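/- Let $H$ be a compact simple Lie group and $K\subset H$ a closed subgroup such that $H/K$ is an irreducible symmetric space, i.e. there is an involutive automorphism $\theta$ of $H$ with $(H^\theta)_0\subset K\subset H^\theta$, and $\mathrm{Ad}(K)$ acts irreducibly on $\mathfrak q\neq 0$, where $\mathfrak h=\mathfrak k\oplus\mathfrak q$ is the orthogonal decomposition with respect to the Killing form $B_{\mathfrak h}$ of $\mathfrak h=\mathrm{Lie}(H)$, with $\mathfrak k=\mathrm{Lie}(K)$. Put $d=\dim K$, $n=\dim H/K$, and let $M=H\times H/\Delta K$, where $\Delta K=\{(k,k):k\in K\}$, so $\dim M=2n+d$. Identify $T_oM$ with $\mathfrak p=\mathfrak p_1\oplus\mathfrak p_2\oplus\mathfrak p_3$, where $\mathfrak p_1=\{(X,0):X\in\mathfrak q\}$, $\mathfrak p_2=\{(0,X):X\in\mathfrak q\}$, $\mathfrak p_3=\{(Z,-Z):Z\in\mathfrak k\}$. For $x_1,x_2,x_3>0$ and $x_4\in\mathbb R$ with $x_1x_2>x_4^2$, denote by $g=(x_1,x_2,x_3,x_4)$ the $H\times H$-invariant Riemannian metric on $M$ given on $T_oM$ by $$g((X_1,X_2),(Y_1,Y_2))=-x_1B_{\mathfrak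 h}(X_1,Y_1)-x_2B_{\mathfrak h}(X_2,Y_2)-x_4\bigl(B_{\mathfrak h}(X_1,Y_2)+B_{\mathfrak h}(X_2,Y_1)\bigr)$$ for $X_i,Y_i\in\mathfrak q$, by $g((Z,-Z),(W,-W))=-2x_3B_{\mathfrak h}(Z,W)$ for $Z,W\in\mathfrak k$, and by $g(\mathfrak p_1\oplus\mathfrak p_2,\mathfrak p_3)=0$. Let $g_K=(1,1,1,0)$ be the standard metric, let $\det_{g_K}g$ be the determinant of $g$ in a $g_K$-orthonormal basis, and let $\mathrm{s}(g)$ be the scalar curvature of $g$. Then for every metric $g=(x_1,x_2,1,x_4)$ with $x_1,x_2>0$ and $x_1x_2>x_4^2$, the normalized scalar curvature $\mathrm{s}_N(g):=\mathrm{s}(g)\,(\det_{g_K}g)^{1/\dim M}$ is (at every point of $M$) $$\mathrm{s}_N(g)=\frac{(x_1x_2-x_4^2)^{\frac{n}{d+2n}}\Bigl(8d(x_4^2-x_1x_2)^2-n\bigl(x_2^2+x_1^2(4x_2^2-8x_2+1)-2x_4^2+8x_2x_4^2-4x_4^4-8x_1(x_2^2-x_4^2)\bigr)\Bigr)}{16(x_4^2-x_1x_2)^2}.$$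 -/

import Mathlib

open scoped Manifold ContDiff Bundle

noncomputable section

/-! ### Scalar curvature and relative determinant of Riemannian metrics -/

section Riemannian

variable {F : Type*} [NormedAddCommGroup F] [NormedSpace ℝ F]

/-- The Christoffel symbol at `y` of a metric `G` on an open subset of the vector space `F`, as a
bilinear expression: `christoffel G y v w` is the vector `Γ(v, w)` such that, for all `z`,
`2 G(Γ(v, w), z) = D_v G (w, z) + D_w G (v, z) - D_z G (v, w)`. -/
def christoffel (G : F → F →L[ℝ] F →L[ℝ] ℝ) (y v w : F) : F :=
  (G y).inverse ((1 / 2 : ℝ) •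
    (fderiv ℝ G y v w + fderiv ℝ G y w v - ((fderiv ℝ G y).flip v).flip w))

/-- The curvature tensor `R(u, v) w = ∇_u ∇_v w - ∇_v ∇_u w` (for constant `u`, `v`, `w`) at `y` of
a metric `G` on an open subset of the vector space `F`. -/
def curvatureTensor (G : F → F →L[ℝ] F →L[ℝ] ℝ) (y u v w : F) : F :=
  fderiv ℝ (fun x ↦ christoffel G x v w) y u - fderiv ℝ (fun x ↦ christoffel G x u w) y v
    + christoffel G y u (christoffel G y v w) - christoffel G y v (christoffel G y u w)

variable [FiniteDimensional ℝ F]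

/-- The Ricci tensor `Ric(v, w)`, the trace of `u ↦ R(u, v) w`. -/
def ricciTensor (G : F → F →L[ℝ] F →L[ℝ] ℝ) (y v w : F) : ℝ :=
  ∑ i, (Module.finBasis ℝ F).coord i (curvatureTensor G y (Module.finBasis ℝ F i) v w)

/-- The Gram matrix of a bilinear form in a fixed basis of `F`. -/
def gramMatrix (B : F →L[ℝ] F →L[ℝ] ℝ) :
    Matrix (Fin (Module.finrank ℝ F)) (Fin (Module.finrank ℝ F)) ℝ :=
  Matrix.of fun i j ↦ B (Module.finBasis ℝ F i) (Module.finBasis ℝ F j)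

/-- The scalar curvature at `y` of a metric `G` on an open subset of the vector space `F`: the
trace of the Ricci tensor with respect to `G`. -/
def scalarCurvatureCoord (G : F → F →L[ℝ] F →L[ℝ] ℝ) (y : F) : ℝ :=
  ∑ i, ∑ j, (gramMatrix (G y))⁻¹ i j *
    ricciTensor G y (Module.finBasis ℝ F i) (Module.finBasis ℝ F j)

/-- The determinant of the bilinear form `B` relative to the inner product `B₀`, that is, the
determinant of the matrix of `B` in a `B₀`-orthonormal basis. -/
def relDet (B₀ B : F →L[ℝ] F →L[ℝ] ℝ) : ℝ :=
  (gramMatrix B).det / (gramMatrix B₀).det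

variable {M : Type*} [TopologicalSpace M] [ChartedSpace F M] [IsManifold 𝓘(ℝ, F) ∞ M]

variable (F M) in
/-- Smooth Riemannian metrics on the manifold `M`. -/
abbrev RiemMetric : Type _ :=
  Bundle.ContMDiffRiemannianMetric 𝓘(ℝ, F) ∞ F (fun p : M ↦ TangentSpace 𝓘(ℝ, F) p)

/-- The expression of the metric `g` in the preferred chart at `p`. -/
def coordMetric (g : RiemMetric F M) (p : M) (y : F) : F →L[ℝ] F →L[ℝ] ℝ :=
  let φ := extChartAt 𝓘(ℝ, F) p
  let A : F →L[ℝ] F := mfderiv 𝓘(ℝ, F) 𝓘(ℝ, F) φ.symm y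
  let B : F →L[ℝ] F →L[ℝ] ℝ := g.inner (φ.symm y)
  B.bilinearComp A A

/-- The scalar curvature of the Riemannian metric `g` at `p`. -/
def scalarCurvature (g : RiemMetric F M) (p : M) : ℝ :=
  scalarCurvatureCoord (coordMetric g p) (extChartAt 𝓘(ℝ, F) p p)

/-- The normalized scalar curvature `s_N(g) = s(g) (det_{g₀} g) ^ (1 / dim M)` at `p`, where `g₀`
is a background metric. -/
def normalizedScalarCurvature (g₀ g : RiemMetric F M) (p : M) : ℝ :=
  scalarCurvature g p * relDet (F := F) (g₀.inner p) (g.inner p) ^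
    ((1 : ℝ) / (Module.finrank ℝ F : ℝ))

end Riemannian

/-! ### Symmetric pairs -/

section SymmetricPair

variable {E : Type*} [NormedAddCommGroup E] [NormedSpace ℝ E] [FiniteDimensional ℝ E]
  {H : Type*} [TopologicalSpace H] [ChartedSpace E H] [Group H] [LieGroup 𝓘(ℝ, E) ∞ H]

instance instLieGroupMinSmoothnessThree : LieGroup 𝓘(ℝ, E) (minSmoothness ℝ 3) H :=
  LieGroup.of_le (n := ∞) (by simpa using ENat.LEInfty.out (m := (3 : ℕ∞ω)))

variable (E) in
/-- The Lie algebra of the closed subgroup `K` of `H`: the space of velocities at the identity of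
curves in `K` through the identity. -/
def subgroupLieAlgebra (K : Subgroup H) : Submodule ℝ (GroupLieAlgebra 𝓘(ℝ, E) H) :=
  Submodule.span ℝ {v | ∃ γ : ℝ → H, (∀ t, γ t ∈ K) ∧ γ 0 = 1 ∧
    MDifferentiableAt 𝓘(ℝ, ℝ) 𝓘(ℝ, E) γ 0 ∧ mfderiv 𝓘(ℝ, ℝ) 𝓘(ℝ, E) γ 0 (1 : ℝ) = v}

variable (E) in
/-- The orthogonal complement `𝔮` of the Lie algebra of `K` with respect to the Killing form of
the Lie algebra of `H`. -/
def killingComplement (K : Subgroup H) : Submodule ℝ (GroupLieAlgebra 𝓘(ℝ, E) H) :=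
  (killingForm ℝ (GroupLieAlgebra 𝓘(ℝ, E) H)).orthogonal (subgroupLieAlgebra E K)

/-- The adjoint representation of the Lie group `H` on its Lie algebra. -/
def adjointRep (h : H) (v : GroupLieAlgebra 𝓘(ℝ, E) H) : GroupLieAlgebra 𝓘(ℝ, E) H :=
  mfderiv 𝓘(ℝ, E) 𝓘(ℝ, E) (fun x : H ↦ h * x * h⁻¹) 1 v

variable (E) in
/-- `H / K` is an irreducible symmetric space: `K` is a closed subgroup which lies between the
fixed-point group of a smooth involutive automorphism `θ` of `H` and its identity component, and
the isotropy representation `𝔮` of `K` is nonzero and irreducible. -/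
structure IsIrreducibleSymmetric (K : Subgroup H) : Prop where
  isClosed : IsClosed (K : Set H)
  exists_involution : ∃ θ : H →* H, ContMDiff 𝓘(ℝ, E) 𝓘(ℝ, E) ∞ θ ∧ (∀ h, θ (θ h) = h) ∧
    (∃ h, θ h ≠ h) ∧ (∀ k ∈ K, θ k = k) ∧ connectedComponentIn {h | θ h = h} 1 ⊆ (K : Set H)
  ne_bot : killingComplement E K ≠ ⊥
  irreducible : ∀ V : Submodule ℝ (GroupLieAlgebra 𝓘(ℝ, E) H), V ≤ killingComplement E K →
    (∀ k ∈ K, ∀ v ∈ V, adjointRep k v ∈ V) → V = ⊥ ∨ V = killingComplement E K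

end SymmetricPair

/-! ### The homogeneous space `H × H / ΔK` and its invariant metrics -/

section HomogeneousSpace

/-- The diagonal subgroup `ΔK` of `H × H`. -/
def diagSubgroup {H : Type*} [Group H] (K : Subgroup H) : Subgroup (H × H) :=
  K.map ((MonoidHom.id H).prod (MonoidHom.id H))

/-- The homogeneous space `H × H / ΔK`. -/
abbrev DiagQuotient {H : Type*} [Group H] (K : Subgroup H) : Type _ :=
  (H × H) ⧸ diagSubgroup K

variable {E : Type*} [NormedAddCommGroup E] [NormedSpace ℝ E] [FiniteDimensional ℝ E]
  {H : Type*} [TopologicalSpace H] [ChartedSpace E H] [Group H] [LieGroup 𝓘(ℝ, E) ∞ H]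
  {F : Type*} [NormedAddCommGroup F] [NormedSpace ℝ F]
  {K : Subgroup H} [ChartedSpace F (DiagQuotient K)]

variable [IsManifold 𝓘(ℝ, F) ∞ (DiagQuotient K)]

variable (E F K) in
/-- The smooth manifold structure on `H × H / ΔK` is the one of a homogeneous space: the action of
`H × H` is smooth and the projection from `H × H` is a smooth submersion. (There is exactly one
such structure.) -/
structure IsHomogeneousManifold : Prop where
  contMDiffSMul : ContMDiffSMul (𝓘(ℝ, E).prod 𝓘(ℝ, E)) 𝓘(ℝ, F) ∞ (H × H) (DiagQuotient K)
  contMDiff_mk : ContMDiff (𝓘(ℝ, E).prod 𝓘(ℝ, E)) 𝓘(ℝ, F) ∞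
    (fun a : H × H ↦ (a : DiagQuotient K))
  surjective_mfderiv_mk : ∀ a : H × H, Function.Surjective
    (mfderiv (𝓘(ℝ, E).prod 𝓘(ℝ, E)) 𝓘(ℝ, F) (fun a : H × H ↦ (a : DiagQuotient K)) a)

variable (F K) in
/-- The image of `(X, Y)` in the tangent space of `H × H / ΔK` at the base point under the
derivative of the projection. -/
def projDeriv (X Y : GroupLieAlgebra 𝓘(ℝ, E) H) :
    TangentSpace 𝓘(ℝ, F) (((1 : H × H)) : DiagQuotient K) :=
  mfderiv (𝓘(ℝ, E).prod 𝓘(ℝ, E)) 𝓘(ℝ, F) (fun a : H × H ↦ (a : DiagQuotient K)) (1 : H × H)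
    ((X, Y) : E × E)

/-- The Riemannian metric `g` on `H × H / ΔK` is invariant under the action of `H × H`. -/
def IsInvariantMetric (g : RiemMetric F (DiagQuotient K)) : Prop :=
  ∀ (a : H × H) (p : DiagQuotient K) (u v : TangentSpace 𝓘(ℝ, F) p),
    g.inner (a • p) (mfderiv 𝓘(ℝ, F) 𝓘(ℝ, F) (fun x : DiagQuotient K ↦ a • x) p u)
      (mfderiv 𝓘(ℝ, F) 𝓘(ℝ, F) (fun x : DiagQuotient K ↦ a • x) p v) = g.inner p u v

variable (E) in
/-- The invariant metric `g = (x₁, x₂, x₃, x₄)` on `H × H / ΔK`. With `𝔭₁ = (𝔮, 0)`, `𝔭₂ = (0, 𝔮)`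
and `𝔭₃ = {(Z, -Z) : Z ∈ 𝔨}`, it is `x₁`, `x₂`, `x₃` times minus the Killing form of `𝔥 ⊕ 𝔥` on
`𝔭₁`, `𝔭₂`, `𝔭₃`, it pairs `(X, 0)` with `(0, Y)` to `x₄` times minus the Killing form of `𝔥`, and
`𝔭₃` is orthogonal to `𝔭₁` and `𝔭₂`. -/
structure IsMetricOfForm (g : RiemMetric F (DiagQuotient K)) (x₁ x₂ x₃ x₄ : ℝ) : Prop where
  invariant : IsInvariantMetric g
  inner₁₁ : ∀ X ∈ killingComplement E K, ∀ Y ∈ killingComplement E K,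
    g.inner _ (projDeriv F K X 0) (projDeriv F K Y 0) =
      x₁ * -(killingForm ℝ (GroupLieAlgebra 𝓘(ℝ, E) H) X Y)
  inner₂₂ : ∀ X ∈ killingComplement E K, ∀ Y ∈ killingComplement E K,
    g.inner _ (projDeriv F K 0 X) (projDeriv F K 0 Y) =
      x₂ * -(killingForm ℝ (GroupLieAlgebra 𝓘(ℝ, E) H) X Y)
  inner₃₃ : ∀ Z ∈ subgroupLieAlgebra E K, ∀ W ∈ subgroupLieAlgebra E K,
    g.inner _ (projDeriv F K Z (-Z)) (projDeriv F K W (-W)) =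
      x₃ * -(killingForm ℝ (GroupLieAlgebra 𝓘(ℝ, E) H) Z W
        + killingForm ℝ (GroupLieAlgebra 𝓘(ℝ, E) H) (-Z) (-W))
  inner₁₂ : ∀ X ∈ killingComplement E K, ∀ Y ∈ killingComplement E K,
    g.inner _ (projDeriv F K X 0) (projDeriv F K 0 Y) =
      x₄ * -(killingForm ℝ (GroupLieAlgebra 𝓘(ℝ, E) H) X Y)
  inner₁₃ : ∀ X ∈ killingComplement E K, ∀ Z ∈ subgroupLieAlgebra E K,
    g.inner _ (projDeriv F K X 0) (projDeriv F K Z (-Z)) = 0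
  inner₂₃ : ∀ X ∈ killingComplement E K, ∀ Z ∈ subgroupLieAlgebra E K,
    g.inner _ (projDeriv F K 0 X) (projDeriv F K Z (-Z)) = 0

end HomogeneousSpace

end

/-! Write `π : H × H → M` for the projection. Near any point of `M` a local section of `a • π` pulls
the Maurer–Cartan form of `H × H` back to a form `α` with values in `𝔥 ⊕ 𝔥` and `dα = -[α, α]`. By
invariance the coordinate metric is `Q(α, α)`, where `Q` is the pullback of the inner product at the
base point: a form on `𝔥 ⊕ 𝔥` whose kernel is `Δ𝔨` and which is `ad(Δ𝔨)`-invariant. The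
`Q`-coefficients of `α` in a `Q`-orthonormal frame `ε` form an orthonormal coframe. The Koszul
formula gives a skew, torsion-free connection form `Ω₀ ∘ α` with `Ω₀` constant, so by Cartan's
second structure equation the curvature is `[Ω₀(a), Ω₀(c)] - Ω₀([a, c])`. Taking traces gives the
scalar curvature in terms of structure constants and double brackets
(`scalarCurvatureCoord_of_maurerCartan`). The double brackets `Q([[εᵢ, εⱼ], εⱼ], εᵢ)` account for
the isotropy part of `[εᵢ, εⱼ]`, which `Q` does not see.

For the frame adapted to `𝔮 ⊕ 𝔮 ⊕ 𝔨` every sum is a polynomial in the inverse of the matrix `(x₁,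
x₄; x₄, x₂)` times `A = ∑ ⟨[Xᵢ, Xⱼ], Zₐ⟩²`, up to a multiple of `C = ∑ ⟨[Zₐ, Z_b], Z_c⟩²`. The
Killing form is the trace of `ad²`, and this yields `2A = n` and `A + C = d`
(`IsSymmetricFrame.sum_sq_br`), so only `n` and `d` survive (`IsSymmetricFrame.scalar_sum`).

The relations `[𝔮, 𝔮] ⊆ 𝔨` and `[𝔨, 𝔨] ⊆ 𝔨` follow from `𝔨` and `𝔮` being the `±1`-eigenspaces of
`dθ`. Definiteness of the Killing form on each of them is read off from the positivity of the
standard metric (`killingForm_neg_of_mem`, `killingForm_neg_of_mem_complement`). The volume factor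
is the Gram determinant of the same frame, `(x₁x₂ - x₄²)ⁿ`. -/

noncomputable section

/-! ### Cartan's structure equations for a metric given by a coframe. -/

section Coframe

variable {F : Type*} [NormedAddCommGroup F] [NormedSpace ℝ F] [FiniteDimensional ℝ F]
  {P : Type*} [NormedAddCommGroup P] [NormedSpace ℝ P]

/-- In finite dimension an injective map into the dual is invertible, so `inverse` is the true
inverse and not its default value `0`. -/
theorem inverse_apply_of_injective (B : F →L[ℝ] F →L[ℝ] ℝ) (hB : Function.Injective B) (x : F) :
    B.inverse (B x) = x := by
  have hdim : Module.finrank ℝ F = Module.finrank ℝ (F →L[ℝ] ℝ) := by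
    rw [← (LinearMap.toContinuousLinearMap (𝕜 := ℝ) (E := F) (F' := ℝ)).finrank_eq]
    exact Subspace.dual_finrank_eq.symm
  let L : F ≃ₗ[ℝ] (F →L[ℝ] ℝ) := LinearMap.linearEquivOfInjective (B : F →ₗ[ℝ] F →L[ℝ] ℝ) hB hdim
  have h : B = (L.toContinuousLinearEquiv : F →L[ℝ] F →L[ℝ] ℝ) := by
    ext x y; rfl
  rw [h, ContinuousLinearMap.inverse_equiv]
  simp

variable {b : P →L[ℝ] P →L[ℝ] ℝ} {G : F → F →L[ℝ] F →L[ℝ] ℝ} {e : F → F →L[ℝ] P} {y : F}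

omit [FiniteDimensional ℝ F] in
theorem fderiv_bilinearComp_apply (he : DifferentiableAt ℝ e y) (u v w : F) :
    fderiv ℝ (fun z ↦ b.bilinearComp (e z) (e z)) y u v w =
      b (fderiv ℝ e y u v) (e y w) + b (e y v) (fderiv ℝ e y u w) := by
  have h0 : DifferentiableAt ℝ (fun z ↦ b.bilinearComp (e z) (e z)) y := by
    have : (fun z ↦ b.bilinearComp (e z) (e z)) =
        fun z ↦ ((ContinuousLinearMap.compL ℝ F P ℝ).flip (e z)).comp (b.comp (e z)) := by
      ext; simp
    rw [this]
    fun_prop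
  have h1 : HasFDerivAt (fun z ↦ b (e z v) (e z w)) _ y :=
    (((b.hasFDerivAt (x := e y v)).comp y ((he.hasFDerivAt.clm_apply
      (hasFDerivAt_const v y)))).clm_apply (he.hasFDerivAt.clm_apply (hasFDerivAt_const w y)))
  have h2 : HasFDerivAt (fun z ↦ b (e z v) (e z w)) _ y :=
    ((h0.hasFDerivAt.clm_apply (hasFDerivAt_const v y)).clm_apply (hasFDerivAt_const w y))
  have := congrArg (fun L : F →L[ℝ] ℝ ↦ L u) (h2.unique h1)
  simp at this
  rw [this]; ring

/-- The Christoffel symbols of a metric which is the pullback of a constant form `b` under a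
coframe `e`, in terms of the torsion-free and skew connection form `Ω`. -/
theorem coframe_christoffel (hb : ∀ x z, b x z = b z x) (hb' : ∀ x, (∀ z, b x z = 0) → x = 0)
    (hG : G =ᶠ[nhds y] fun z ↦ b.bilinearComp (e z) (e z)) (he : DifferentiableAt ℝ e y)
    (hinv : (e y).IsInvertible) {Ω : F → P → P}
    (tors : ∀ u v, fderiv ℝ e y u v - fderiv ℝ e y v u + Ω u (e y v) - Ω v (e y u) = 0)
    (skew : ∀ u x z, b (Ω u x) z + b x (Ω u z) = 0) (v w : F) :
    e y (christoffel G y v w) = fderiv ℝ e y v w + Ω v (e y w) := by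
  obtain ⟨e', he'⟩ := hinv
  have hinj : Function.Injective (G y) := by
    rw [injective_iff_map_eq_zero]
    intro x hx
    apply e'.injective
    rw [map_zero]
    refine hb' _ fun z ↦ ?_
    have := congrArg (fun L : F →L[ℝ] ℝ ↦ L (e'.symm z)) hx
    simpa [hG.self_of_nhds, ← he'] using this
  have key : christoffel G y v w = e'.symm (fderiv ℝ e y v w + Ω v (e y w)) := by
    -- Under `G y` the claim becomes an identity of functionals. As in the uniqueness proof for the
    -- Levi-Civita connection, it is a combination of three torsion identities and three skewness
    -- identities.
    rw [← inverse_apply_of_injective (G y) hinj (e'.symm _), christoffel]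
    congr 1
    ext z
    simp only [hG.fderiv_eq, fderiv_bilinearComp_apply he, hG.self_of_nhds,
      smul_apply, sub_apply, add_apply,
      ContinuousLinearMap.flip_apply, ContinuousLinearMap.bilinearComp_apply, smul_eq_mul]
    have e1 : e y (e'.symm (fderiv ℝ e y v w + Ω v (e y w))) = fderiv ℝ e y v w + Ω v (e y w) := by
      rw [← he']; simp
    rw [e1]
    have t1 := congrArg (fun x ↦ b x (e y v)) (tors w z)
    have t2 := congrArg (fun x ↦ b x (e y w)) (tors v z)
    have t3 := congrArg (fun x ↦ b x (e y z)) (tors v w)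
    simp only [map_add, map_sub, map_zero, add_apply,
      sub_apply, zero_apply] at t1 t2 t3 ⊢
    have s1 := skew v (e y w) (e y z)
    have s2 := skew w (e y v) (e y z)
    have s3 := skew z (e y v) (e y w)
    rw [hb (e y v) (fderiv ℝ e y w z), hb (e y w) (fderiv ℝ e y v z),
      hb (e y v) (fderiv ℝ e y z w)]
    rw [hb (e y w) (Ω v (e y z))] at s1
    rw [hb (e y v) (Ω w (e y z))] at s2
    rw [hb (e y v) (Ω z (e y w))] at s3
    linarith
  rw [key, ← he']
  simp

/-- The curvature tensor of a metric in terms of a coframe and a connection form. -/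
theorem coframe_curvatureTensor (hb : ∀ x z, b x z = b z x) (hb' : ∀ x, (∀ z, b x z = 0) → x = 0)
    (hG : G =ᶠ[nhds y] fun z ↦ b.bilinearComp (e z) (e z)) (he : ContDiffAt ℝ 2 e y)
    (hinv : (e y).IsInvertible) {Ω : F → F →L[ℝ] P →L[ℝ] P} (hΩ : DifferentiableAt ℝ Ω y)
    (tors : ∀ᶠ z in nhds y, ∀ u v,
      fderiv ℝ e z u v - fderiv ℝ e z v u + Ω z u (e z v) - Ω z v (e z u) = 0)
    (skew : ∀ᶠ z in nhds y, ∀ u x x', b (Ω z u x) x' + b x (Ω z u x') = 0) (u v w : F) :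
    e y (curvatureTensor G y u v w) = fderiv ℝ Ω y u v (e y w) - fderiv ℝ Ω y v u (e y w)
      + Ω y u (Ω y v (e y w)) - Ω y v (Ω y u (e y w)) := by
  have hed : ∀ᶠ z in nhds y, DifferentiableAt ℝ e z := by
    filter_upwards [he.eventually (by simp)] with z hz using hz.differentiableAt (by simp)
  have hinv' : ∀ᶠ z in nhds y, (e z).IsInvertible := by
    obtain ⟨e', he'⟩ := hinv
    have := he.continuousAt.eventually (he' ▸ ContinuousLinearEquiv.nhds e')
    filter_upwards [this] with z hz using hz
  have hΓ : ∀ᶠ z in nhds y, ∀ v w,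
      e z (christoffel G z v w) = fderiv ℝ e z v w + Ω z v (e z w) := by
    filter_upwards [hG.eventually_nhds, hed, hinv', tors, skew] with z h1 h2 h3 h4 h5 v w
    exact coframe_christoffel (Ω := fun u x ↦ Ω z u x) hb hb' h1 h2 h3 h4 h5 v w
  have hede : DifferentiableAt ℝ (fderiv ℝ e) y :=
    (he.fderiv_right (m := 1) (by norm_num)).differentiableAt (by simp)
  have heD := hed.self_of_nhds
  have hN (v w : F) : DifferentiableAt ℝ (fun z ↦ fderiv ℝ e z v w + Ω z v (e z w)) y := by
    fun_prop
  have hΓd (v w : F) : DifferentiableAt ℝ (fun z ↦ christoffel G z v w) y := by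
    have h1 : (fun z ↦ christoffel G z v w) =ᶠ[nhds y]
        fun z ↦ (e z).inverse (fderiv ℝ e z v w + Ω z v (e z w)) := by
      filter_upwards [hΓ, hinv'] with z hz hz'
      obtain ⟨e', he'⟩ := hz'
      rw [← hz, ← he', ContinuousLinearMap.inverse_equiv]
      simp
    refine DifferentiableAt.congr_of_eventuallyEq ?_ h1
    refine DifferentiableAt.clm_apply ?_ (hN v w)
    obtain ⟨e', he'⟩ := hinv
    exact ((he' ▸ contDiffAt_map_inverse (n := 1) e').differentiableAt (by simp)).comp y heD
  -- Differentiate `e (Γ(v, w)) = D_v e (w) + Ω(v) (e w)` by the product rule. The second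
  -- derivatives of `e` cancel by symmetry once `u` and `v` are antisymmetrized.
  have hD (u v w : F) : e y (fderiv ℝ (fun z ↦ christoffel G z v w) y u) =
      fderiv ℝ (fderiv ℝ e) y u v w + fderiv ℝ Ω y u v (e y w) + Ω y v (fderiv ℝ e y u w)
        - fderiv ℝ e y u (christoffel G y v w) := by
    have h1 : HasFDerivAt (fun z ↦ e z (christoffel G z v w)) _ y :=
      heD.hasFDerivAt.clm_apply (hΓd v w).hasFDerivAt
    have h2 : HasFDerivAt (fun z ↦ fderiv ℝ e z v w + Ω z v (e z w)) _ y :=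
      ((hede.hasFDerivAt.clm_apply (hasFDerivAt_const v y)).clm_apply (hasFDerivAt_const w y)).add
        ((hΩ.hasFDerivAt.clm_apply (hasFDerivAt_const v y)).clm_apply
          (heD.hasFDerivAt.clm_apply (hasFDerivAt_const w y)))
    have h3 := h2.congr_of_eventuallyEq (f₁ := fun z ↦ e z (christoffel G z v w))
      (by filter_upwards [hΓ] with z hz using hz v w)
    have := congrArg (fun L : F →L[ℝ] P ↦ L u) (h1.unique h3)
    simp only [add_apply, ContinuousLinearMap.comp_apply, ContinuousLinearMap.flip_apply,
      zero_apply, map_zero, zero_add] at this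
    rw [eq_sub_iff_add_eq, this]
    abel
  have hsymm : fderiv ℝ (fderiv ℝ e) y u v w = fderiv ℝ (fderiv ℝ e) y v u w := by
    rw [(he.isSymmSndFDerivAt (by simp)).eq u v]
  have hΓy := hΓ.self_of_nhds
  simp only [curvatureTensor, map_add, map_sub, hD, hΓy, hsymm]
  abel

end Coframe

/-! ### Scalar curvature and relative determinant in an arbitrary basis. -/

section Traces

variable {F : Type*} [NormedAddCommGroup F] [NormedSpace ℝ F] [FiniteDimensional ℝ F]
  {ι : Type*} [Fintype ι] [DecidableEq ι]

omit [DecidableEq ι] in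
theorem gramMatrix_eq_basis (f : Module.Basis ι ℝ F) (B : F →L[ℝ] F →L[ℝ] ℝ) :
    gramMatrix B = (f.toMatrix (Module.finBasis ℝ F)).transpose *
      (Matrix.of fun i j ↦ B (f i) (f j)) * f.toMatrix (Module.finBasis ℝ F) := by
  ext i j
  have h (k) : Module.finBasis ℝ F k = ∑ l, f.toMatrix (Module.finBasis ℝ F) l k • f l :=
    (f.sum_toMatrix_smul_self _ k).symm
  simp only [gramMatrix, Matrix.of_apply, Matrix.mul_apply, Matrix.transpose_apply]
  rw [h i, h j]
  simp only [map_sum, map_smul, sum_apply, smul_apply,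
    smul_eq_mul, Finset.mul_sum, Finset.sum_mul]
  refine Finset.sum_congr rfl fun k _ ↦ Finset.sum_congr rfl fun l _ ↦ ?_
  ring

/-- A change of basis multiplies both Gram determinants by the same nonzero square, which cancels in
the quotient. -/
theorem relDet_eq_basis (f : Module.Basis ι ℝ F) (B₀ B : F →L[ℝ] F →L[ℝ] ℝ) :
    relDet B₀ B = (Matrix.of fun i j ↦ B (f i) (f j)).det /
      (Matrix.of fun i j ↦ B₀ (f i) (f j)).det := by
  let σ : ι ≃ Fin (Module.finrank ℝ F) := f.indexEquiv (Module.finBasis ℝ F)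
  have h (B : F →L[ℝ] F →L[ℝ] ℝ) : (gramMatrix B).det =
      ((f.reindex σ).toMatrix (Module.finBasis ℝ F)).det ^ 2 *
        (Matrix.of fun i j ↦ B (f i) (f j)).det := by
    rw [gramMatrix_eq_basis (f.reindex σ), Matrix.det_mul, Matrix.det_mul, Matrix.det_transpose,
      ← Matrix.det_submatrix_equiv_self σ.symm (Matrix.of fun i j ↦ B (f i) (f j))]
    have : (Matrix.of fun i j ↦ B (f.reindex σ i) (f.reindex σ j)) =
      (Matrix.of fun i j ↦ B (f i) (f j)).submatrix σ.symm σ.symm := by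
      ext i j; simp
    rw [this]; ring
  have hne : ((f.reindex σ).toMatrix (Module.finBasis ℝ F)).det ≠ 0 := by
    have := congrArg Matrix.det
      (Module.Basis.toMatrix_mul_toMatrix_flip (f.reindex σ) (Module.finBasis ℝ F))
    rw [Matrix.det_mul, Matrix.det_one] at this
    exact left_ne_zero_of_mul_eq_one this
  rw [relDet, h, h, mul_div_mul_left _ _ (pow_ne_zero 2 hne)]

/-- The scalar curvature is the sum of the sectional curvature terms of an orthonormal basis. -/
theorem scalarCurvatureCoord_eq_basis {G : F → F →L[ℝ] F →L[ℝ] ℝ} {y : F}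
    (f : Module.Basis ι ℝ F) (hf : ∀ i j, G y (f i) (f j) = if i = j then 1 else 0)
    (R : F →ₗ[ℝ] F →ₗ[ℝ] F →ₗ[ℝ] F) (hR : ∀ u v w, curvatureTensor G y u v w = R u v w) :
    scalarCurvatureCoord G y = ∑ i, ∑ j, f.coord i (R (f i) (f j) (f j)) := by
  -- As a trace, the Ricci form can be evaluated both in `finBasis`, as in its definition, and in
  -- `f`.
  let ric : F →ₗ[ℝ] F →ₗ[ℝ] ℝ := LinearMap.mk₂ ℝ
    (fun v w ↦ LinearMap.trace ℝ F ((R.flip v).flip w))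
    (fun _ _ _ ↦ by rw [← map_add]; congr 1; ext; simp)
    (fun _ _ _ ↦ by rw [← map_smul]; congr 1; ext; simp)
    (fun _ _ _ ↦ by rw [← map_add]; congr 1; ext; simp)
    (fun _ _ _ ↦ by rw [← map_smul]; congr 1; ext; simp)
  have hric {κ : Type} [Fintype κ] [DecidableEq κ] (c : Module.Basis κ ℝ F) (v w : F) :
      ric v w = ∑ i, c.coord i (R (c i) v w) := by
    simp [ric, LinearMap.trace_eq_matrix_trace ℝ c, Matrix.trace, LinearMap.toMatrix_apply]
  have hricf (v w : F) : ric v w = ∑ i, f.coord i (R (f i) v w) := by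
    simp [ric, LinearMap.trace_eq_matrix_trace ℝ f, Matrix.trace, LinearMap.toMatrix_apply]
  have hRic (v w : F) : ricciTensor G y v w = ric v w := by
    simp only [ricciTensor, hric (Module.finBasis ℝ F), hR]
  set b := Module.finBasis ℝ F with hbdef
  set p := f.toMatrix b with hp
  set q := b.toMatrix f with hq
  have hpq : p * q = 1 := f.toMatrix_mul_toMatrix_flip b
  have hqp : q * p = 1 := b.toMatrix_mul_toMatrix_flip f
  have hgram : gramMatrix (G y) = p.transpose * p := by
    rw [gramMatrix_eq_basis f]
    have : (Matrix.of fun i j ↦ G y (f i) (f j)) = 1 := by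
      ext i j; simp [hf, Matrix.one_apply]
    rw [this, Matrix.mul_one]
  have hinv : (gramMatrix (G y))⁻¹ = q * q.transpose := by
    apply Matrix.inv_eq_right_inv
    rw [hgram, Matrix.mul_assoc, ← Matrix.mul_assoc p, hpq, Matrix.one_mul,
      ← Matrix.transpose_mul, hqp, Matrix.transpose_one]
  have hfq (k) : f k = ∑ i, q i k • b i := (b.sum_toMatrix_smul_self f k).symm
  rw [Finset.sum_comm]
  simp only [← hricf]
  have h1 (k) : ric (f k) (f k) = ∑ i, ∑ j, q i k * q j k * ric (b i) (b j) := by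
    rw [hfq k]
    simp only [map_sum, map_smul, LinearMap.sum_apply, LinearMap.smul_apply, smul_eq_mul,
      Finset.mul_sum]
    rw [Finset.sum_comm]
    refine Finset.sum_congr rfl fun k _ ↦ Finset.sum_congr rfl fun l _ ↦ ?_
    ring
  simp only [h1, scalarCurvatureCoord, hRic, hinv, Matrix.mul_apply, Matrix.transpose_apply,
    Finset.sum_mul]
  symm
  rw [Finset.sum_comm]
  refine Finset.sum_congr rfl fun i _ ↦ ?_
  rw [Finset.sum_comm]

end Traces

/-! ### Scalar curvature of a homogeneous space from its Maurer–Cartan form. -/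

section MaurerCartan

variable {F : Type*} [NormedAddCommGroup F] [NormedSpace ℝ F] [FiniteDimensional ℝ F]
  {V : Type*} [NormedAddCommGroup V] [NormedSpace ℝ V]
  {ι : Type*} [Fintype ι] [DecidableEq ι]

omit [DecidableEq ι] in
theorem sum_cyclic (f : ι → ι → ι → ℝ) :
    ∑ i, ∑ j, ∑ k, f j k i = ∑ i, ∑ j, ∑ k, f i j k := by
  rw [Finset.sum_comm]
  refine Finset.sum_congr rfl fun i _ ↦ ?_
  rw [Finset.sum_comm]

omit [FiniteDimensional ℝ F] in
theorem fderiv_const_clm_comp_apply {W : Type*} [NormedAddCommGroup W] [NormedSpace ℝ W]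
    (L : V →L[ℝ] W) {α : F → F →L[ℝ] V} {z : F} (hα : DifferentiableAt ℝ α z) (u v : F) :
    fderiv ℝ (fun x ↦ L.comp (α x)) z u v = L (fderiv ℝ α z u v) := by
  have h : HasFDerivAt (fun x ↦ L.comp (α x)) _ z :=
    (hasFDerivAt_const L z).clm_comp hα.hasFDerivAt
  rw [h.fderiv]; simp

/-- The matrix entries of the Levi-Civita connection of a homogeneous space in terms of the Lie
bracket `β` and the inner product `Q`, given by the Koszul formula. -/
def koszulCoeff (β : V →L[ℝ] V →L[ℝ] V) (Q : V →L[ℝ] V →L[ℝ] ℝ) (x z : V) : V →L[ℝ] ℝ :=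
  (1 / 2 : ℝ) • ((Q.flip z).comp (β.flip x) + (Q.flip x).comp (β z) + Q (β z x))

theorem koszulCoeff_apply (β : V →L[ℝ] V →L[ℝ] V) (Q : V →L[ℝ] V →L[ℝ] ℝ) (a x z : V) :
    koszulCoeff β Q x z a = (Q (β a x) z + Q (β z a) x + Q (β z x) a) / 2 := by
  simp [koszulCoeff]; ring

/-- The Levi-Civita connection form of a homogeneous space in an orthonormal frame `ε`. -/
def koszulForm (β : V →L[ℝ] V →L[ℝ] V) (Q : V →L[ℝ] V →L[ℝ] ℝ) (ε : ι → V) :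
    V →L[ℝ] (ι → ℝ) →L[ℝ] (ι → ℝ) :=
  ∑ j, ∑ k, (koszulCoeff β Q (ε j) (ε k)).smulRight
    ((ContinuousLinearMap.proj j : (ι → ℝ) →L[ℝ] ℝ).smulRight (Pi.single k 1 : ι → ℝ))

theorem koszulForm_apply (β : V →L[ℝ] V →L[ℝ] V) (Q : V →L[ℝ] V →L[ℝ] ℝ) (ε : ι → V)
    (a : V) (x : ι → ℝ) (k : ι) :
    koszulForm β Q ε a x k = ∑ j, koszulCoeff β Q (ε j) (ε k) a * x j := by
  simp [koszulForm, Finset.sum_apply, Pi.single_apply, sum_apply]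

/-- The standard dot product as a continuous bilinear form. -/
def dotForm (ι : Type*) [Fintype ι] : (ι → ℝ) →L[ℝ] (ι → ℝ) →L[ℝ] ℝ :=
  ∑ j, (ContinuousLinearMap.proj j : (ι → ℝ) →L[ℝ] ℝ).smulRight
    (ContinuousLinearMap.proj j : (ι → ℝ) →L[ℝ] ℝ)

omit [DecidableEq ι] in
theorem dotForm_apply (x z : ι → ℝ) : dotForm ι x z = ∑ j, x j * z j := by
  simp [dotForm, sum_apply]

variable {β : V →L[ℝ] V →L[ℝ] V} {Q : V →L[ℝ] V →L[ℝ] ℝ} {ε : ι → V}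
  {α : F → F →L[ℝ] V} {G : F → F →L[ℝ] F →L[ℝ] ℝ} {y : F}

omit [DecidableEq ι] in
-- Parseval's identity: `ε` is complete modulo the kernel of `Q`.
theorem apply_eq_sum_of_frame (hQ : ∀ a c, Q a c = Q c a)
    (hker : ∀ a z, Q (a - ∑ j, Q a (ε j) • ε j) z = 0) (a c : V) :
    Q a c = ∑ j, Q a (ε j) * Q c (ε j) := by
  have := hker a c
  simp only [map_sub, map_sum, map_smul, sub_apply, sum_apply, smul_apply, smul_eq_mul,
    sub_eq_zero] at this
  rw [this]
  exact Finset.sum_congr rfl fun j _ ↦ by rw [hQ c]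

/-- Combined with `dα = -[α, α]`, this says that the connection form has no torsion. The Koszul
coefficients are antisymmetrized as usual; invariance under the kernel of `Q` is what permits
arguments with a vertical component. -/
theorem koszulForm_torsion (hβ : ∀ a c, β a c = -β c a) (hQ : ∀ a c, Q a c = Q c a)
    (hker : ∀ a z, Q (a - ∑ j, Q a (ε j) • ε j) z = 0)
    (hinv : ∀ l, (∀ z, Q l z = 0) → ∀ a c, Q (β l a) c + Q a (β l c) = 0) (a c : V) :
    (fun k ↦ Q (β a c) (ε k)) =
      koszulForm β Q ε a (fun k ↦ Q c (ε k)) - koszulForm β Q ε c (fun k ↦ Q a (ε k)) := by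
  have key (a c : V) (k : ι) : koszulForm β Q ε a (fun k ↦ Q c (ε k)) k =
      koszulCoeff β Q c (ε k) a := by
    rw [koszulForm_apply]
    set l := c - ∑ j, Q c (ε j) • ε j with hl
    have hc : c = l + ∑ j, Q c (ε j) • ε j := by simp [hl]
    -- The vertical part `l` contributes nothing: one Koszul term pairs with `l`, and the other two
    -- cancel because `ad l` is skew for `Q`.
    have hl0 : koszulCoeff β Q l (ε k) a = 0 := by
      rw [koszulCoeff_apply, hβ a l, hβ (ε k) l, hQ (β (ε k) a) l, hker c (β (ε k) a)]
      have := hinv l (hker c) a (ε k)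
      rw [hQ a] at this
      simp only [map_neg, neg_apply]
      linarith
    have hlin : koszulCoeff β Q c (ε k) a = koszulCoeff β Q l (ε k) a +
        ∑ j, Q c (ε j) * koszulCoeff β Q (ε j) (ε k) a := by
      conv_lhs => rw [hc]
      simp only [koszulCoeff_apply, map_add, map_sum, map_smul, add_apply, sum_apply, smul_apply,
        smul_eq_mul]
      rw [← sub_eq_iff_eq_add']
      simp only [mul_div_assoc', ← Finset.sum_div, mul_add, Finset.sum_add_distrib]
      ring
    rw [hlin, hl0, zero_add]
    exact Finset.sum_congr rfl fun j _ ↦ mul_comm _ _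
  ext k
  simp only [Pi.sub_apply, key, koszulCoeff_apply]
  rw [hβ c a, hβ (ε k) a, hβ (ε k) c]
  simp only [map_neg, neg_apply]
  ring

/-- The scalar curvature of a unimodular homogeneous space with Maurer-Cartan form `α`, in terms
of the Lie bracket `β`, the (degenerate) inner product `Q` on the Lie algebra, and an orthonormal
frame `ε`. -/
theorem scalarCurvatureCoord_of_maurerCartan
    (hβ : ∀ a c, β a c = -β c a) (hQ : ∀ a c, Q a c = Q c a)
    (hε : ∀ i j, Q (ε i) (ε j) = if i = j then 1 else 0)
    (hker : ∀ a z, Q (a - ∑ j, Q a (ε j) • ε j) z = 0)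
    (hinv : ∀ l, (∀ z, Q l z = 0) → ∀ a c, Q (β l a) c + Q a (β l c) = 0)
    (hunim : ∀ i, ∑ j, Q (β (ε i) (ε j)) (ε j) = 0)
    (hα : ContDiffAt ℝ 2 α y)
    (hMC : ∀ᶠ z in nhds y, ∀ u v,
      fderiv ℝ α z u v - fderiv ℝ α z v u = -β (α z u) (α z v))
    (hG : G =ᶠ[nhds y] fun z ↦ Q.bilinearComp (α z) (α z))
    (f : Module.Basis ι ℝ F) (hf : ∀ i, α y (f i) = ε i) :
    scalarCurvatureCoord G y =
      -(1 / 4) * ∑ i, ∑ j, ∑ k, Q (β (ε i) (ε j)) (ε k) ^ 2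
        - (1 / 2) * ∑ i, ∑ j, ∑ k, Q (β (ε i) (ε j)) (ε k) * Q (β (ε j) (ε k)) (ε i)
        - ∑ i, ∑ j, Q (β (β (ε i) (ε j)) (ε j)) (ε i) := by
  let pr : V →L[ℝ] (ι → ℝ) := ContinuousLinearMap.pi fun j ↦ Q.flip (ε j)
  have hpr (a : V) : pr a = fun j ↦ Q a (ε j) := rfl
  let e : F → F →L[ℝ] (ι → ℝ) := fun z ↦ pr.comp (α z)
  let Ω₀ := koszulForm β Q ε
  let Ω : F → F →L[ℝ] (ι → ℝ) →L[ℝ] (ι → ℝ) := fun z ↦ Ω₀.comp (α z)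
  have hαd : ∀ᶠ z in nhds y, DifferentiableAt ℝ α z := by
    filter_upwards [hα.eventually (by simp)] with z hz using hz.differentiableAt (by simp)
  have hed {z : F} (hz : DifferentiableAt ℝ α z) (u v : F) :
      fderiv ℝ e z u v = pr (fderiv ℝ α z u v) :=
    fderiv_const_clm_comp_apply pr hz u v
  have hΩd {z : F} (hz : DifferentiableAt ℝ α z) (u v : F) :
      fderiv ℝ Ω z u v = Ω₀ (fderiv ℝ α z u v) :=
    fderiv_const_clm_comp_apply Ω₀ hz u v
  have hparseval := apply_eq_sum_of_frame hQ hker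
  -- At `y` the coframe is the coordinate map of the basis `f`, in particular invertible.
  have hey : e y = (f.equivFun.toContinuousLinearEquiv : F →L[ℝ] (ι → ℝ)) := by
    apply ContinuousLinearMap.coe_injective
    refine f.ext fun i ↦ ?_
    ext j
    simp [e, hf, hpr, hε]
  have hcurv (u v w : F) : e y (curvatureTensor G y u v w) =
      Ω₀ (α y u) (Ω₀ (α y v) (e y w)) - Ω₀ (α y v) (Ω₀ (α y u) (e y w))
        - Ω₀ (β (α y u) (α y v)) (e y w) := by
    rw [coframe_curvatureTensor (b := dotForm ι) (e := e) (Ω := Ω)]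
    · rw [hΩd hαd.self_of_nhds, hΩd hαd.self_of_nhds, ← sub_apply, ← map_sub,
        hMC.self_of_nhds]
      simp only [map_neg, neg_apply, Ω, ContinuousLinearMap.comp_apply]
      abel
    · intro x z; simp only [dotForm_apply, mul_comm]
    · intro x hx
      ext k
      simpa [dotForm_apply, Pi.single_apply] using hx (Pi.single k 1)
    · filter_upwards [hG] with z hz
      rw [hz]
      ext u v
      simp only [ContinuousLinearMap.bilinearComp_apply, dotForm_apply]
      exact hparseval _ _
    · exact contDiffAt_const.clm_comp hα
    · exact ⟨_, hey.symm⟩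
    · exact (hasFDerivAt_const Ω₀ y).clm_comp hαd.self_of_nhds.hasFDerivAt |>.differentiableAt
    · filter_upwards [hαd, hMC] with z hz hMCz u v
      have := koszulForm_torsion hβ hQ hker hinv (α z u) (α z v)
      rw [← hpr, ← hpr, ← hpr] at this
      rw [hed hz, hed hz, ← map_sub, hMCz, map_neg, this]
      simp only [e, Ω, ContinuousLinearMap.comp_apply, Ω₀]
      abel
    · refine Filter.Eventually.of_forall fun z u x x' ↦ ?_
      simp only [dotForm_apply, Ω, Ω₀, ContinuousLinearMap.comp_apply, koszulForm_apply,
        Finset.sum_mul, Finset.mul_sum]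
      nth_rewrite 1 [Finset.sum_comm]
      simp only [← Finset.sum_add_distrib]
      refine Finset.sum_eq_zero fun j _ ↦ Finset.sum_eq_zero fun k _ ↦ ?_
      simp only [koszulCoeff_apply]
      rw [hβ (ε k) (ε j), hβ (ε k) (α z u), hβ (ε j) (α z u)]
      simp only [map_neg, neg_apply]
      ring
  let fe : F ≃L[ℝ] (ι → ℝ) := f.equivFun.toContinuousLinearEquiv
  let R : F →ₗ[ℝ] F →ₗ[ℝ] F →ₗ[ℝ] F := LinearMap.mk₂ ℝ
    (fun u v ↦ (((fe.symm : (ι → ℝ) →L[ℝ] F).comp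
      ((Ω₀ (α y u)).comp (Ω₀ (α y v)) - (Ω₀ (α y v)).comp (Ω₀ (α y u))
        - Ω₀ (β (α y u) (α y v)))).comp (fe : F →L[ℝ] (ι → ℝ)) : F →L[ℝ] F))
    (fun _ _ _ ↦ by ext; simp; abel)
    (fun _ _ _ ↦ by ext; simp [smul_sub])
    (fun _ _ _ ↦ by ext; simp; abel)
    (fun _ _ _ ↦ by ext; simp [smul_sub])
  -- The formula just found exhibits the curvature tensor as trilinear, which is needed to change
  -- basis in its traces.
  have hR (u v w : F) : curvatureTensor G y u v w = R u v w := by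
    apply fe.injective
    have := hcurv u v w
    rw [hey] at this
    simp only [R, LinearMap.mk₂_apply, ContinuousLinearMap.coe_coe, ContinuousLinearMap.comp_apply,
      ContinuousLinearEquiv.coe_coe, ContinuousLinearEquiv.apply_symm_apply, sub_apply]
    exact this
  have hGf (i j) : G y (f i) (f j) = if i = j then 1 else 0 := by
    rw [hG.self_of_nhds]; simp [hf, hε]
  rw [scalarCurvatureCoord_eq_basis f hGf R hR]
  let c : ι → ι → ι → ℝ := fun i j k ↦ Q (β (ε i) (ε j)) (ε k)
  have hcs (i j k) : c i j k = -c j i k := by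
    simp only [c]; rw [hβ (ε i)]; simp
  have hk (i j k) : koszulCoeff β Q (ε j) (ε k) (ε i) = (c i j k + c k i j + c k j i) / 2 := by
    rw [koszulCoeff_apply]
  have hfe (j) : fe (f j) = Pi.single j 1 := by
    ext k; simp [fe, Pi.single_apply, eq_comm]
  have hΩs (a : V) (j k) : Ω₀ a (Pi.single j 1) k = koszulCoeff β Q (ε j) (ε k) a := by
    simp [Ω₀, koszulForm_apply, Pi.single_apply]
  have hterm (i j) : f.coord i (R (f i) (f j) (f j)) =
      ∑ m, koszulCoeff β Q (ε m) (ε i) (ε i) * koszulCoeff β Q (ε j) (ε m) (ε j)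
        - ∑ m, koszulCoeff β Q (ε m) (ε i) (ε j) * koszulCoeff β Q (ε j) (ε m) (ε i)
        - koszulCoeff β Q (ε j) (ε i) (β (ε i) (ε j)) := by
    have h1 (x : F) : f.coord i x = fe x i := by simp [fe]
    rw [h1]
    simp only [R, LinearMap.mk₂_apply, ContinuousLinearMap.coe_coe, ContinuousLinearMap.comp_apply,
      ContinuousLinearEquiv.coe_coe, ContinuousLinearEquiv.apply_symm_apply, hfe, sub_apply,
      Pi.sub_apply, hf, hΩs]
    simp only [Ω₀, koszulForm_apply, hΩs]
  let D : ι → ι → ℝ := fun i j ↦ Q (β (β (ε i) (ε j)) (ε j)) (ε i)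
  have h1 (i m) : koszulCoeff β Q (ε m) (ε i) (ε i) = -c m i i := by
    rw [hk, hcs i m i, show c i i m = 0 by linarith [hcs i i m]]; ring
  have h2 (j m) : koszulCoeff β Q (ε j) (ε m) (ε j) = c m j j := by
    rw [hk, show c j j m = 0 by linarith [hcs j j m]]; ring
  -- With `a = c i j m`, `b = c j m i`, `g = c m i j`, the product is `(a + b - g)(a - b + g) / 4`.
  have h3 (i j m) : koszulCoeff β Q (ε m) (ε i) (ε j) * koszulCoeff β Q (ε j) (ε m) (ε i) =
      (1 / 4) * (c i j m ^ 2 - c j m i ^ 2 - c m i j ^ 2) + (1 / 2) * (c j m i * c m i j) := by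
    rw [hk, hk, hcs i m j, hcs m j i]; ring
  have h4 (i j) : koszulCoeff β Q (ε j) (ε i) (β (ε i) (ε j)) =
      (1 / 2) * (D i j + D j i) + (1 / 2) * ∑ m, c i j m ^ 2 := by
    have hsq : Q (β (ε i) (ε j)) (β (ε i) (ε j)) = ∑ m, c i j m ^ 2 := by
      rw [hparseval]
      exact Finset.sum_congr rfl fun m _ ↦ by simp only [c]; ring
    have hD : Q (β (ε i) (β (ε i) (ε j))) (ε j) = D j i := by
      simp only [D]
      rw [hβ (ε i) (β (ε i) (ε j)), hβ (ε i) (ε j)]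
      simp
    rw [koszulCoeff_apply, hsq, hD]; ring
  -- Summed over all indices, the three squares in `h3` have equal totals, as do the cyclic
  -- products.
  have hS := sum_cyclic fun i j k ↦ c i j k ^ 2
  have hS' := sum_cyclic fun i j k ↦ c j k i ^ 2
  have hT := sum_cyclic fun i j k ↦ c i j k * c j k i
  have hD := Finset.sum_comm (s := Finset.univ) (t := Finset.univ) (f := D)
  -- This is the only place where unimodularity enters: the trace of `ad` along the frame vanishes.
  have hfirst : ∑ i, ∑ j, ∑ m, -c m i i * c m j j = 0 := by
    refine Finset.sum_eq_zero fun i _ ↦ ?_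
    rw [Finset.sum_comm]
    refine Finset.sum_eq_zero fun m _ ↦ ?_
    rw [← Finset.mul_sum, hunim m, mul_zero]
  simp only [hterm, h1, h2, h3, h4, Finset.sum_sub_distrib, Finset.sum_add_distrib,
    ← Finset.mul_sum] at hfirst ⊢
  change _ = -(1 / 4) * ∑ i, ∑ j, ∑ k, c i j k ^ 2
    - (1 / 2) * ∑ i, ∑ j, ∑ k, c i j k * c j k i - ∑ i, ∑ j, D i j
  rw [hfirst]
  linarith

end MaurerCartan

/-! ### The algebra of `𝔥 ⊕ 𝔥` modulo `Δ𝔨` in an adapted frame. -/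

section SymmetricFrame

variable {E : Type*} [NormedAddCommGroup E] [NormedSpace ℝ E] {n d : ℕ}

/-- An orthonormal frame adapted to the decomposition `𝔥 = 𝔮 ⊕ 𝔨` of a symmetric pair, where the
inner product `ip` is minus the Killing form and `br` is the Lie bracket of `𝔥`; `X` is a basis
of `𝔮` and `Z` a basis of `𝔨`. -/
structure IsSymmetricFrame (br : E →L[ℝ] E →L[ℝ] E) (ip : E →L[ℝ] E →L[ℝ] ℝ)
    (X : Fin n → E) (Z : Fin d → E) : Prop where
  br_skew : ∀ a c, br a c = -br c a
  ip_symm : ∀ a c, ip a c = ip c a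
  ip_invariant : ∀ a c e, ip (br a c) e = ip a (br c e)
  ip_X_X : ∀ i j, ip (X i) (X j) = if i = j then 1 else 0
  ip_Z_Z : ∀ a b, ip (Z a) (Z b) = if a = b then 1 else 0
  ip_X_Z : ∀ i a, ip (X i) (Z a) = 0
  eq_sum : ∀ v, v = ∑ i, ip v (X i) • X i + ∑ a, ip v (Z a) • Z a
  br_X_X : ∀ i j k, ip (br (X i) (X j)) (X k) = 0
  br_Z_Z : ∀ a b i, ip (br (Z a) (Z b)) (X i) = 0
  casimir : ∀ v, ip v v =
    ∑ i, ip (br v (X i)) (br v (X i)) + ∑ a, ip (br v (Z a)) (br v (Z a))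

/-- The form `∑ᵢ ⟨a, Wᵢ⟩ ⟨c, Wᵢ⟩`. -/
def partForm {κ : Type*} [Fintype κ] (ip : E →L[ℝ] E →L[ℝ] ℝ) (W : κ → E) :
    E →L[ℝ] E →L[ℝ] ℝ :=
  ∑ i, (ip.flip (W i)).smulRight (ip.flip (W i))

theorem partForm_apply {κ : Type*} [Fintype κ] (ip : E →L[ℝ] E →L[ℝ] ℝ) (W : κ → E) (a c : E) :
    partForm ip W a c = ∑ i, ip a (W i) * ip c (W i) := by
  simp [partForm, sum_apply]

theorem partForm_symm {κ : Type*} [Fintype κ] (ip : E →L[ℝ] E →L[ℝ] ℝ) (W : κ → E) (a c : E) :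
    partForm ip W a c = partForm ip W c a := by
  simp only [partForm_apply, mul_comm]

/-- The componentwise bracket on `𝔥 ⊕ 𝔥`. -/
def prodBracket (br : E →L[ℝ] E →L[ℝ] E) : (E × E) →L[ℝ] (E × E) →L[ℝ] (E × E) :=
  (ContinuousLinearMap.compL ℝ (E × E) E (E × E) (.inl ℝ E E)).comp
      (br.bilinearComp (.fst ℝ E E) (.fst ℝ E E)) +
    (ContinuousLinearMap.compL ℝ (E × E) E (E × E) (.inr ℝ E E)).comp
      (br.bilinearComp (.snd ℝ E E) (.snd ℝ E E))

@[simp]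
theorem prodBracket_apply (br : E →L[ℝ] E →L[ℝ] E) (a c : E × E) :
    prodBracket br a c = (br a.1 c.1, br a.2 c.2) := by
  simp [prodBracket]

/-- The degenerate inner product on `𝔥 ⊕ 𝔥` which induces the invariant metric
`(x₁, x₂, 1, x₄)`, in terms of the forms `q` and `k` on `𝔮` and `𝔨`. -/
def diagForm (q k : E →L[ℝ] E →L[ℝ] ℝ) (x₁ x₂ x₄ : ℝ) : (E × E) →L[ℝ] (E × E) →L[ℝ] ℝ :=
  x₁ • q.bilinearComp (.fst ℝ E E) (.fst ℝ E E) + x₂ • q.bilinearComp (.snd ℝ E E) (.snd ℝ E E) +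
    x₄ • (q.bilinearComp (.fst ℝ E E) (.snd ℝ E E) + q.bilinearComp (.snd ℝ E E) (.fst ℝ E E)) +
    (1 / 2 : ℝ) • k.bilinearComp (.fst ℝ E E - .snd ℝ E E) (.fst ℝ E E - .snd ℝ E E)

theorem diagForm_apply (q k : E →L[ℝ] E →L[ℝ] ℝ) (x₁ x₂ x₄ : ℝ) (a c : E × E) :
    diagForm q k x₁ x₂ x₄ a c = x₁ * q a.1 c.1 + x₂ * q a.2 c.2 + x₄ * (q a.1 c.2 + q a.2 c.1)
      + 1 / 2 * k (a.1 - a.2) (c.1 - c.2) := by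
  simp [diagForm]; ring

/-- The frame of `𝔥 ⊕ 𝔥` given by `(Uₛ₀ Xᵢ, Uₛ₁ Xᵢ)` and `(Zₐ, -Zₐ) / √2`. -/
def diagFrame (X : Fin n → E) (Z : Fin d → E) (U : Fin 2 → Fin 2 → ℝ) :
    (Fin 2 × Fin n) ⊕ Fin d → E × E :=
  Sum.elim (fun p ↦ (U p.1 0 • X p.2, U p.1 1 • X p.2)) fun a ↦ ((√2)⁻¹ • Z a, -((√2)⁻¹ • Z a))

namespace IsSymmetricFrame

variable {br : E →L[ℝ] E →L[ℝ] E} {ip : E →L[ℝ] E →L[ℝ] ℝ} {X : Fin n → E} {Z : Fin d → E}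
  (h : IsSymmetricFrame br ip X Z) {x₁ x₂ x₄ : ℝ} {U : Fin 2 → Fin 2 → ℝ}

include h

theorem ip_Z_X (a i) : ip (Z a) (X i) = 0 := by rw [h.ip_symm, h.ip_X_Z]

theorem br_Z_X_X (a i j) : ip (br (Z a) (X i)) (X j) = ip (br (X i) (X j)) (Z a) := by
  rw [h.ip_invariant, h.ip_symm]

theorem br_Z_X_Z (a i b) : ip (br (Z a) (X i)) (Z b) = 0 := by
  rw [h.br_skew, map_neg, neg_apply, h.ip_invariant, h.ip_symm, h.br_Z_Z, neg_zero]

theorem br_X_Z_X (a i j) : ip (br (X i) (Z a)) (X j) = -ip (br (X i) (X j)) (Z a) := by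
  rw [h.br_skew, ← h.br_Z_X_X]; simp

theorem br_X_Z_Z (a i b) : ip (br (X i) (Z a)) (Z b) = 0 := by
  rw [h.br_skew]; simp [h.br_Z_X_Z]

theorem ip_eq (v w : E) : ip v w = partForm ip X v w + partForm ip Z v w := by
  conv_lhs => rw [h.eq_sum w]
  simp only [map_add, map_sum, map_smul, smul_eq_mul, partForm_apply]
  congr 1 <;> exact Finset.sum_congr rfl fun _ _ ↦ mul_comm _ _

theorem partForm_X_X (v : E) (i) : partForm ip X v (X i) = ip v (X i) := by
  simp [partForm_apply, h.ip_X_X]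

theorem partForm_X_Z (v : E) (a) : partForm ip X v (Z a) = 0 := by
  simp [partForm_apply, h.ip_Z_X]

theorem partForm_Z_X (v : E) (i) : partForm ip Z v (X i) = 0 := by
  simp [partForm_apply, h.ip_X_Z]

theorem partForm_Z_Z (v : E) (a) : partForm ip Z v (Z a) = ip v (Z a) := by
  simp [partForm_apply, h.ip_Z_Z]

/-- An element `m` without `𝔮`-component lies in `𝔨`, so `ad m` preserves the splitting `𝔮 ⊕ 𝔨` and
acts skewly on `𝔮`. -/
theorem partForm_X_invariant {m : E} (hm : ∀ i, ip m (X i) = 0) (v w : E) :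
    partForm ip X (br m v) w + partForm ip X v (br m w) = 0 := by
  have hmX (i j) : ip (br m (X i)) (X j) = -ip (br m (X j)) (X i) := by
    rw [h.br_skew m (X j)]
    simp [h.ip_invariant, h.ip_symm (X j)]
  have hmZ (a j) : ip (br m (Z a)) (X j) = 0 := by
    rw [h.eq_sum m]; simp [hm, h.br_Z_Z, sum_apply]
  have key (v : E) (j) : ip (br m v) (X j) = ∑ i, ip v (X i) * ip (br m (X i)) (X j) := by
    conv_lhs => rw [h.eq_sum v]
    simp [hmZ, sum_apply]
  have key' (v w : E) : partForm ip X (br m v) w =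
      ∑ j, ∑ i, ip v (X i) * ip (br m (X i)) (X j) * ip w (X j) := by
    rw [partForm_apply]
    exact Finset.sum_congr rfl fun j _ ↦ by rw [key, Finset.sum_mul]
  rw [partForm_symm _ _ v, key', key']
  nth_rewrite 1 [Finset.sum_comm]
  simp only [← Finset.sum_add_distrib]
  refine Finset.sum_eq_zero fun i _ ↦ Finset.sum_eq_zero fun j _ ↦ ?_
  rw [hmX i j]; ring

theorem partForm_Z_invariant {m : E} (hm : ∀ i, ip m (X i) = 0) (v w : E) :
    partForm ip Z (br m v) w + partForm ip Z v (br m w) = 0 := by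
  have h1 := h.partForm_X_invariant hm v w
  have h2 : ip (br m v) w + ip v (br m w) = 0 := by
    rw [h.br_skew m v]; simp [h.ip_invariant]
  rw [h.ip_eq, h.ip_eq] at h2
  linarith

/-- The kernel of the degenerate inner product is the diagonal `Δ𝔨`. -/
theorem eq_of_diagForm_eq_zero (hD : x₁ * x₂ - x₄ ^ 2 ≠ 0) {l : E × E}
    (hl : ∀ z, diagForm (partForm ip X) (partForm ip Z) x₁ x₂ x₄ l z = 0) :
    l.1 = l.2 ∧ ∀ i, ip l.1 (X i) = 0 := by
  have h1 (i) : ip l.1 (X i) = 0 ∧ ip l.2 (X i) = 0 := by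
    have e1 := hl (X i, 0)
    have e2 := hl (0, X i)
    simp only [diagForm_apply, h.partForm_X_X, map_zero, sub_zero, zero_sub, map_neg,
      h.partForm_Z_X] at e1 e2
    constructor <;> apply mul_left_cancel₀ hD
    · linear_combination x₂ * e1 - x₄ * e2
    · linear_combination x₁ * e2 - x₄ * e1
  have h2 (a) : ip (l.1 - l.2) (Z a) = 0 := by
    have e1 := hl (Z a, 0)
    simp only [diagForm_apply, h.partForm_X_Z, map_zero, sub_zero, h.partForm_Z_Z] at e1
    linarith
  refine ⟨?_, fun i ↦ (h1 i).1⟩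
  rw [← sub_eq_zero, h.eq_sum (l.1 - l.2)]
  simp only [h2]
  simp [h1]

/-- Kernel elements are diagonal pairs `(m, m)` with `m ∈ 𝔨`. They act by the same `ad m` on both
factors, so the mixed `x₄` terms are preserved as well. -/
theorem diagForm_invariant (hD : x₁ * x₂ - x₄ ^ 2 ≠ 0) (l : E × E)
    (hl : ∀ z, diagForm (partForm ip X) (partForm ip Z) x₁ x₂ x₄ l z = 0) (v w : E × E) :
    diagForm (partForm ip X) (partForm ip Z) x₁ x₂ x₄ (prodBracket br l v) w +
      diagForm (partForm ip X) (partForm ip Z) x₁ x₂ x₄ v (prodBracket br l w) = 0 := by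
  obtain ⟨hl1, hl2⟩ := h.eq_of_diagForm_eq_zero hD hl
  have hX := h.partForm_X_invariant hl2
  have hZ := h.partForm_Z_invariant hl2 (v.1 - v.2) (w.1 - w.2)
  simp only [diagForm_apply, prodBracket_apply, ← hl1, ← map_sub]
  linear_combination x₁ * hX v.1 w.1 + x₂ * hX v.2 w.2 + x₄ * hX v.1 w.2 + x₄ * hX v.2 w.1
    + 1 / 2 * hZ

theorem diagForm_inl (w : E × E) (p : Fin 2 × Fin n) :
    diagForm (partForm ip X) (partForm ip Z) x₁ x₂ x₄ w (diagFrame X Z U (Sum.inl p)) =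
      (x₁ * U p.1 0 + x₄ * U p.1 1) * ip w.1 (X p.2) +
        (x₂ * U p.1 1 + x₄ * U p.1 0) * ip w.2 (X p.2) := by
  simp only [diagForm_apply, diagFrame, Sum.elim_inl, map_smul, smul_eq_mul, h.partForm_X_X,
    map_sub, sub_apply, h.partForm_Z_X]
  ring

theorem diagForm_inr (w : E × E) (a : Fin d) :
    diagForm (partForm ip X) (partForm ip Z) x₁ x₂ x₄ w (diagFrame X Z U (Sum.inr a)) =
      (√2)⁻¹ * (ip w.1 (Z a) - ip w.2 (Z a)) := by
  simp only [diagForm_apply, diagFrame, Sum.elim_inr, map_smul, smul_eq_mul, h.partForm_X_Z,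
    map_sub, map_neg, h.partForm_Z_Z, sub_apply]
  ring

theorem diagForm_orthonormal
    (hU : ∀ s t, x₁ * U s 0 * U t 0 + x₂ * U s 1 * U t 1 + x₄ * (U s 0 * U t 1 + U s 1 * U t 0) =
      if s = t then 1 else 0) (i j : (Fin 2 × Fin n) ⊕ Fin d) :
    diagForm (partForm ip X) (partForm ip Z) x₁ x₂ x₄ (diagFrame X Z U i) (diagFrame X Z U j) =
      if i = j then 1 else 0 := by
  have h2 : (√2)⁻¹ * (√2)⁻¹ = (1 / 2 : ℝ) := by
    rw [← mul_inv, Real.mul_self_sqrt (by norm_num)]; norm_num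
  rcases i with ⟨s, i⟩ | a <;> rcases j with ⟨t, j⟩ | b
  · rw [h.diagForm_inl]
    have := hU s t
    simp only [diagFrame, Sum.elim_inl, map_smul, smul_apply, smul_eq_mul, h.ip_X_X,
      Sum.inl.injEq, Prod.mk.injEq]
    by_cases hij : i = j
    · simp only [hij, and_true, if_true, ← this]; ring
    · simp [hij]
  · rw [h.diagForm_inr]; simp [diagFrame, h.ip_X_Z]
  · rw [h.diagForm_inl]; simp [diagFrame, h.ip_Z_X]
  · rw [h.diagForm_inr]
    simp only [diagFrame, Sum.elim_inr, map_smul, smul_apply, smul_eq_mul, h.ip_Z_Z, map_neg,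
      neg_apply, Sum.inr.injEq]
    by_cases hab : a = b
    · simp only [hab, if_true]; linear_combination 2 * h2
    · simp [hab]

/-- The three conditions on `U` say that `UᵀU` is the inverse of the matrix `(x₁, x₄; x₄, x₂)`.
Hence subtracting the frame expansion removes both `𝔮`-components and the antidiagonal
`𝔨`-component, and leaves a diagonal element of the kernel. -/
theorem diagForm_complete
    (hM₁₁ : U 0 0 ^ 2 + U 1 0 ^ 2 = x₂ / (x₁ * x₂ - x₄ ^ 2))
    (hM₁₂ : U 0 0 * U 0 1 + U 1 0 * U 1 1 = -x₄ / (x₁ * x₂ - x₄ ^ 2))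
    (hM₂₂ : U 0 1 ^ 2 + U 1 1 ^ 2 = x₁ / (x₁ * x₂ - x₄ ^ 2))
    (hD : x₁ * x₂ - x₄ ^ 2 ≠ 0) (v z : E × E) :
    diagForm (partForm ip X) (partForm ip Z) x₁ x₂ x₄
      (v - ∑ j, diagForm (partForm ip X) (partForm ip Z) x₁ x₂ x₄ v (diagFrame X Z U j) •
        diagFrame X Z U j) z = 0 := by
  set l := v - ∑ j, diagForm (partForm ip X) (partForm ip Z) x₁ x₂ x₄ v (diagFrame X Z U j) •
    diagFrame X Z U j with hl
  have h2 : (√2)⁻¹ * (√2)⁻¹ = (1 / 2 : ℝ) := by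
    rw [← mul_inv, Real.mul_self_sqrt (by norm_num)]; norm_num
  have e1 : l.1 = v.1 - (∑ i, ∑ s, ((x₁ * U s 0 + x₄ * U s 1) * ip v.1 (X i) +
        (x₂ * U s 1 + x₄ * U s 0) * ip v.2 (X i)) • U s 0 • X i +
      ∑ a, ((√2)⁻¹ * (ip v.1 (Z a) - ip v.2 (Z a))) • (√2)⁻¹ • Z a) := by
    simp only [hl, Fintype.sum_sum_type, Fintype.sum_prod_type_right, h.diagForm_inl,
      h.diagForm_inr, Prod.fst_sub, Prod.fst_add, Prod.fst_sum, Prod.smul_fst]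
    simp only [diagFrame, Sum.elim_inl, Sum.elim_inr]
  have e2 : l.2 = v.2 - (∑ i, ∑ s, ((x₁ * U s 0 + x₄ * U s 1) * ip v.1 (X i) +
        (x₂ * U s 1 + x₄ * U s 0) * ip v.2 (X i)) • U s 1 • X i +
      ∑ a, ((√2)⁻¹ * (ip v.1 (Z a) - ip v.2 (Z a))) • -((√2)⁻¹ • Z a)) := by
    simp only [hl, Fintype.sum_sum_type, Fintype.sum_prod_type_right, h.diagForm_inl,
      h.diagForm_inr, Prod.snd_sub, Prod.snd_add, Prod.snd_sum, Prod.smul_snd]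
    simp only [diagFrame, Sum.elim_inl, Sum.elim_inr]
  have hX (i) : ip l.1 (X i) = 0 ∧ ip l.2 (X i) = 0 := by
    rw [e1, e2]
    simp only [map_sub, map_add, map_sum, map_smul, map_neg, sub_apply, add_apply, sum_apply,
      smul_apply, neg_apply, smul_eq_mul, h.ip_X_X, h.ip_Z_X, Fin.sum_univ_two, mul_ite, mul_one,
      mul_zero, Finset.sum_add_distrib, Finset.sum_ite_eq', Finset.mem_univ, if_true,
      Finset.sum_const_zero, neg_zero]
    rw [eq_div_iff hD] at hM₁₁ hM₁₂ hM₂₂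
    constructor <;> apply mul_left_cancel₀ hD
    · linear_combination (-(x₁ * ip v.1 (X i) + x₄ * ip v.2 (X i))) * hM₁₁
        - (x₄ * ip v.1 (X i) + x₂ * ip v.2 (X i)) * hM₁₂
    · linear_combination (-(x₁ * ip v.1 (X i) + x₄ * ip v.2 (X i))) * hM₁₂
        - (x₄ * ip v.1 (X i) + x₂ * ip v.2 (X i)) * hM₂₂
  have hZ (a) : ip (l.1 - l.2) (Z a) = 0 := by
    rw [e1, e2]
    simp only [map_sub, map_add, map_sum, map_smul, map_neg, sub_apply, add_apply, sum_apply,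
      smul_apply, neg_apply, smul_eq_mul, h.ip_X_Z, h.ip_Z_Z, Fin.sum_univ_two, mul_ite, mul_one,
      mul_zero, Finset.sum_ite_eq', Finset.mem_univ, if_true, Finset.sum_neg_distrib, mul_neg]
    linear_combination (-2 * (ip v.1 (Z a) - ip v.2 (Z a))) * h2
  rw [diagForm_apply]
  have hZ' (w) : partForm ip Z (l.1 - l.2) w = 0 := by simp [partForm_apply, -map_sub, hZ]
  rw [hZ']
  simp [partForm_apply, hX]

/-- Sum the Casimir identity over each part of the frame. For `Xᵢ`, the brackets with `𝔮` and with
`𝔨` contribute equally, which gives the factor 2; for `Zₐ`, the brackets with `𝔮` and with `𝔨` give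
the two terms. -/
theorem sum_sq_br :
    2 * ∑ i, ∑ j, ∑ a, ip (br (X i) (X j)) (Z a) ^ 2 = n ∧
      ∑ i, ∑ j, ∑ a, ip (br (X i) (X j)) (Z a) ^ 2 +
        ∑ a, ∑ b, ∑ c, ip (br (Z a) (Z b)) (Z c) ^ 2 = d := by
  have key (v : E) : ip v v =
      ∑ i, (partForm ip X (br v (X i)) (br v (X i)) + partForm ip Z (br v (X i)) (br v (X i))) +
      ∑ a, (partForm ip X (br v (Z a)) (br v (Z a)) + partForm ip Z (br v (Z a)) (br v (Z a))) := by
    rw [h.casimir]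
    simp only [← h.ip_eq]
  have hX (i) := key (X i)
  have hZ (a) := key (Z a)
  simp [partForm_apply, h.br_X_X, h.br_X_Z_X, h.br_X_Z_Z, h.br_Z_X_X, h.br_Z_X_Z, h.br_Z_Z,
    h.ip_X_X, h.ip_Z_Z, ← sq] at hX hZ
  have e1 : (n : ℝ) = ∑ _i : Fin n, 1 := by simp
  have e2 : (d : ℝ) = ∑ _a : Fin d, 1 := by simp
  constructor
  · rw [e1, Finset.sum_congr rfl fun i _ ↦ hX i, Finset.sum_add_distrib, two_mul]
    congr 1
    exact Finset.sum_congr rfl fun i _ ↦ Finset.sum_comm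
  · rw [e2, Finset.sum_congr rfl fun a _ ↦ hZ a, Finset.sum_add_distrib]
    congr 1
    conv_rhs => rw [Finset.sum_comm]
    exact Finset.sum_congr rfl fun i _ ↦ Finset.sum_comm

omit h in
theorem sum_prod_factor (g : Fin 2 → Fin 2 → ℝ) (f : Fin n → Fin n → Fin d → ℝ) :
    ∑ p : Fin 2 × Fin n, ∑ q : Fin 2 × Fin n, ∑ a, g p.1 q.1 * f p.2 q.2 a =
      (∑ s, ∑ t, g s t) * ∑ i, ∑ j, ∑ a, f i j a := by
  simp only [Fintype.sum_prod_type, Fin.sum_univ_two, ← Finset.mul_sum, Finset.sum_add_distrib]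
  ring

omit h in
theorem sum_prod_factor' (g : Fin 2 → Fin 2 → ℝ) (f : Fin n → Fin n → Fin d → ℝ) :
    ∑ p : Fin 2 × Fin n, ∑ a, ∑ q : Fin 2 × Fin n, g p.1 q.1 * f p.2 q.2 a =
      (∑ s, ∑ t, g s t) * ∑ i, ∑ j, ∑ a, f i j a := by
  rw [← sum_prod_factor]
  exact Finset.sum_congr rfl fun p _ ↦ Finset.sum_comm

omit h in
theorem sum_prod_factor'' (g : Fin 2 → Fin 2 → ℝ) (f : Fin n → Fin n → Fin d → ℝ) :
    ∑ a, ∑ p : Fin 2 × Fin n, ∑ q : Fin 2 × Fin n, g p.1 q.1 * f p.2 q.2 a =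
      (∑ s, ∑ t, g s t) * ∑ i, ∑ j, ∑ a, f i j a := by
  rw [← sum_prod_factor', Finset.sum_comm]

variable (x₁ x₂ x₄ U) in
omit h in
/-- The structure constants `⟨[(Uₛ₀ X, Uₛ₁ X), (Uₜ₀ Y, Uₜ₁ Y)], (Z, -Z) / √2⟩`, relative to
`⟨[X, Y], Z⟩`. -/
def fiberCoeff (s t : Fin 2) : ℝ := (√2)⁻¹ * (U s 0 * U t 0 - U s 1 * U t 1)

variable (x₁ x₂ x₄ U) in
omit h in
/-- The structure constants `⟨[(Z, -Z) / √2, (Uₛ₀ X, Uₛ₁ X)], (Uₜ₀ Y, Uₜ₁ Y)⟩`, relative to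
`⟨[X, Y], Z⟩`. -/
def baseCoeff (s t : Fin 2) : ℝ :=
  (√2)⁻¹ * ((x₁ * U t 0 + x₄ * U t 1) * U s 0 - (x₂ * U t 1 + x₄ * U t 0) * U s 1)

/-- The structure constants of the homogeneous space in the frame `diagFrame`. -/
theorem structureConstants (i j k : (Fin 2 × Fin n) ⊕ Fin d) :
    diagForm (partForm ip X) (partForm ip Z) x₁ x₂ x₄
      (prodBracket br (diagFrame X Z U i) (diagFrame X Z U j)) (diagFrame X Z U k) =
    match i, j, k with
    | Sum.inl p, Sum.inl q, Sum.inr a =>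
      fiberCoeff U p.1 q.1 * ip (br (X p.2) (X q.2)) (Z a)
    | Sum.inl p, Sum.inr a, Sum.inl q =>
      -(baseCoeff x₁ x₂ x₄ U p.1 q.1 * ip (br (X p.2) (X q.2)) (Z a))
    | Sum.inr a, Sum.inl p, Sum.inl q =>
      baseCoeff x₁ x₂ x₄ U p.1 q.1 * ip (br (X p.2) (X q.2)) (Z a)
    | _, _, _ => 0 := by
  -- Two vectors from the `𝔨`-part bracket to a diagonal element of `Δ𝔨`, which `Q` annihilates, so
  -- no `𝔨𝔨𝔨` constants occur. The surviving triples have two indices in `𝔮 ⊕ 𝔮` and one in `𝔨`.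
  rcases i with p | a <;> rcases j with q | b <;> rcases k with r | c <;>
  simp only [h.diagForm_inl, h.diagForm_inr, prodBracket_apply] <;>
  simp only [diagFrame, Sum.elim_inl, Sum.elim_inr, map_smul, smul_apply, smul_eq_mul, map_neg,
    neg_apply, h.br_X_X, h.br_X_Z_X, h.br_X_Z_Z, h.br_Z_X_X, h.br_Z_X_Z, h.br_Z_Z, fiberCoeff,
    baseCoeff] <;> ring

theorem sum_structureConstants_sq :
    ∑ i, ∑ j, ∑ k, diagForm (partForm ip X) (partForm ip Z) x₁ x₂ x₄
      (prodBracket br (diagFrame X Z U i) (diagFrame X Z U j)) (diagFrame X Z U k) ^ 2 =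
    (∑ s, ∑ t, fiberCoeff U s t ^ 2 + 2 * ∑ s, ∑ t, baseCoeff x₁ x₂ x₄ U s t ^ 2) *
      ∑ i, ∑ j, ∑ a, ip (br (X i) (X j)) (Z a) ^ 2 := by
  simp only [h.structureConstants, Fintype.sum_sum_type]
  simp only [ne_eq, OfNat.ofNat_ne_zero, not_false_eq_true, zero_pow, Finset.sum_const_zero,
    zero_add, add_zero, neg_sq, mul_pow, Finset.sum_add_distrib]
  rw [sum_prod_factor (fun s t ↦ fiberCoeff U s t ^ 2) fun i j a ↦ ip (br (X i) (X j)) (Z a) ^ 2,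
    sum_prod_factor' (fun s t ↦ baseCoeff x₁ x₂ x₄ U s t ^ 2)
      fun i j a ↦ ip (br (X i) (X j)) (Z a) ^ 2,
    sum_prod_factor'' (fun s t ↦ baseCoeff x₁ x₂ x₄ U s t ^ 2)
      fun i j a ↦ ip (br (X i) (X j)) (Z a) ^ 2]
  ring

/-- The three summands correspond to the position of the single `𝔨`-index in the cyclic triple;
skewness of the bracket absorbs the minus signs. -/
theorem sum_structureConstants_cyclic :
    ∑ i, ∑ j, ∑ k, diagForm (partForm ip X) (partForm ip Z) x₁ x₂ x₄
      (prodBracket br (diagFrame X Z U i) (diagFrame X Z U j)) (diagFrame X Z U k) *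
      diagForm (partForm ip X) (partForm ip Z) x₁ x₂ x₄
      (prodBracket br (diagFrame X Z U j) (diagFrame X Z U k)) (diagFrame X Z U i) =
    (∑ s, ∑ t, (fiberCoeff U s t * baseCoeff x₁ x₂ x₄ U t s) +
      ∑ s, ∑ t, (baseCoeff x₁ x₂ x₄ U s t * baseCoeff x₁ x₂ x₄ U t s) +
      ∑ s, ∑ t, (fiberCoeff U s t * baseCoeff x₁ x₂ x₄ U s t)) *
      ∑ i, ∑ j, ∑ a, ip (br (X i) (X j)) (Z a) ^ 2 := by
  have hs (i j a) : ip (br (X j) (X i)) (Z a) = -ip (br (X i) (X j)) (Z a) := by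
    rw [h.br_skew]; simp
  simp only [h.structureConstants, Fintype.sum_sum_type]
  simp only [mul_zero, Finset.sum_const_zero, zero_add, add_zero,
    Finset.sum_add_distrib]
  rw [add_mul, add_mul,
    ← sum_prod_factor (fun s t ↦ fiberCoeff U s t * baseCoeff x₁ x₂ x₄ U t s),
    ← sum_prod_factor' (fun s t ↦ baseCoeff x₁ x₂ x₄ U s t * baseCoeff x₁ x₂ x₄ U t s),
    ← sum_prod_factor'' (fun s t ↦ fiberCoeff U s t * baseCoeff x₁ x₂ x₄ U s t)]
  congr 1
  · congr 1
    · refine Finset.sum_congr rfl fun p _ ↦ Finset.sum_congr rfl fun q _ ↦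
        Finset.sum_congr rfl fun a _ ↦ ?_
      rw [hs p.2 q.2]; ring
    · refine Finset.sum_congr rfl fun p _ ↦ Finset.sum_congr rfl fun a _ ↦
        Finset.sum_congr rfl fun q _ ↦ ?_
      rw [hs p.2 q.2]; ring
  · refine Finset.sum_congr rfl fun a _ ↦ Finset.sum_congr rfl fun p _ ↦
        Finset.sum_congr rfl fun q _ ↦ ?_
    ring

/-- Four blocks according to the types of the two frame vectors. The `𝔨𝔨` block is where `∑ ⟨[Zₐ,
Z_b], Z_c⟩²` enters the curvature. -/
theorem sum_double_bracket
    (hU : ∀ s t, x₁ * U s 0 * U t 0 + x₂ * U s 1 * U t 1 + x₄ * (U s 0 * U t 1 + U s 1 * U t 0) =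
      if s = t then 1 else 0) :
    ∑ i, ∑ j, diagForm (partForm ip X) (partForm ip Z) x₁ x₂ x₄
      (prodBracket br (prodBracket br (diagFrame X Z U i) (diagFrame X Z U j))
        (diagFrame X Z U j)) (diagFrame X Z U i) =
    -((∑ s, ∑ t, ((x₁ * U s 0 + x₄ * U s 1) * U s 0 * U t 0 ^ 2 +
        (x₂ * U s 1 + x₄ * U s 0) * U s 1 * U t 1 ^ 2) + 1 +
        1 / 2 * ∑ s, (U s 0 ^ 2 + U s 1 ^ 2)) *
      ∑ i, ∑ j, ∑ a, ip (br (X i) (X j)) (Z a) ^ 2) -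
    1 / 2 * ∑ a, ∑ b, ∑ c, ip (br (Z a) (Z b)) (Z c) ^ 2 := by
  have h2 : (√2)⁻¹ * (√2)⁻¹ = (1 / 2 : ℝ) := by
    rw [← mul_inv, Real.mul_self_sqrt (by norm_num)]; norm_num
  -- Invariance turns a double bracket into minus the squared length of a single one.
  have hdb (v w : E) : ip (br (br v w) w) v = -(partForm ip X (br v w) (br v w) +
      partForm ip Z (br v w) (br v w)) := by
    rw [← h.ip_eq, h.ip_invariant, h.br_skew w v, map_neg]
  have hXX (i j) : ip (br (br (X i) (X j)) (X j)) (X i) =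
      -∑ a, ip (br (X i) (X j)) (Z a) ^ 2 := by
    rw [hdb]; simp [partForm_apply, h.br_X_X, ← sq]
  have hXZ (i a) : ip (br (br (X i) (Z a)) (Z a)) (X i) =
      -∑ j, ip (br (X i) (X j)) (Z a) ^ 2 := by
    rw [hdb]; simp [partForm_apply, h.br_X_Z_X, h.br_X_Z_Z, ← sq]
  have hZX (i a) : ip (br (br (Z a) (X i)) (X i)) (Z a) =
      -∑ j, ip (br (X i) (X j)) (Z a) ^ 2 := by
    rw [hdb]; simp [partForm_apply, h.br_Z_X_X, h.br_Z_X_Z, ← sq]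
  have hZZ (a b) : ip (br (br (Z a) (Z b)) (Z b)) (Z a) =
      -∑ c, ip (br (Z a) (Z b)) (Z c) ^ 2 := by
    rw [hdb]; simp [partForm_apply, h.br_Z_Z, ← sq]
  have q1 (p q : Fin 2 × Fin n) : diagForm (partForm ip X) (partForm ip Z) x₁ x₂ x₄
      (prodBracket br (prodBracket br (diagFrame X Z U (Sum.inl p)) (diagFrame X Z U (Sum.inl q)))
        (diagFrame X Z U (Sum.inl q))) (diagFrame X Z U (Sum.inl p)) =
      ∑ a, -((x₁ * U p.1 0 + x₄ * U p.1 1) * U p.1 0 * U q.1 0 ^ 2 +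
        (x₂ * U p.1 1 + x₄ * U p.1 0) * U p.1 1 * U q.1 1 ^ 2) *
          ip (br (X p.2) (X q.2)) (Z a) ^ 2 := by
    rw [h.diagForm_inl, ← Finset.mul_sum]
    simp only [prodBracket_apply, diagFrame, Sum.elim_inl, map_smul, smul_apply, smul_eq_mul, hXX]
    ring
  have q2 (p : Fin 2 × Fin n) (a) : diagForm (partForm ip X) (partForm ip Z) x₁ x₂ x₄
      (prodBracket br (prodBracket br (diagFrame X Z U (Sum.inl p)) (diagFrame X Z U (Sum.inr a)))
        (diagFrame X Z U (Sum.inr a))) (diagFrame X Z U (Sum.inl p)) =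
      -(1 / 2) * ∑ j, ip (br (X p.2) (X j)) (Z a) ^ 2 := by
    have hpp := hU p.1 p.1
    rw [if_pos rfl] at hpp
    rw [h.diagForm_inl]
    simp only [prodBracket_apply, diagFrame, Sum.elim_inl, Sum.elim_inr, map_smul, smul_apply,
      smul_eq_mul, map_neg, neg_apply, hXZ]
    linear_combination (-(∑ j, ip (br (X p.2) (X j)) (Z a) ^ 2)) * (h2 + (√2)⁻¹ * (√2)⁻¹ * (hpp))
  have q3 (a) (p : Fin 2 × Fin n) : diagForm (partForm ip X) (partForm ip Z) x₁ x₂ x₄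
      (prodBracket br (prodBracket br (diagFrame X Z U (Sum.inr a)) (diagFrame X Z U (Sum.inl p)))
        (diagFrame X Z U (Sum.inl p))) (diagFrame X Z U (Sum.inr a)) =
      -(1 / 2) * (U p.1 0 ^ 2 + U p.1 1 ^ 2) * ∑ j, ip (br (X p.2) (X j)) (Z a) ^ 2 := by
    rw [h.diagForm_inr]
    simp only [prodBracket_apply, diagFrame, Sum.elim_inl, Sum.elim_inr, map_smul, smul_apply,
      smul_eq_mul, map_neg, neg_apply, hZX]
    linear_combination
      (-(U p.1 0 ^ 2 + U p.1 1 ^ 2) * (∑ j, ip (br (X p.2) (X j)) (Z a) ^ 2)) * h2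
  have q4 (a b) : diagForm (partForm ip X) (partForm ip Z) x₁ x₂ x₄
      (prodBracket br (prodBracket br (diagFrame X Z U (Sum.inr a)) (diagFrame X Z U (Sum.inr b)))
        (diagFrame X Z U (Sum.inr b))) (diagFrame X Z U (Sum.inr a)) =
      -(1 / 2) * ∑ c, ip (br (Z a) (Z b)) (Z c) ^ 2 := by
    rw [h.diagForm_inr]
    simp only [prodBracket_apply, diagFrame, Sum.elim_inr, map_smul, smul_apply,
      smul_eq_mul, map_neg, neg_apply, hZZ]
    linear_combination
      (-2 * ((√2)⁻¹ * (√2)⁻¹ + 1 / 2) * (∑ c, ip (br (Z a) (Z b)) (Z c) ^ 2)) * h2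
  simp only [Fintype.sum_sum_type, q1, q2, q3, q4, Finset.sum_add_distrib]
  rw [sum_prod_factor (fun s t ↦ -((x₁ * U s 0 + x₄ * U s 1) * U s 0 * U t 0 ^ 2 +
        (x₂ * U s 1 + x₄ * U s 0) * U s 1 * U t 1 ^ 2))
      fun i j a ↦ ip (br (X i) (X j)) (Z a) ^ 2]
  have c1 : ∑ i, ∑ a, ∑ j, ip (br (X i) (X j)) (Z a) ^ 2 =
      ∑ i, ∑ j, ∑ a, ip (br (X i) (X j)) (Z a) ^ 2 :=
    Finset.sum_congr rfl fun p _ ↦ Finset.sum_comm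
  have c2 : ∑ a, ∑ i, ∑ j, ip (br (X i) (X j)) (Z a) ^ 2 =
      ∑ i, ∑ j, ∑ a, ip (br (X i) (X j)) (Z a) ^ 2 := by
    rw [← c1, Finset.sum_comm]
  simp only [Fintype.sum_prod_type, ← Finset.mul_sum, Fin.sum_univ_two, Finset.sum_neg_distrib,
    Finset.sum_add_distrib, c1, c2]
  ring

/-- In each summand, either no admissible type pattern occurs or the constant is a multiple of
`⟨[Xᵢ, Xᵢ], Zₐ⟩ = 0`. -/
theorem unimodular (i : (Fin 2 × Fin n) ⊕ Fin d) :
    ∑ j, diagForm (partForm ip X) (partForm ip Z) x₁ x₂ x₄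
      (prodBracket br (diagFrame X Z U i) (diagFrame X Z U j)) (diagFrame X Z U j) = 0 := by
  have hs (i a) : ip (br (X i) (X i)) (Z a) = 0 := by
    have := congrArg (fun v ↦ ip v (Z a)) (h.br_skew (X i) (X i))
    simp only [map_neg, neg_apply] at this
    linarith
  simp only [h.structureConstants, Fintype.sum_sum_type]
  rcases i with p | a <;> simp [hs]

theorem scalar_sum (hD : x₁ * x₂ - x₄ ^ 2 ≠ 0)
    (hU : ∀ s t, x₁ * U s 0 * U t 0 + x₂ * U s 1 * U t 1 + x₄ * (U s 0 * U t 1 + U s 1 * U t 0) =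
      if s = t then 1 else 0)
    (hM₁₁ : U 0 0 ^ 2 + U 1 0 ^ 2 = x₂ / (x₁ * x₂ - x₄ ^ 2))
    (hM₁₂ : U 0 0 * U 0 1 + U 1 0 * U 1 1 = -x₄ / (x₁ * x₂ - x₄ ^ 2))
    (hM₂₂ : U 0 1 ^ 2 + U 1 1 ^ 2 = x₁ / (x₁ * x₂ - x₄ ^ 2)) :
    -(1 / 4) * ∑ i, ∑ j, ∑ k, diagForm (partForm ip X) (partForm ip Z) x₁ x₂ x₄
      (prodBracket br (diagFrame X Z U i) (diagFrame X Z U j)) (diagFrame X Z U k) ^ 2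
    - (1 / 2) * ∑ i, ∑ j, ∑ k, diagForm (partForm ip X) (partForm ip Z) x₁ x₂ x₄
      (prodBracket br (diagFrame X Z U i) (diagFrame X Z U j)) (diagFrame X Z U k) *
      diagForm (partForm ip X) (partForm ip Z) x₁ x₂ x₄
      (prodBracket br (diagFrame X Z U j) (diagFrame X Z U k)) (diagFrame X Z U i)
    - ∑ i, ∑ j, diagForm (partForm ip X) (partForm ip Z) x₁ x₂ x₄
      (prodBracket br (prodBracket br (diagFrame X Z U i) (diagFrame X Z U j))
        (diagFrame X Z U j)) (diagFrame X Z U i) =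
    (8 * d * (x₄ ^ 2 - x₁ * x₂) ^ 2 -
      n * (x₂ ^ 2 + x₁ ^ 2 * (4 * x₂ ^ 2 - 8 * x₂ + 1) - 2 * x₄ ^ 2 + 8 * x₂ * x₄ ^ 2
        - 4 * x₄ ^ 4 - 8 * x₁ * (x₂ ^ 2 - x₄ ^ 2))) / (16 * (x₄ ^ 2 - x₁ * x₂) ^ 2) := by
  have h2 : (√2)⁻¹ ^ 2 = (1 / 2 : ℝ) := by
    rw [inv_pow, Real.sq_sqrt (by norm_num)]; norm_num
  -- The total does not depend on the chosen frame: `e1` to `e5` express each sum, or pair of sums,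
  -- through the three entries of `UᵀU`, whose values are given.
  have e1 : ∑ s, ∑ t, fiberCoeff U s t ^ 2 = (√2)⁻¹ ^ 2 * ((U 0 0 ^ 2 + U 1 0 ^ 2) ^ 2
      - 2 * (U 0 0 * U 0 1 + U 1 0 * U 1 1) ^ 2 + (U 0 1 ^ 2 + U 1 1 ^ 2) ^ 2) := by
    simp only [Fin.sum_univ_two, fiberCoeff]; ring
  have e2 : ∑ s, ∑ t, baseCoeff x₁ x₂ x₄ U s t ^ 2 = (√2)⁻¹ ^ 2 *
      ((U 0 0 ^ 2 + U 1 0 ^ 2) * (x₁ ^ 2 * (U 0 0 ^ 2 + U 1 0 ^ 2)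
          + 2 * x₁ * x₄ * (U 0 0 * U 0 1 + U 1 0 * U 1 1) + x₄ ^ 2 * (U 0 1 ^ 2 + U 1 1 ^ 2))
        - 2 * (U 0 0 * U 0 1 + U 1 0 * U 1 1) *
          (x₁ * x₂ * (U 0 0 * U 0 1 + U 1 0 * U 1 1) + x₁ * x₄ * (U 0 0 ^ 2 + U 1 0 ^ 2)
          + x₂ * x₄ * (U 0 1 ^ 2 + U 1 1 ^ 2) + x₄ ^ 2 * (U 0 0 * U 0 1 + U 1 0 * U 1 1))
        + (U 0 1 ^ 2 + U 1 1 ^ 2) * (x₂ ^ 2 * (U 0 1 ^ 2 + U 1 1 ^ 2)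
          + 2 * x₂ * x₄ * (U 0 0 * U 0 1 + U 1 0 * U 1 1) + x₄ ^ 2 * (U 0 0 ^ 2 + U 1 0 ^ 2))) := by
    simp only [Fin.sum_univ_two, baseCoeff]; ring
  have e3 : ∑ s, ∑ t, (baseCoeff x₁ x₂ x₄ U s t * baseCoeff x₁ x₂ x₄ U t s) = (√2)⁻¹ ^ 2 *
      ((x₁ * (U 0 0 ^ 2 + U 1 0 ^ 2) + x₄ * (U 0 0 * U 0 1 + U 1 0 * U 1 1)) ^ 2
        - 2 * (x₁ * (U 0 0 * U 0 1 + U 1 0 * U 1 1) + x₄ * (U 0 1 ^ 2 + U 1 1 ^ 2)) *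
          (x₄ * (U 0 0 ^ 2 + U 1 0 ^ 2) + x₂ * (U 0 0 * U 0 1 + U 1 0 * U 1 1))
        + (x₄ * (U 0 0 * U 0 1 + U 1 0 * U 1 1) + x₂ * (U 0 1 ^ 2 + U 1 1 ^ 2)) ^ 2) := by
    simp only [Fin.sum_univ_two, baseCoeff]; ring
  have e4 : ∑ s, ∑ t, (fiberCoeff U s t * baseCoeff x₁ x₂ x₄ U t s) +
      ∑ s, ∑ t, (fiberCoeff U s t * baseCoeff x₁ x₂ x₄ U s t) = 2 * ((√2)⁻¹ ^ 2 *
      (x₁ * ((U 0 0 ^ 2 + U 1 0 ^ 2) ^ 2 - (U 0 0 * U 0 1 + U 1 0 * U 1 1) ^ 2)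
        + x₂ * ((U 0 1 ^ 2 + U 1 1 ^ 2) ^ 2 - (U 0 0 * U 0 1 + U 1 0 * U 1 1) ^ 2))) := by
    simp only [Fin.sum_univ_two, baseCoeff, fiberCoeff]; ring
  have e5 : ∑ s, ∑ t, ((x₁ * U s 0 + x₄ * U s 1) * U s 0 * U t 0 ^ 2 +
        (x₂ * U s 1 + x₄ * U s 0) * U s 1 * U t 1 ^ 2) + 1 +
        1 / 2 * ∑ s, (U s 0 ^ 2 + U s 1 ^ 2) =
      x₁ * (U 0 0 ^ 2 + U 1 0 ^ 2) ^ 2 + x₂ * (U 0 1 ^ 2 + U 1 1 ^ 2) ^ 2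
        + x₄ * (U 0 0 * U 0 1 + U 1 0 * U 1 1) * ((U 0 0 ^ 2 + U 1 0 ^ 2) + (U 0 1 ^ 2 + U 1 1 ^ 2))
        + 1 + 1 / 2 * ((U 0 0 ^ 2 + U 1 0 ^ 2) + (U 0 1 ^ 2 + U 1 1 ^ 2)) := by
    simp only [Fin.sum_univ_two]; ring
  rw [hM₁₁, hM₁₂, hM₂₂, h2] at e1 e2 e3 e4
  rw [hM₁₁, hM₁₂, hM₂₂] at e5
  obtain ⟨hn, hd⟩ := h.sum_sq_br
  rw [h.sum_structureConstants_sq, h.sum_structureConstants_cyclic, h.sum_double_bracket hU,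
    e1, e2, e3, e5,
    add_right_comm (∑ s, ∑ t, fiberCoeff U s t * baseCoeff x₁ x₂ x₄ U t s), e4, ← hn, ← hd]
  generalize ∑ i, ∑ j, ∑ a, ip (br (X i) (X j)) (Z a) ^ 2 = A
  generalize ∑ a, ∑ b, ∑ c, ip (br (Z a) (Z b)) (Z c) ^ 2 = C
  obtain ⟨D, hDD⟩ : ∃ D, D = x₁ * x₂ - x₄ ^ 2 := ⟨_, rfl⟩
  rw [← hDD] at hD ⊢
  rw [show x₄ ^ 2 - x₁ * x₂ = -D by rw [hDD]; ring, neg_sq]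
  field_simp
  rw [hDD]
  ring

end IsSymmetricFrame

/-- Gram–Schmidt for the positive definite matrix `(x₁, x₄; x₄, x₂)`. The rows of `U` are
orthonormal, which makes `UᵀU` its inverse. -/
theorem exists_orthonormal_pair {x₁ x₂ x₄ : ℝ} (hx₁ : 0 < x₁) (hD : 0 < x₁ * x₂ - x₄ ^ 2) :
    ∃ U : Fin 2 → Fin 2 → ℝ,
    (∀ s t, x₁ * U s 0 * U t 0 + x₂ * U s 1 * U t 1 + x₄ * (U s 0 * U t 1 + U s 1 * U t 0) =
      if s = t then 1 else 0) ∧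
    U 0 0 ^ 2 + U 1 0 ^ 2 = x₂ / (x₁ * x₂ - x₄ ^ 2) ∧
    U 0 0 * U 0 1 + U 1 0 * U 1 1 = -x₄ / (x₁ * x₂ - x₄ ^ 2) ∧
    U 0 1 ^ 2 + U 1 1 ^ 2 = x₁ / (x₁ * x₂ - x₄ ^ 2) := by
  obtain ⟨r, hr⟩ : ∃ r : ℝ, r ^ 2 = 1 / x₁ := ⟨√(1 / x₁), Real.sq_sqrt (by positivity)⟩
  obtain ⟨w, hw⟩ : ∃ w : ℝ, w ^ 2 = 1 / (x₁ * (x₁ * x₂ - x₄ ^ 2)) :=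
    ⟨√(1 / (x₁ * (x₁ * x₂ - x₄ ^ 2))), Real.sq_sqrt (by positivity)⟩
  have hx₁' := hx₁.ne'
  have hD' := hD.ne'
  have hr' : r ^ 2 * x₁ = 1 := by rw [hr]; field_simp
  have hw' : w ^ 2 * (x₁ * (x₁ * x₂ - x₄ ^ 2)) = 1 := by rw [hw]; field_simp
  -- The vector `(-x₄, x₁)` is orthogonal to `(1, 0)` and has squared length `x₁ (x₁x₂ - x₄²)`,
  -- hence the normalization `w`.
  refine ⟨![![r, 0], ![-x₄ * w, x₁ * w]], ?_, ?_, ?_, ?_⟩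
  · intro s t
    fin_cases s <;> fin_cases t <;> simp
    · linear_combination hr'
    · ring
    · ring
    · linear_combination hw'
  · simp only [Matrix.cons_val_zero, Matrix.cons_val_one]
    rw [eq_div_iff hD']
    apply mul_left_cancel₀ hx₁'
    linear_combination (x₁ * x₂ - x₄ ^ 2) * hr' + x₄ ^ 2 * hw'
  · simp only [Matrix.cons_val_zero, Matrix.cons_val_one]
    rw [eq_div_iff hD']
    linear_combination -x₄ * hw'
  · simp only [Matrix.cons_val_zero, Matrix.cons_val_one]
    rw [eq_div_iff hD']
    linear_combination x₁ * hw'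

end SymmetricFrame

/-! ### The Maurer–Cartan form pulled back to a vector space. -/

section MaurerCartanForm

variable {E : Type*} [NormedAddCommGroup E] [NormedSpace ℝ E] [FiniteDimensional ℝ E]
  {H : Type*} [TopologicalSpace H] [ChartedSpace E H] [Group H] [LieGroup 𝓘(ℝ, E) ∞ H]
  {F : Type*} [NormedAddCommGroup F] [NormedSpace ℝ F]

/-- The pullback of the left-invariant Maurer-Cartan form of `H` under the map `s`. -/
def mcForm (s : F → H) (y : F) : F →L[ℝ] E :=
  mfderiv 𝓘(ℝ, F) 𝓘(ℝ, E) (fun z ↦ (s y)⁻¹ * s z) y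

omit [FiniteDimensional ℝ E] in
-- The map `z ↦ s(x)⁻¹ s(z)` is smooth in both variables and sends `z = x` to `1`. Since this image
-- is constant, tangent coordinates introduce no transition maps.
theorem contDiffAt_mcForm {s : F → H} {y : F} (hs : ContMDiffAt 𝓘(ℝ, F) 𝓘(ℝ, E) ∞ s y) :
    ContDiffAt ℝ ∞ (mcForm (E := E) s) y := by
  have : IsManifold 𝓘(ℝ, E) 1 H := IsManifold.of_le (n := ∞) (by simp)
  have h0 : ContMDiffAt (𝓘(ℝ, F).prod 𝓘(ℝ, F)) 𝓘(ℝ, E) ∞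
      (Function.uncurry fun x z : F ↦ (s x)⁻¹ * s z) (y, id y) := by
    have hs1 : ContMDiffAt (𝓘(ℝ, F).prod 𝓘(ℝ, F)) 𝓘(ℝ, E) ∞ (fun p : F × F ↦ s p.1) (y, y) :=
      ContMDiffAt.comp (y, y) hs contMDiffAt_fst
    have hs2 : ContMDiffAt (𝓘(ℝ, F).prod 𝓘(ℝ, F)) 𝓘(ℝ, E) ∞ (fun p : F × F ↦ s p.2) (y, y) :=
      ContMDiffAt.comp (y, y) hs contMDiffAt_snd
    exact hs1.inv.mul hs2
  have h1 := ContMDiffAt.mfderiv (m := ∞) (fun x z : F ↦ (s x)⁻¹ * s z) id h0 contMDiffAt_id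
    (by simp)
  have h2 : (fun x : F ↦ (s x)⁻¹ * s (id x)) = fun _ ↦ (1 : H) := by ext; simp
  rw [← contMDiffAt_iff_contDiffAt]
  refine h1.congr_of_eventuallyEq (Filter.Eventually.of_forall fun x ↦ ?_)
  rw [h2]
  change mcForm s x = inTangentCoordinates 𝓘(ℝ, F) 𝓘(ℝ, E) id (fun _ ↦ (1 : H)) (mcForm s) y x
  rw [inTangentCoordinates_eq _ _ _ (by rw [chartAt_self_eq]; trivial) (by simp)]
  ext u
  simp only [ContinuousLinearMap.comp_apply]
  have h3 : achart F (id y) = achart F (id x) :=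
    Subtype.ext (by simp only [coe_achart, chartAt_self_eq])
  rw [h3, VectorBundleCore.coordChange_self, VectorBundleCore.coordChange_self]
  · exact mem_chart_source F x
  · exact mem_chart_source E (1 : H)

/-- The Lie bracket of the Lie algebra of `H`, as a continuous bilinear map on the model space. -/
def lieBracketCLM (E : Type*) [NormedAddCommGroup E] [NormedSpace ℝ E] [FiniteDimensional ℝ E]
    (H : Type*) [TopologicalSpace H] [ChartedSpace E H] [Group H] [LieGroup 𝓘(ℝ, E) ∞ H] :
    E →L[ℝ] E →L[ℝ] E :=
  LinearMap.toContinuousBilinearMap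
    (LinearMap.mk₂ ℝ (fun v w : GroupLieAlgebra 𝓘(ℝ, E) H ↦ ⁅v, w⁆) add_lie smul_lie lie_add
      (fun c v w ↦ lie_smul c v w) :
      GroupLieAlgebra 𝓘(ℝ, E) H →ₗ[ℝ] GroupLieAlgebra 𝓘(ℝ, E) H →ₗ[ℝ] GroupLieAlgebra 𝓘(ℝ, E) H)

omit [FiniteDimensional ℝ E] [LieGroup 𝓘(ℝ, E) ∞ H] in
theorem mcForm_congr {s s' : F → H} {y : F} (h : s =ᶠ[nhds y] s') :
    mcForm (E := E) s y = mcForm s' y := by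
  simp only [mcForm]
  exact Filter.EventuallyEq.mfderiv_eq (by filter_upwards [h] with z hz; rw [hz, h.self_of_nhds])

omit [FiniteDimensional ℝ E] in
theorem mcForm_comp {F' : Type*} [NormedAddCommGroup F'] [NormedSpace ℝ F'] {s : F → H}
    {f : F' → F} {y : F'} (hs : MDifferentiableAt 𝓘(ℝ, F) 𝓘(ℝ, E) s (f y))
    (hf : DifferentiableAt ℝ f y) :
    mcForm (E := E) (fun z ↦ s (f z)) y = (mcForm s (f y)).comp (fderiv ℝ f y) := by
  have h1 : MDifferentiableAt 𝓘(ℝ, F) 𝓘(ℝ, E) (fun z ↦ (s (f y))⁻¹ * s z) (f y) :=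
    (contMDiff_mul_left (n := ∞)).mdifferentiableAt (by simp) |>.comp _ hs
  have := mfderiv_comp y h1 hf.mdifferentiableAt
  rw [mfderiv_eq_fderiv] at this
  exact this

omit [FiniteDimensional ℝ E] in
theorem mcForm_apply {s : F → H} {y : F} (hs : MDifferentiableAt 𝓘(ℝ, F) 𝓘(ℝ, E) s y) (u : F) :
    mcForm (E := E) s y u =
      mfderiv 𝓘(ℝ, E) 𝓘(ℝ, E) (fun x : H ↦ (s y)⁻¹ * x) (s y) (mfderiv 𝓘(ℝ, F) 𝓘(ℝ, E) s y u) := by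
  have h1 : MDifferentiableAt 𝓘(ℝ, E) 𝓘(ℝ, E) (fun x : H ↦ (s y)⁻¹ * x) (s y) :=
    (contMDiff_mul_left (n := ∞)).mdifferentiableAt (by simp)
  have := mfderiv_comp y h1 hs
  exact congrArg (fun L : F →L[ℝ] E ↦ L u) this

omit [FiniteDimensional ℝ E] in
theorem mfderiv_mul_left_inv_mulInvariantVectorField (g : H) (v : GroupLieAlgebra 𝓘(ℝ, E) H) :
    (mfderiv 𝓘(ℝ, E) 𝓘(ℝ, E) (fun x : H ↦ g⁻¹ * x) g (mulInvariantVectorField v g) : E) = v := by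
  have h1 (g x : H) : MDifferentiableAt 𝓘(ℝ, E) 𝓘(ℝ, E) (fun x : H ↦ g * x) x :=
    (contMDiff_mul_left (n := ∞)).mdifferentiableAt (by simp)
  have h2 := mfderiv_comp_of_eq (h1 g⁻¹ g) (h1 g 1) (mul_one g)
  have h3 : (fun x : H ↦ g⁻¹ * x) ∘ (fun x ↦ g * x) = id := by ext; simp
  rw [h3, mfderiv_id, mul_one] at h2
  exact (congrArg (fun L : E →L[ℝ] E ↦ L v) h2).symm

open VectorField in
/-- The Maurer-Cartan equation in a chart at its center. -/
theorem fderiv_mcForm_extChartAt_symm (g : H) (u v : E) :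
    fderiv ℝ (mcForm (E := E) (extChartAt 𝓘(ℝ, E) g).symm) (extChartAt 𝓘(ℝ, E) g g) u v -
      fderiv ℝ (mcForm (E := E) (extChartAt 𝓘(ℝ, E) g).symm) (extChartAt 𝓘(ℝ, E) g g) v u =
      -lieBracketCLM E H (mcForm (extChartAt 𝓘(ℝ, E) g).symm (extChartAt 𝓘(ℝ, E) g g) u)
        (mcForm (extChartAt 𝓘(ℝ, E) g).symm (extChartAt 𝓘(ℝ, E) g g) v) := by
  have : IsManifold 𝓘(ℝ, E) 1 H := IsManifold.of_le (n := ∞) (by simp)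
  set φ := extChartAt 𝓘(ℝ, E) g with hφ
  set x₀ := φ g with hx₀
  let A : E → E →L[ℝ] E := mcForm (E := E) φ.symm
  have htarget : ∀ᶠ x in nhds x₀, x ∈ φ.target := extChartAt_target_mem_nhds g
  have hsmooth : ContMDiffAt 𝓘(ℝ, E) 𝓘(ℝ, E) ∞ φ.symm x₀ :=
    contMDiffOn_extChartAt_symm g |>.contMDiffAt htarget
  have hA : ContDiffAt ℝ ∞ A x₀ := contDiffAt_mcForm hsmooth
  have hdiff : ∀ᶠ x in nhds x₀, MDifferentiableAt 𝓘(ℝ, E) 𝓘(ℝ, E) φ.symm x := by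
    filter_upwards [htarget] with x hx
    exact ((contMDiffOn_extChartAt_symm (n := ∞) g).contMDiffAt
      (isOpen_extChartAt_target g |>.mem_nhds hx)).mdifferentiableAt (by simp)
  -- `V X` is the left-invariant field `X` read in the chart. The Maurer–Cartan form takes the
  -- constant value `X` on it, so derivatives of the form can be traded for derivatives of `V X`.
  let V (X : E) : E → E := mpullback 𝓘(ℝ, E) 𝓘(ℝ, E) φ.symm
    (mulInvariantVectorField (X : GroupLieAlgebra 𝓘(ℝ, E) H))
  have hV (X : E) : ∀ᶠ x in nhds x₀, A x (V X x) = X := by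
    filter_upwards [htarget, hdiff] with x hx hxd
    have hinv : (mfderiv 𝓘(ℝ, E) 𝓘(ℝ, E) φ.symm x).IsInvertible := by
      have := isInvertible_mfderivWithin_extChartAt_symm (I := 𝓘(ℝ, E)) hx
      rwa [modelWithCornersSelf_coe, Set.range_id, mfderivWithin_univ] at this
    have h1 : mfderiv 𝓘(ℝ, E) 𝓘(ℝ, E) φ.symm x (V X x) =
        mulInvariantVectorField (X : GroupLieAlgebra 𝓘(ℝ, E) H) (φ.symm x) :=
      hinv.self_apply_inverse _
    have h2 := mcForm_apply hxd (V X x)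
    rw [h1] at h2
    exact h2.trans (mfderiv_mul_left_inv_mulInvariantVectorField _ _)
  have hAd : DifferentiableAt ℝ A x₀ := hA.differentiableAt (by simp)
  have hAinv : (A x₀).IsInvertible := by
    have hsurj : Function.Surjective (A x₀) := fun X ↦ ⟨V X x₀, (hV X).self_of_nhds⟩
    have hinj : Function.Injective (A x₀) :=
      (LinearMap.injective_iff_surjective (f := (A x₀ : E →ₗ[ℝ] E))).2 hsurj
    exact ⟨(LinearEquiv.ofBijective (A x₀ : E →ₗ[ℝ] E) ⟨hinj, hsurj⟩).toContinuousLinearEquiv,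
      by ext; rfl⟩
  obtain ⟨A₀, hA₀⟩ := hAinv
  have hVd (X : E) : DifferentiableAt ℝ (V X) x₀ := by
    have h1 : V X =ᶠ[nhds x₀] fun x ↦ (A x).inverse X := by
      have := hA.continuousAt.eventually (hA₀ ▸ ContinuousLinearEquiv.nhds A₀)
      filter_upwards [hV X, this] with x hx ⟨e, he⟩
      nth_rewrite 2 [← hx]
      rw [← he, ContinuousLinearMap.inverse_equiv]
      simp
    refine DifferentiableAt.congr_of_eventuallyEq ?_ h1
    refine DifferentiableAt.clm_apply ?_ (differentiableAt_const X)
    exact ((hA₀ ▸ contDiffAt_map_inverse (n := 1) A₀).differentiableAt (by simp)).comp x₀ hAd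
  have hD (X w : E) : A x₀ (fderiv ℝ (V X) x₀ w) = -fderiv ℝ A x₀ w (V X x₀) := by
    have h1 : HasFDerivAt (fun x ↦ A x (V X x)) _ x₀ :=
      hAd.hasFDerivAt.clm_apply (hVd X).hasFDerivAt
    have h2 : HasFDerivAt (fun x ↦ A x (V X x)) (0 : E →L[ℝ] E) x₀ :=
      (hasFDerivAt_const X x₀).congr_of_eventuallyEq (hV X)
    have := congrArg (fun L : E →L[ℝ] E ↦ L w) (h1.unique h2)
    simp only [add_apply, ContinuousLinearMap.comp_apply, ContinuousLinearMap.flip_apply,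
      zero_apply] at this
    exact eq_neg_of_add_eq_zero_left this
  have hbr (X Y : GroupLieAlgebra 𝓘(ℝ, E) H) :
      A x₀ (lieBracket ℝ (V X) (V Y) x₀) = lieBracketCLM E H X Y := by
    rw [← lieBracketWithin_univ]
    have h1 : mulInvariantVectorField ⁅X, Y⁆ g = mlieBracketWithin 𝓘(ℝ, E)
        (mulInvariantVectorField X) (mulInvariantVectorField Y) Set.univ g := by
      rw [GroupLieAlgebra.bracket_def, mulInvariantVector_mlieBracket, mlieBracketWithin_univ]
    have h0 (w : E) : ((mfderiv 𝓘(ℝ, E) 𝓘(ℝ, E) (extChartAt 𝓘(ℝ, E) g) g).inverse w : E) = w := by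
      rw [mfderiv_extChartAt_self]
      exact congrArg (fun L : E →L[ℝ] E ↦ L w) ContinuousLinearMap.inverse_id
    rw [mlieBracketWithin_apply] at h1
    replace h1 := h1.trans (h0 _)
    simp only [modelWithCornersSelf_coe, Set.range_id, mpullbackWithin_univ, Set.preimage_univ,
      Set.inter_univ] at h1
    have h2 : mfderiv 𝓘(ℝ, E) 𝓘(ℝ, E) φ.symm x₀ = ContinuousLinearMap.id ℝ E := by
      have := mfderivWithin_range_extChartAt_symm (I := 𝓘(ℝ, E)) (x := g)
      rwa [modelWithCornersSelf_coe, Set.range_id, mfderivWithin_univ] at this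
    have h3 := mcForm_apply hdiff.self_of_nhds (lieBracketWithin ℝ (V X) (V Y) Set.univ x₀)
    rw [h2] at h3
    have h4 := mfderiv_mul_left_inv_mulInvariantVectorField g ⁅X, Y⁆
    have h5 : φ.symm x₀ = g := φ.left_inv (mem_extChartAt_source g)
    rw [h5] at h3
    rw [h1] at h4
    exact h3.trans h4
  -- At the centre every tangent vector is the value of a left-invariant field, so the bracket
  -- formula covers arbitrary `u` and `v`.
  have hu : V (A x₀ u) x₀ = u := by
    have := (hV (A x₀ u)).self_of_nhds
    rw [← hA₀] at this
    exact hA₀ ▸ A₀.injective this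
  have hv : V (A x₀ v) x₀ = v := by
    have := (hV (A x₀ v)).self_of_nhds
    rw [← hA₀] at this
    exact hA₀ ▸ A₀.injective this
  have := hbr (A x₀ u) (A x₀ v)
  rw [lieBracket, map_sub, hD, hD, hu, hv] at this
  change fderiv ℝ A x₀ u v - fderiv ℝ A x₀ v u = -lieBracketCLM E H (A x₀ u) (A x₀ v)
  rw [← this]
  abel

/-- The Maurer-Cartan equation. -/
theorem maurerCartan {s : F → H} {y : F} (hs : ContMDiffAt 𝓘(ℝ, F) 𝓘(ℝ, E) 2 s y) (u v : F) :
    fderiv ℝ (mcForm (E := E) s) y u v - fderiv ℝ (mcForm (E := E) s) y v u =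
      -lieBracketCLM E H (mcForm s y u) (mcForm s y v) := by
  have : IsManifold 𝓘(ℝ, E) 1 H := IsManifold.of_le (n := ∞) (by simp)
  -- Factor `s` through the chart centred at `s y`. The second derivatives of the coordinate map are
  -- symmetric and drop out, which leaves the equation at the centre of the chart.
  set φ := extChartAt 𝓘(ℝ, E) (s y) with hφ
  let f : F → E := fun z ↦ φ (s z)
  have hf' : ContDiffAt ℝ 2 f y := by
    rw [← contMDiffAt_iff_contDiffAt]
    exact ((contMDiffAt_extChartAt (n := ∞)).of_le ENat.LEInfty.out).comp y hs
  have hfd : ∀ᶠ z in nhds y, DifferentiableAt ℝ f z := by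
    filter_upwards [hf'.eventually (by simp)] with z hz using hz.differentiableAt (by simp)
  have htarget : ∀ᶠ x in nhds (f y), x ∈ φ.target := extChartAt_target_mem_nhds (s y)
  have hsource : ∀ᶠ z in nhds y, s z ∈ φ.source :=
    hs.continuousAt.eventually (extChartAt_source_mem_nhds (s y))
  have hsmooth : ContMDiffAt 𝓘(ℝ, E) 𝓘(ℝ, E) ∞ φ.symm (f y) :=
    contMDiffOn_extChartAt_symm (s y) |>.contMDiffAt htarget
  have hsd : ∀ᶠ z in nhds y, s =ᶠ[nhds z] fun z ↦ φ.symm (f z) := by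
    filter_upwards [hsource.eventually_nhds] with z hz
    filter_upwards [hz] with x hx using (φ.left_inv hx).symm
  let A : E → E →L[ℝ] E := mcForm (E := E) φ.symm
  have hA : DifferentiableAt ℝ A (f y) := (contDiffAt_mcForm hsmooth).differentiableAt (by simp)
  have heq : mcForm (E := E) s =ᶠ[nhds y] fun z ↦ (A (f z)).comp (fderiv ℝ f z) := by
    filter_upwards [hsd, hfd, hsource] with z h1 h2 h3
    rw [mcForm_congr h1, mcForm_comp _ h2]
    exact ((contMDiffOn_extChartAt_symm (n := ∞) (s y)).contMDiffAt
      (isOpen_extChartAt_target (s y) |>.mem_nhds (φ.map_source h3))).mdifferentiableAt (by simp)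
  have hf2 : DifferentiableAt ℝ (fderiv ℝ f) y :=
    (hf'.fderiv_right (m := 1) (by norm_num)).differentiableAt (by simp)
  have hder : HasFDerivAt (fun z ↦ (A (f z)).comp (fderiv ℝ f z)) _ y :=
    (hA.hasFDerivAt.comp y hfd.self_of_nhds.hasFDerivAt).clm_comp hf2.hasFDerivAt
  have hsymm : fderiv ℝ (fderiv ℝ f) y u v = fderiv ℝ (fderiv ℝ f) y v u :=
    (hf'.isSymmSndFDerivAt (by simp)).eq u v
  have hMC := fderiv_mcForm_extChartAt_symm (s y) (fderiv ℝ f y u) (fderiv ℝ f y v)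
  rw [heq.fderiv_eq, heq.self_of_nhds, hder.fderiv]
  simp only [add_apply, ContinuousLinearMap.comp_apply, ContinuousLinearMap.compL_apply,
    ContinuousLinearMap.flip_apply, hsymm, Function.comp_apply]
  rw [add_sub_add_left_eq_sub]
  exact hMC

end MaurerCartanForm

/-! ### Curves in fibres and local sections of submersions. -/

section Submersion

variable {E : Type*} [NormedAddCommGroup E] [NormedSpace ℝ E] [FiniteDimensional ℝ E]
  {A : Type*} [TopologicalSpace A] {I : ModelWithCorners ℝ E A} [I.Boundaryless]
  {N : Type*} [TopologicalSpace N] [ChartedSpace A N] [IsManifold I ∞ N]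
  {F : Type*} [NormedAddCommGroup F] [NormedSpace ℝ F] [FiniteDimensional ℝ F]
  {M : Type*} [TopologicalSpace M] [ChartedSpace F M]

omit [FiniteDimensional ℝ E] in
theorem contMDiffAt_extChartAt_symm_self (a : N) :
    ContMDiffAt 𝓘(ℝ, E) I ∞ (extChartAt I a).symm (extChartAt I a a) :=
  (contMDiffOn_extChartAt_symm a).contMDiffAt (extChartAt_target_mem_nhds a)

omit [FiniteDimensional ℝ E] in
theorem mfderiv_extChartAt_symm_self (a : N) :
    (mfderiv 𝓘(ℝ, E) I (extChartAt I a).symm (extChartAt I a a) : E →L[ℝ] E) =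
      ContinuousLinearMap.id ℝ E := by
  have : IsManifold I 1 N := IsManifold.of_le (n := ∞) (by simp)
  have := mfderivWithin_range_extChartAt_symm (I := I) (x := a)
  rwa [I.range_eq_univ, mfderivWithin_univ] at this

omit [FiniteDimensional ℝ E] [FiniteDimensional ℝ F] [IsManifold I ∞ N] in
theorem contDiffAt_writtenInExtChartAt {q : N → M} {a : N} (hq : ContMDiffAt I 𝓘(ℝ, F) ∞ q a) :
    ContDiffAt ℝ ∞ (writtenInExtChartAt I 𝓘(ℝ, F) a q) (extChartAt I a a) := by
  have h := (contMDiffAt_iff.1 hq).2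
  rwa [I.range_eq_univ, contDiffWithinAt_univ] at h

omit [FiniteDimensional ℝ E] [FiniteDimensional ℝ F] [IsManifold I ∞ N] in
theorem hasStrictFDerivAt_writtenInExtChartAt {q : N → M} {a : N}
    (hq : ContMDiffAt I 𝓘(ℝ, F) ∞ q a) :
    HasStrictFDerivAt (writtenInExtChartAt I 𝓘(ℝ, F) a q) (mfderiv I 𝓘(ℝ, F) q a : E →L[ℝ] F)
      (extChartAt I a a) := by
  have h := (contDiffAt_writtenInExtChartAt hq).hasStrictFDerivAt (by simp)
  have h1 : (mfderiv I 𝓘(ℝ, F) q a : E →L[ℝ] F) = fderiv ℝ (writtenInExtChartAt I 𝓘(ℝ, F) a q)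
      (extChartAt I a a) := by
    rw [← fderivWithin_univ, ← I.range_eq_univ]
    exact if_pos (hq.mdifferentiableAt (by simp))
  rw [h1]
  exact h

/-- A vector in the kernel of a surjective derivative is the velocity of a curve in the fibre. -/
theorem exists_curve_of_mfderiv_eq_zero {q : N → M} {a : N} (hq : ContMDiffAt I 𝓘(ℝ, F) ∞ q a)
    (hsurj : Function.Surjective (mfderiv I 𝓘(ℝ, F) q a)) {v : E}
    (hv : (mfderiv I 𝓘(ℝ, F) q a : E →L[ℝ] F) v = 0) :
    ∃ γ : ℝ → N, γ 0 = a ∧ MDifferentiableAt 𝓘(ℝ, ℝ) I γ 0 ∧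
      (mfderiv 𝓘(ℝ, ℝ) I γ 0 : ℝ →L[ℝ] E) 1 = v ∧ ∀ᶠ t in nhds 0, q (γ t) = q a := by
  set L : E →L[ℝ] F := mfderiv I 𝓘(ℝ, F) q a with hL
  set x₀ : E := extChartAt I a a with hx₀
  set f := writtenInExtChartAt I 𝓘(ℝ, F) a q with hf
  have hs : HasStrictFDerivAt f L x₀ := hasStrictFDerivAt_writtenInExtChartAt hq
  have hr : L.range = ⊤ := LinearMap.range_eq_top.2 hsurj
  let w : L.ker := ⟨v, hv⟩
  -- The implicit function parametrizes the level set of `f` by the kernel of its derivative; `c` is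
  -- the image of the line in direction `v`.
  let c : ℝ → E := fun t ↦ hs.implicitFunction f L hr (f x₀) (t • w)
  have hc0 : c 0 = x₀ := by
    simp only [c, zero_smul]
    have := (hs.eq_implicitFunction hr).self_of_nhds
    rwa [hs.implicitToOpenPartialHomeomorph_self] at this
  have hc : HasFDerivAt c ((1 : ℝ →L[ℝ] ℝ).smulRight v) 0 := by
    have h1 : HasFDerivAt (fun t : ℝ ↦ t • w) ((1 : ℝ →L[ℝ] ℝ).smulRight w) 0 :=
      ((1 : ℝ →L[ℝ] ℝ).smulRight w).hasFDerivAt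
    have h2 := (hs.to_implicitFunction hr).hasFDerivAt
    rw [← zero_smul ℝ w] at h2
    refine (h2.comp (0 : ℝ) h1).congr_fderiv ?_
    ext
    simp [w]
  have hfc : ∀ᶠ t in nhds (0 : ℝ), f (c t) = f x₀ := by
    have h1 : Filter.Tendsto (fun t : ℝ ↦ (f x₀, t • w)) (nhds 0) (nhds (f x₀, 0)) := by
      have : Continuous (fun t : ℝ ↦ (f x₀, t • w)) := by fun_prop
      simpa using this.tendsto 0
    exact h1.eventually (hs.map_implicitFunction_eq hr)
  have hsymm := contMDiffAt_extChartAt_symm_self (I := I) a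
  have hsx : (extChartAt I a).symm x₀ = a := extChartAt_to_inv a
  have hcm : MDifferentiableAt 𝓘(ℝ, ℝ) 𝓘(ℝ, E) c 0 := hc.differentiableAt.mdifferentiableAt
  have hsd : MDifferentiableAt 𝓘(ℝ, E) I (extChartAt I a).symm (c 0) := by
    rw [hc0]; exact hsymm.mdifferentiableAt (by simp)
  have hγ : MDifferentiableAt 𝓘(ℝ, ℝ) I (fun t ↦ (extChartAt I a).symm (c t)) 0 := hsd.comp 0 hcm
  refine ⟨fun t ↦ (extChartAt I a).symm (c t), by simp only [hc0, hsx], hγ, ?_, ?_⟩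
  · have h1 := mfderiv_comp (0 : ℝ) hsd hcm
    have h2 := congrArg (fun T : ℝ →L[ℝ] E ↦ T 1) h1
    refine h2.trans ?_
    rw [mfderiv_eq_fderiv, hc.fderiv, hc0, mfderiv_extChartAt_symm_self]
    exact one_smul ℝ v
  · have h1 : ∀ᶠ t in nhds (0 : ℝ), q ((extChartAt I a).symm (c t)) ∈
        (extChartAt 𝓘(ℝ, F) (q a)).source := by
      refine ContinuousAt.preimage_mem_nhds (f := fun t ↦ q ((extChartAt I a).symm (c t))) ?_ ?_
      · refine ContinuousAt.comp (g := q) ?_ hγ.continuousAt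
        rw [hc0, hsx]
        exact hq.continuousAt
      · rw [hc0, hsx]
        exact extChartAt_source_mem_nhds _
    filter_upwards [h1, hfc] with t ht1 ht2
    refine (extChartAt 𝓘(ℝ, F) (q a)).injOn ht1 (mem_extChartAt_source _) (ht2.trans ?_)
    simp only [hf, writtenInExtChartAt, Function.comp_apply, hsx]

omit [FiniteDimensional ℝ E] in
/-- A linear right inverse of the derivative of a submersion is the derivative of a local
section. -/
theorem exists_section_of_mfderiv_comp {q : N → M} {a : N} (hq : ContMDiffAt I 𝓘(ℝ, F) ∞ q a)
    {L : F →L[ℝ] E} (hL : ∀ u, (mfderiv I 𝓘(ℝ, F) q a : E →L[ℝ] F) (L u) = u) :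
    ∃ s : F → N, s (extChartAt 𝓘(ℝ, F) (q a) (q a)) = a ∧
      ContMDiffAt 𝓘(ℝ, F) I ∞ s (extChartAt 𝓘(ℝ, F) (q a) (q a)) ∧
      (mfderiv 𝓘(ℝ, F) I s (extChartAt 𝓘(ℝ, F) (q a) (q a)) : F →L[ℝ] E) = L ∧
      ∀ᶠ y in nhds (extChartAt 𝓘(ℝ, F) (q a) (q a)),
        q (s y) = (extChartAt 𝓘(ℝ, F) (q a)).symm y := by
  set T : E →L[ℝ] F := mfderiv I 𝓘(ℝ, F) q a with hT
  set x₀ : E := extChartAt I a a with hx₀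
  set y₀ : F := extChartAt 𝓘(ℝ, F) (q a) (q a) with hy₀
  set f := writtenInExtChartAt I 𝓘(ℝ, F) a q with hf
  have hsx : (extChartAt I a).symm x₀ = a := extChartAt_to_inv a
  have hfx : f x₀ = y₀ := by simp only [hf, writtenInExtChartAt, Function.comp_apply, hsx, hy₀]
  -- On the affine slice `x₀ + L u` the submersion has identity derivative, so it can be inverted
  -- there. This gives a section with prescribed derivative `L`.
  let j : F → E := fun u ↦ x₀ + L u
  have hj0 : j 0 = x₀ := by simp [j]
  have hj : ContDiff ℝ ∞ j := contDiff_const.add L.contDiff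
  have hjd (u : F) : HasFDerivAt j L u := L.hasFDerivAt.const_add x₀
  let k : F → F := fun u ↦ f (j u)
  have hk0 : k 0 = y₀ := by simp only [k, hj0, hfx]
  have hf0 : ContDiffAt ℝ ∞ f (j 0) := by
    rw [hj0]; exact contDiffAt_writtenInExtChartAt hq
  have hk : ContDiffAt ℝ ∞ k 0 := hf0.comp (0 : F) hj.contDiffAt
  have hkd : HasFDerivAt k (ContinuousLinearEquiv.refl ℝ F : F →L[ℝ] F) 0 := by
    have h1 : HasFDerivAt f T (j 0) := hj0 ▸ (hasStrictFDerivAt_writtenInExtChartAt hq).hasFDerivAt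
    refine (h1.comp (0 : F) (hjd 0)).congr_fderiv ?_
    ext u
    exact hL u
  let r : F → F := hk.localInverse hkd (by simp)
  have hr : ContDiffAt ℝ ∞ r y₀ := hk0 ▸ hk.to_localInverse hkd (by simp)
  have hr0 : r y₀ = 0 := hk0 ▸ hk.localInverse_apply_image hkd (by simp)
  have hkr : ∀ᶠ y in nhds y₀, k (r y) = y :=
    hk0 ▸ (hk.hasStrictFDerivAt' hkd (by simp)).eventually_right_inverse
  have hrd : HasFDerivAt r (ContinuousLinearMap.id ℝ F) y₀ := by
    have := (hk.hasStrictFDerivAt' hkd (by simp)).to_localInverse.hasFDerivAt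
    rw [hk0] at this
    exact this
  have hjr : ContDiffAt ℝ ∞ (fun y ↦ j (r y)) y₀ := hj.contDiffAt.comp y₀ hr
  have hjrd : HasFDerivAt (fun y ↦ j (r y)) L y₀ := (hjd (r y₀)).comp y₀ hrd
  have hjr0 : j (r y₀) = x₀ := by rw [hr0, hj0]
  have hsymm : ContMDiffAt 𝓘(ℝ, E) I ∞ (extChartAt I a).symm (j (r y₀)) := by
    rw [hjr0]; exact contMDiffAt_extChartAt_symm_self (I := I) a
  have hs : ContMDiffAt 𝓘(ℝ, F) I ∞ (fun y ↦ (extChartAt I a).symm (j (r y))) y₀ :=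
    hsymm.comp y₀ hjr.contMDiffAt
  have hs0 : (extChartAt I a).symm (j (r y₀)) = a := by rw [hjr0, hsx]
  refine ⟨fun y ↦ (extChartAt I a).symm (j (r y)), hs0, hs, ?_, ?_⟩
  · have h1 := mfderiv_comp y₀ (hsymm.mdifferentiableAt (by simp))
      hjrd.differentiableAt.mdifferentiableAt
    refine h1.trans ?_
    rw [mfderiv_eq_fderiv, hjrd.fderiv, hjr0, mfderiv_extChartAt_symm_self]
    exact ContinuousLinearMap.id_comp L
  · have h1 : ∀ᶠ y in nhds y₀, q ((extChartAt I a).symm (j (r y))) ∈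
        (extChartAt 𝓘(ℝ, F) (q a)).source := by
      refine ContinuousAt.preimage_mem_nhds (f := fun y ↦ q ((extChartAt I a).symm (j (r y)))) ?_ ?_
      · refine ContinuousAt.comp (g := q) ?_ hs.continuousAt
        rw [hs0]
        exact hq.continuousAt
      · rw [hs0]
        exact extChartAt_source_mem_nhds _
    filter_upwards [h1, hkr] with y hy1 hy2
    rw [← (extChartAt 𝓘(ℝ, F) (q a)).left_inv hy1]
    exact congrArg _ hy2

end Submersion

/-! ### The chain rule with derivatives viewed on the model spaces. -/

section ChainRule

variable {E E' E'' A A' A'' N N' N'' : Type*} [NormedAddCommGroup E] [NormedSpace ℝ E]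
  [NormedAddCommGroup E'] [NormedSpace ℝ E'] [NormedAddCommGroup E''] [NormedSpace ℝ E'']
  [TopologicalSpace A] [TopologicalSpace A'] [TopologicalSpace A'']
  {I : ModelWithCorners ℝ E A} {I' : ModelWithCorners ℝ E' A'} {I'' : ModelWithCorners ℝ E'' A''}
  [TopologicalSpace N] [TopologicalSpace N'] [TopologicalSpace N'']
  [ChartedSpace A N] [ChartedSpace A' N'] [ChartedSpace A'' N'']

/-- Keeping `y` separate from `f x` avoids transport between tangent spaces at points that are only
propositionally equal. -/
theorem mfderiv_comp_model {g : N' → N''} {f : N → N'} {x : N} {y : N'}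
    (hg : MDifferentiableAt I' I'' g y) (hf : MDifferentiableAt I I' f x) (h : f x = y) :
    (mfderiv I I'' (fun z ↦ g (f z)) x : E →L[ℝ] E'') =
      (mfderiv I' I'' g y : E' →L[ℝ] E'').comp (mfderiv I I' f x : E →L[ℝ] E') := by
  subst h
  exact mfderiv_comp x hg hf

end ChainRule

/-! ### Velocities of curves in a subgroup. -/

section SubgroupLieAlgebra

variable {E : Type*} [NormedAddCommGroup E] [NormedSpace ℝ E]
  {H : Type*} [TopologicalSpace H] [ChartedSpace E H] [Group H] [LieGroup 𝓘(ℝ, E) ∞ H]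
  {K : Subgroup H}

omit [LieGroup 𝓘(ℝ, E) ∞ H] in
theorem mfderiv_mem_subgroupLieAlgebra {γ : ℝ → H} (h0 : γ 0 = 1)
    (hγ : MDifferentiableAt 𝓘(ℝ, ℝ) 𝓘(ℝ, E) γ 0) (hK : ∀ᶠ t in nhds 0, γ t ∈ K) {v : E}
    (hv : (mfderiv 𝓘(ℝ, ℝ) 𝓘(ℝ, E) γ 0 : ℝ →L[ℝ] E) 1 = v) :
    (v : GroupLieAlgebra 𝓘(ℝ, E) H) ∈ subgroupLieAlgebra E K := by
  classical
  -- The curves in the definition must lie in `K` at all times. Resetting `γ` to `1` whenever it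
  -- leaves `K` does not change its germ at `0`.
  let γ' : ℝ → H := fun t ↦ if γ t ∈ K then γ t else 1
  have heq : γ' =ᶠ[nhds 0] γ := by
    filter_upwards [hK] with t ht using if_pos ht
  refine Submodule.subset_span ⟨γ', fun t ↦ ?_, ?_, hγ.congr_of_eventuallyEq heq, ?_⟩
  · by_cases h : γ t ∈ K
    · simp only [γ', if_pos h, h]
    · simp only [γ', if_neg h, one_mem]
  · rw [heq.self_of_nhds, h0]
  · rw [heq.mfderiv_eq]
    exact hv

omit [LieGroup 𝓘(ℝ, E) ∞ H] in
theorem apply_eq_of_mem_subgroupLieAlgebra {V : Type*} [AddCommGroup V] [Module ℝ V]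
    {S T : E →ₗ[ℝ] V} (h : ∀ γ : ℝ → H, (∀ t, γ t ∈ K) → γ 0 = 1 →
      MDifferentiableAt 𝓘(ℝ, ℝ) 𝓘(ℝ, E) γ 0 →
      S ((mfderiv 𝓘(ℝ, ℝ) 𝓘(ℝ, E) γ 0 : ℝ →L[ℝ] E) 1) =
        T ((mfderiv 𝓘(ℝ, ℝ) 𝓘(ℝ, E) γ 0 : ℝ →L[ℝ] E) 1))
    {v : GroupLieAlgebra 𝓘(ℝ, E) H} (hv : v ∈ subgroupLieAlgebra E K) : S v = T v := by
  have h1 : subgroupLieAlgebra E K ≤ LinearMap.eqLocus S T := by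
    refine Submodule.span_le.2 ?_
    rintro v ⟨γ, hγK, h0, hγ, rfl⟩
    exact h γ hγK h0 hγ
  exact h1 hv

end SubgroupLieAlgebra

/-! ### The kernel of the derivative of the projection is `Δ𝔨`. -/

section Projection

theorem mk_eq_mk_one_iff {H : Type*} [Group H] {K : Subgroup H} {a : H × H} :
    (a : DiagQuotient K) = ((1 : H × H) : DiagQuotient K) ↔ a.1 = a.2 ∧ a.1 ∈ K := by
  rw [eq_comm, QuotientGroup.eq, inv_one, one_mul, diagSubgroup, Subgroup.mem_map]
  constructor
  · rintro ⟨k, hk, rfl⟩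
    exact ⟨rfl, hk⟩
  · rintro ⟨h1, h2⟩
    exact ⟨a.1, h2, Prod.ext rfl h1⟩

variable {E : Type*} [NormedAddCommGroup E] [NormedSpace ℝ E] [FiniteDimensional ℝ E]
  {H : Type*} [TopologicalSpace H] [ChartedSpace E H] [Group H] [LieGroup 𝓘(ℝ, E) ∞ H]
  {F : Type*} [NormedAddCommGroup F] [NormedSpace ℝ F]
  {K : Subgroup H} [ChartedSpace F (DiagQuotient K)]

variable (E F K) in
/-- The derivative of the projection `H × H → H × H / ΔK` at the identity. -/
def mkDeriv : E × E →L[ℝ] F :=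
  mfderiv (𝓘(ℝ, E).prod 𝓘(ℝ, E)) 𝓘(ℝ, F) (fun a : H × H ↦ (a : DiagQuotient K)) (1 : H × H)

omit [FiniteDimensional ℝ E] [LieGroup 𝓘(ℝ, E) ∞ H] in
theorem mkDeriv_diag (hM : IsHomogeneousManifold E F K) {Z : GroupLieAlgebra 𝓘(ℝ, E) H}
    (hZ : Z ∈ subgroupLieAlgebra E K) : mkDeriv E F K (Z, Z) = 0 := by
  refine apply_eq_of_mem_subgroupLieAlgebra (K := K)
    (S := ((mkDeriv E F K).comp ((ContinuousLinearMap.id ℝ E).prod (.id ℝ E)) : E →ₗ[ℝ] F))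
    (T := 0) (fun γ hγK h0 hγ ↦ ?_) hZ
  have h1 : MDifferentiableAt 𝓘(ℝ, ℝ) (𝓘(ℝ, E).prod 𝓘(ℝ, E)) (fun t ↦ (γ t, γ t)) 0 :=
    hγ.prodMk hγ
  have h2 := mfderiv_comp_model (y := (1 : H × H))
    ((hM.contMDiff_mk 1).mdifferentiableAt (by simp)) h1 (by rw [h0]; rfl)
  have h3 : (fun t ↦ ((γ t, γ t) : DiagQuotient K)) =
      fun _ ↦ ((1 : H × H) : DiagQuotient K) := by
    ext t
    exact mk_eq_mk_one_iff.2 ⟨rfl, hγK t⟩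
  rw [h3, mfderiv_const, mfderiv_prodMk hγ hγ] at h2
  exact (congrArg (fun L : ℝ →L[ℝ] F ↦ L 1) h2).symm

/-- A kernel vector is the velocity of a curve in the fibre over the base point, and this fibre is
`ΔK`. -/
theorem eq_and_mem_of_mkDeriv_eq_zero [FiniteDimensional ℝ F] (hM : IsHomogeneousManifold E F K)
    {X Y : GroupLieAlgebra 𝓘(ℝ, E) H} (h : mkDeriv E F K (X, Y) = 0) :
    X = Y ∧ X ∈ subgroupLieAlgebra E K := by
  obtain ⟨γ, h0, hγ, hv, hq⟩ := exists_curve_of_mfderiv_eq_zero (hM.contMDiff_mk 1)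
    (hM.surjective_mfderiv_mk 1) (v := ((X, Y) : E × E)) h
  have h1 : MDifferentiableAt 𝓘(ℝ, ℝ) 𝓘(ℝ, E) (fun t ↦ (γ t).1) 0 :=
    mdifferentiableAt_fst.comp (0 : ℝ) hγ
  have hd1 : (mfderiv 𝓘(ℝ, ℝ) 𝓘(ℝ, E) (fun t ↦ (γ t).1) 0 : ℝ →L[ℝ] E) 1 = X := by
    have := mfderiv_comp (0 : ℝ) (mdifferentiableAt_fst (I := 𝓘(ℝ, E)) (I' := 𝓘(ℝ, E))) hγ
    rw [mfderiv_fst] at this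
    refine (congrArg (fun L : ℝ →L[ℝ] E ↦ L 1) this).trans ?_
    exact congrArg Prod.fst hv
  have hd2 : (mfderiv 𝓘(ℝ, ℝ) 𝓘(ℝ, E) (fun t ↦ (γ t).2) 0 : ℝ →L[ℝ] E) 1 = Y := by
    have := mfderiv_comp (0 : ℝ) (mdifferentiableAt_snd (I := 𝓘(ℝ, E)) (I' := 𝓘(ℝ, E))) hγ
    rw [mfderiv_snd] at this
    refine (congrArg (fun L : ℝ →L[ℝ] E ↦ L 1) this).trans ?_
    exact congrArg Prod.snd hv
  have hq' : ∀ᶠ t in nhds (0 : ℝ), (γ t).1 = (γ t).2 ∧ (γ t).1 ∈ K := by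
    filter_upwards [hq] with t ht using mk_eq_mk_one_iff.1 ht
  constructor
  · have heq : (fun t ↦ (γ t).1) =ᶠ[nhds 0] fun t ↦ (γ t).2 := by
      filter_upwards [hq'] with t ht using ht.1
    rw [← hd1, ← hd2, heq.mfderiv_eq]
    rfl
  · exact mfderiv_mem_subgroupLieAlgebra (by rw [h0]; rfl) h1 (hq'.mono fun t ht ↦ ht.2) hd1

end Projection

/-! ### The derivative of the involution on the Lie algebra. -/

section Involution

variable {E : Type*} [NormedAddCommGroup E] [NormedSpace ℝ E] [FiniteDimensional ℝ E]
  {H : Type*} [TopologicalSpace H] [ChartedSpace E H] [Group H] [LieGroup 𝓘(ℝ, E) ∞ H]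
  {K : Subgroup H}

variable (E) in
/-- The derivative at the identity of an endomorphism of `H`. -/
def homDeriv (θ : H →* H) : E →L[ℝ] E := mfderiv 𝓘(ℝ, E) 𝓘(ℝ, E) θ 1

/-- A homomorphism satisfies `θ* mc = dθ ∘ mc`. Compare the Maurer–Cartan equations of both sides at
the centre of the chart at `1`, where `mc` is the identity. -/
theorem homDeriv_lieBracket {θ : H →* H} (hθ : ContMDiff 𝓘(ℝ, E) 𝓘(ℝ, E) ∞ θ) (u v : E) :
    homDeriv E θ (lieBracketCLM E H u v) =
      lieBracketCLM E H (homDeriv E θ u) (homDeriv E θ v) := by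
  have hI : IsManifold 𝓘(ℝ, E) 1 H := IsManifold.of_le (n := ∞) (by simp)
  set φ := extChartAt 𝓘(ℝ, E) (1 : H) with hφ
  set x₀ := φ 1 with hx₀
  have hs : ContMDiffAt 𝓘(ℝ, E) 𝓘(ℝ, E) ∞ φ.symm x₀ := contMDiffAt_extChartAt_symm_self (1 : H)
  have hs' : ContMDiffAt 𝓘(ℝ, E) 𝓘(ℝ, E) ∞ (fun x ↦ θ (φ.symm x)) x₀ := hθ.contMDiffAt.comp x₀ hs
  have hsx : φ.symm x₀ = 1 := extChartAt_to_inv _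
  have hd : ∀ᶠ x in nhds x₀, MDifferentiableAt 𝓘(ℝ, E) 𝓘(ℝ, E) φ.symm x := by
    filter_upwards [extChartAt_target_mem_nhds (I := 𝓘(ℝ, E)) (1 : H)] with x hx
    exact ((contMDiffOn_extChartAt_symm (n := ∞) (1 : H)).contMDiffAt
      (isOpen_extChartAt_target _ |>.mem_nhds hx)).mdifferentiableAt (by simp)
  have heq : mcForm (E := E) (fun x ↦ θ (φ.symm x)) =ᶠ[nhds x₀]
      fun x ↦ (homDeriv E θ).comp (mcForm φ.symm x) := by
    filter_upwards [hd] with x hx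
    have h1 : MDifferentiableAt 𝓘(ℝ, E) 𝓘(ℝ, E) (fun z ↦ (φ.symm x)⁻¹ * φ.symm z) x :=
      (contMDiff_mul_left (n := ∞)).mdifferentiableAt (by simp) |>.comp _ hx
    have h2 := mfderiv_comp_model (y := (1 : H)) (hθ.mdifferentiableAt (by simp)) h1
      (inv_mul_cancel _)
    have h3 : (fun z ↦ θ ((φ.symm x)⁻¹ * φ.symm z)) =
        fun z ↦ (θ (φ.symm x))⁻¹ * θ (φ.symm z) := by
      ext; simp
    rw [h3] at h2
    exact h2
  have hA : mcForm (E := E) φ.symm x₀ = ContinuousLinearMap.id ℝ E := by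
    have h1 : (fun z ↦ (φ.symm x₀)⁻¹ * φ.symm z) = φ.symm := by ext; simp [hsx]
    rw [mcForm, h1]
    exact mfderiv_extChartAt_symm_self (1 : H)
  have hmc := maurerCartan (hs.of_le ENat.LEInfty.out) u v
  have hmc' := maurerCartan (hs'.of_le ENat.LEInfty.out) u v
  have hAd : DifferentiableAt ℝ (mcForm (E := E) φ.symm) x₀ :=
    (contDiffAt_mcForm hs).differentiableAt (by simp)
  have hder : HasFDerivAt (fun x ↦ (homDeriv E θ).comp (mcForm φ.symm x)) _ x₀ :=
    (hasFDerivAt_const (homDeriv E θ) x₀).clm_comp hAd.hasFDerivAt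
  rw [heq.fderiv_eq, heq.self_of_nhds, hder.fderiv, hA] at hmc'
  simp only [add_apply, ContinuousLinearMap.comp_apply, ContinuousLinearMap.compL_apply,
    zero_apply, map_zero, add_zero, ← map_sub, hmc, hA,
    ContinuousLinearMap.id_apply, map_neg, neg_inj, ContinuousLinearMap.comp_id] at hmc'
  exact hmc'

omit [FiniteDimensional ℝ E] [LieGroup 𝓘(ℝ, E) ∞ H] in
theorem homDeriv_homDeriv {θ : H →* H} (hθ : ContMDiff 𝓘(ℝ, E) 𝓘(ℝ, E) ∞ θ)
    (hinv : ∀ h, θ (θ h) = h) (v : E) : homDeriv E θ (homDeriv E θ v) = v := by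
  have h1 := mfderiv_comp_model (x := (1 : H)) (y := (1 : H))
    (hθ.mdifferentiableAt (by simp)) (hθ.mdifferentiableAt (by simp)) (map_one θ)
  have h2 : (fun h ↦ θ (θ h)) = id := funext hinv
  rw [h2, mfderiv_id] at h1
  exact (congrArg (fun L : E →L[ℝ] E ↦ L v) h1).symm

omit [FiniteDimensional ℝ E] [LieGroup 𝓘(ℝ, E) ∞ H] in
theorem homDeriv_eq_self {θ : H →* H} (hθ : ContMDiff 𝓘(ℝ, E) 𝓘(ℝ, E) ∞ θ)
    (hfix : ∀ k ∈ K, θ k = k) {v : GroupLieAlgebra 𝓘(ℝ, E) H}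
    (hv : v ∈ subgroupLieAlgebra E K) : homDeriv E θ v = v := by
  refine apply_eq_of_mem_subgroupLieAlgebra (K := K) (S := (homDeriv E θ : E →ₗ[ℝ] E))
    (T := LinearMap.id) (fun γ hγK h0 hγ ↦ ?_) hv
  have h1 := mfderiv_comp_model (y := (1 : H)) (hθ.mdifferentiableAt (by simp)) hγ h0
  have h2 : (fun t ↦ θ (γ t)) = γ := funext fun t ↦ hfix _ (hγK t)
  rw [h2] at h1
  exact (congrArg (fun L : ℝ →L[ℝ] E ↦ L 1) h1).symm

end Involution

/-! ### Fixed vectors of the involution belong to `𝔨`. -/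

section FixedPoints

variable {E : Type*} [NormedAddCommGroup E] [NormedSpace ℝ E] [FiniteDimensional ℝ E]
  {H : Type*} [TopologicalSpace H] [ChartedSpace E H] [Group H] [LieGroup 𝓘(ℝ, E) ∞ H]
  {K : Subgroup H}

/-- An involution is linear near a fixed point in suitable coordinates. The line spanned by a vector
fixed by `dθ` then becomes a curve of fixed points through `1`, which stays in the identity
component and hence in `K`. -/
theorem mem_subgroupLieAlgebra_of_homDeriv_eq_self {θ : H →* H}
    (hθ : ContMDiff 𝓘(ℝ, E) 𝓘(ℝ, E) ∞ θ) (hinv : ∀ h, θ (θ h) = h)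
    (hcomp : connectedComponentIn {h | θ h = h} 1 ⊆ (K : Set H)) {v : GroupLieAlgebra 𝓘(ℝ, E) H}
    (hv : homDeriv E θ v = v) : v ∈ subgroupLieAlgebra E K := by
  have hI : IsManifold 𝓘(ℝ, E) 1 H := IsManifold.of_le (n := ∞) (by simp)
  set φ := extChartAt 𝓘(ℝ, E) (1 : H) with hφ
  set x₀ := φ 1 with hx₀
  set σ : E →L[ℝ] E := homDeriv E θ with hσ
  have hsx : φ.symm x₀ = 1 := extChartAt_to_inv _
  let τ : E → E := fun x ↦ φ (θ (φ.symm x))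
  have hτw : writtenInExtChartAt 𝓘(ℝ, E) 𝓘(ℝ, E) 1 θ = τ := by
    ext x
    simp only [writtenInExtChartAt, map_one, Function.comp_apply, τ, hφ]
  have hτ0 : τ x₀ = x₀ := by
    change φ (θ (φ.symm x₀)) = x₀
    rw [hsx, map_one]
  have hτ : ContDiffAt ℝ ∞ τ x₀ := hτw ▸ contDiffAt_writtenInExtChartAt hθ.contMDiffAt
  have hτd : HasFDerivAt τ σ x₀ :=
    hτw ▸ (hasStrictFDerivAt_writtenInExtChartAt hθ.contMDiffAt).hasFDerivAt
  have htarget : ∀ᶠ x in nhds x₀, x ∈ φ.target := extChartAt_target_mem_nhds 1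
  have hsymm : ContinuousAt φ.symm x₀ := (contMDiffAt_extChartAt_symm_self (1 : H)).continuousAt
  have hθsource : ∀ᶠ x in nhds x₀, θ (φ.symm x) ∈ φ.source := by
    have h1 : ContinuousAt (fun x ↦ θ (φ.symm x)) x₀ := hθ.continuous.continuousAt.comp hsymm
    refine h1.preimage_mem_nhds ?_
    rw [hsx, map_one]
    exact extChartAt_source_mem_nhds _
  have hττ : ∀ᶠ x in nhds x₀, τ (τ x) = x := by
    filter_upwards [htarget, hθsource] with x hx hx'
    simp only [τ, φ.left_inv hx', hinv, φ.right_inv hx]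
  -- Bochner's averaging over the group `{1, θ}`: `G` conjugates `τ` to its linear part `σ`, and its
  -- derivative at `x₀` is the identity because `σ² = 1`.
  let G : E → E := fun x ↦ (1 / 2 : ℝ) • ((x - x₀) + σ (τ x - x₀))
  have hG0 : G x₀ = 0 := by simp [G, hτ0]
  have hG : ContDiffAt ℝ ∞ G x₀ := by
    refine ContDiffAt.const_smul _ ((contDiffAt_id.sub contDiffAt_const).add ?_)
    exact σ.contDiff.contDiffAt.comp x₀ (hτ.sub contDiffAt_const)
  have hGd : HasFDerivAt G (ContinuousLinearEquiv.refl ℝ E : E →L[ℝ] E) x₀ := by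
    have h1 : HasFDerivAt G ((1 / 2 : ℝ) • (ContinuousLinearMap.id ℝ E + σ.comp σ)) x₀ :=
      (((hasFDerivAt_id x₀).sub_const x₀).add
        (σ.hasFDerivAt.comp x₀ (hτd.sub_const x₀))).const_smul (1 / 2 : ℝ)
    refine h1.congr_fderiv ?_
    ext w
    have : σ (σ w) = w := homDeriv_homDeriv hθ hinv w
    simp only [smul_apply, add_apply, ContinuousLinearMap.comp_apply,
      ContinuousLinearMap.id_apply, this, ContinuousLinearEquiv.coe_refl]
    module
  have hGτ : ∀ᶠ x in nhds x₀, G (τ x) = σ (G x) := by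
    filter_upwards [hττ] with x hx
    have : σ (σ (τ x - x₀)) = τ x - x₀ := homDeriv_homDeriv hθ hinv _
    simp only [G, hx, map_smul, map_add, this]
    rw [add_comm]
  let r : E → E := hG.localInverse hGd (by simp)
  have hr : ContDiffAt ℝ ∞ r 0 := hG0 ▸ hG.to_localInverse hGd (by simp)
  have hr0 : r 0 = x₀ := hG0 ▸ hG.localInverse_apply_image hGd (by simp)
  have hGr : ∀ᶠ y in nhds 0, G (r y) = y :=
    hG0 ▸ (hG.hasStrictFDerivAt' hGd (by simp)).eventually_right_inverse
  have hrG : ∀ᶠ x in nhds x₀, r (G x) = x :=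
    (hG.hasStrictFDerivAt' hGd (by simp)).eventually_left_inverse
  have hrd : HasFDerivAt r (ContinuousLinearMap.id ℝ E) 0 := by
    have := (hG.hasStrictFDerivAt' hGd (by simp)).to_localInverse.hasFDerivAt
    rw [hG0] at this
    exact this
  have hrc : ∀ᶠ y in nhds 0, ContinuousAt r y := by
    filter_upwards [(hr.of_le (m := 1) (by simp)).eventually (by simp)] with y hy
      using hy.continuousAt
  let v' : E := v
  let l : ℝ → E := fun t ↦ t • v'
  have hl : Filter.Tendsto l (nhds 0) (nhds 0) := by
    have : Continuous l := by fun_prop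
    simpa [l] using this.tendsto 0
  let c : ℝ → E := fun t ↦ r (l t)
  have hc0 : c 0 = x₀ := by simp [c, l, hr0]
  have hcl : Filter.Tendsto c (nhds 0) (nhds x₀) := by
    have := hr.continuousAt.tendsto.comp hl
    rwa [hr0] at this
  have hcτ : ∀ᶠ t in nhds 0, τ (c t) = c t := by
    have h1 : Filter.Tendsto (fun t ↦ τ (c t)) (nhds 0) (nhds x₀) := by
      have := hτ.continuousAt.tendsto.comp hcl
      rwa [hτ0] at this
    filter_upwards [h1.eventually hrG, hcl.eventually hGτ, hl.eventually hGr] with t h2 h3 h4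
    have h5 : σ (l t) = l t := by
      simp only [l, map_smul]
      exact congrArg (t • ·) hv
    rw [← h2, h3, h4, h5]
  let γ : ℝ → H := fun t ↦ φ.symm (c t)
  have hγ0 : γ 0 = 1 := by simp only [γ, hc0, hsx]
  have hγθ : ∀ᶠ t in nhds 0, θ (γ t) = γ t := by
    filter_upwards [hcτ, hcl.eventually hθsource, hcl.eventually htarget] with t h1 h2 h3
    refine φ.injOn h2 (φ.map_target h3) ?_
    rw [φ.right_inv h3]
    exact h1
  have hγc : ∀ᶠ t in nhds 0, ContinuousAt γ t := by
    have h1 : ∀ᶠ x in nhds x₀, ContinuousAt φ.symm x := by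
      filter_upwards [htarget] with x hx
      exact continuousAt_extChartAt_symm'' hx
    filter_upwards [hcl.eventually h1, hl.eventually hrc] with t ht ht'
    have : ContinuousAt c t := ContinuousAt.comp (g := r) ht' (by fun_prop)
    exact ContinuousAt.comp (g := φ.symm) ht this
  have hγK : ∀ᶠ t in nhds 0, γ t ∈ K := by
    obtain ⟨ε, hε, hball⟩ := Metric.eventually_nhds_iff_ball.1 (hγθ.and hγc)
    have hpre : IsPreconnected (γ '' Metric.ball 0 ε) :=
      (convex_ball (0 : ℝ) ε).isPreconnected.image γ
        (fun t ht ↦ (hball t ht).2.continuousWithinAt)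
    have hsub : γ '' Metric.ball 0 ε ⊆ {h | θ h = h} := by
      rintro _ ⟨t, ht, rfl⟩
      exact (hball t ht).1
    have hone : (1 : H) ∈ γ '' Metric.ball 0 ε := ⟨0, Metric.mem_ball_self hε, hγ0⟩
    filter_upwards [Metric.ball_mem_nhds (0 : ℝ) hε] with t ht
    exact hcomp (hpre.subset_connectedComponentIn hone hsub ⟨t, ht, rfl⟩)
  have hcd : HasFDerivAt c ((1 : ℝ →L[ℝ] ℝ).smulRight v') 0 := by
    have h1 : HasFDerivAt l ((1 : ℝ →L[ℝ] ℝ).smulRight v') 0 :=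
      ((1 : ℝ →L[ℝ] ℝ).smulRight v').hasFDerivAt
    have h2 : HasFDerivAt r (ContinuousLinearMap.id ℝ E) (l 0) := by simpa [l] using hrd
    exact h2.comp (0 : ℝ) h1
  have hsd : MDifferentiableAt 𝓘(ℝ, E) 𝓘(ℝ, E) φ.symm x₀ :=
    (contMDiffAt_extChartAt_symm_self (1 : H)).mdifferentiableAt (by simp)
  refine mfderiv_mem_subgroupLieAlgebra hγ0
    (hsd.comp_of_eq (0 : ℝ) (hcd.differentiableAt.mdifferentiableAt) hc0) hγK ?_
  have h1 := mfderiv_comp_model hsd hcd.differentiableAt.mdifferentiableAt hc0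
  have h2 := congrArg (fun T : ℝ →L[ℝ] E ↦ T 1) h1
  refine h2.trans ?_
  rw [mfderiv_eq_fderiv, hcd.fderiv, mfderiv_extChartAt_symm_self]
  exact one_smul ℝ v'

end FixedPoints

/-! ### Orthonormal frames and traces. -/

section OrthonormalFrames

theorem exists_orthonormal_frame {V : Type*} [AddCommGroup V] [Module ℝ V]
    (B : LinearMap.BilinForm ℝ V) (S : Submodule ℝ V) [FiniteDimensional ℝ S] {m : ℕ} (hm : Module.finrank ℝ S = m)
    (hsymm : ∀ v w, B v w = B w v) (hpos : ∀ v ∈ S, v ≠ 0 → 0 < B v v) :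
    ∃ b : Fin m → V, (∀ i, b i ∈ S) ∧ (∀ i j, B (b i) (b j) = if i = j then 1 else 0) ∧
      ∀ v ∈ S, v = ∑ i, B v (b i) • b i := by
  let core : InnerProductSpace.Core ℝ S :=
    { inner v w := B v w
      conj_inner_symm v w := hsymm _ _
      re_inner_nonneg v := by
        by_cases h : (v : V) = 0
        · simp [h]
        · exact (hpos v v.2 h).le
      add_left u v w := by simp
      smul_left u v c := by simp
      definite v hv := by
        by_contra h
        exact (hpos v v.2 fun h' ↦ h (Subtype.ext h')).ne' hv }
  let := core.toNormedAddCommGroup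
  let := InnerProductSpace.ofCore core.toCore
  let b := (stdOrthonormalBasis ℝ S).reindex (finCongr hm)
  have hb (v w : S) : inner ℝ v w = B v w := rfl
  refine ⟨fun i ↦ b i, fun i ↦ (b i).2, fun i j ↦ ?_, fun v hv ↦ ?_⟩
  · rw [← hb]
    exact orthonormal_iff_ite.1 b.orthonormal i j
  · have := congrArg Subtype.val (b.sum_repr' ⟨v, hv⟩)
    rw [Submodule.coe_sum] at this
    refine this.symm.trans (Finset.sum_congr rfl fun i _ ↦ ?_)
    rw [Submodule.coe_smul, hb, hsymm]

theorem trace_eq_sum_of_frame {V : Type*} [AddCommGroup V] [Module ℝ V] [FiniteDimensional ℝ V]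
    {κ : Type*} [Fintype κ] (B : LinearMap.BilinForm ℝ V) (e : κ → V)
    (he : ∀ v, v = ∑ i, B v (e i) • e i) (T : V →ₗ[ℝ] V) :
    LinearMap.trace ℝ V T = ∑ i, B (T (e i)) (e i) := by
  have h : T = ∑ i, (B.flip (e i)).smulRight (T (e i)) := by
    ext v
    conv_lhs => rw [he v]
    simp [LinearMap.sum_apply]
  conv_lhs => rw [h]
  simp [LinearMap.trace_smulRight]

end OrthonormalFrames

/-! ### Killing form identities for an involution. -/

section SymmetricPair

variable {L : Type*} [LieRing L] [LieAlgebra ℝ L]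

theorem killingForm_lie_left (u v w : L) :
    killingForm ℝ L ⁅u, v⁆ w = killingForm ℝ L u ⁅v, w⁆ :=
  LieModule.traceForm_apply_lie_apply ℝ L L u v w

theorem killingForm_symm (u v : L) : killingForm ℝ L u v = killingForm ℝ L v u :=
  LieModule.traceForm_comm ℝ L L u v

theorem killingForm_apply_involution {σ : L →ₗ[ℝ] L} (hσ : ∀ u v, σ ⁅u, v⁆ = ⁅σ u, σ v⁆)
    (hinv : ∀ v, σ (σ v) = v) (u v : L) : killingForm ℝ L (σ u) (σ v) = killingForm ℝ L u v := by
  let e : L ≃ₗ⁅ℝ⁆ L := { σ with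
    map_lie' := hσ _ _
    invFun := σ
    left_inv := hinv
    right_inv := hinv }
  exact LieAlgebra.killingForm_of_equiv_apply e u v

/-- The complement of the fixed-point algebra of an involution is the `-1`-eigenspace. -/
theorem mem_orthogonal_killingForm_iff {σ : L →ₗ[ℝ] L} (hσ : ∀ u v, σ ⁅u, v⁆ = ⁅σ u, σ v⁆)
    (hinv : ∀ v, σ (σ v) = v) {S : Submodule ℝ L} (hS : ∀ v, v ∈ S ↔ σ v = v)
    (hneg : ∀ v ∈ S, v ≠ 0 → killingForm ℝ L v v < 0) {v : L} :
    v ∈ (killingForm ℝ L).orthogonal S ↔ σ v = -v := by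
  rw [LinearMap.BilinForm.mem_orthogonal_iff]
  have key {w : L} (hw : σ w = -w) (z : L) (hz : z ∈ S) : killingForm ℝ L z w = 0 := by
    have := killingForm_apply_involution hσ hinv z w
    rw [(hS z).1 hz, hw, map_neg] at this
    linarith
  constructor
  · intro h
    have h1 : v + σ v ∈ S := (hS _).2 (by rw [map_add, hinv, add_comm])
    have h2 : σ (v - σ v) = -(v - σ v) := by rw [map_sub, hinv]; abel
    have h3 : killingForm ℝ L (v + σ v) v = 0 := h _ h1
    have h4 := key h2 _ h1
    by_contra hne
    have h5 : v + σ v ≠ 0 := fun h ↦ hne (eq_neg_of_add_eq_zero_right h)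
    have h6 := hneg _ h1 h5
    -- The vector `v + σ v` is orthogonal to `v` and to `v - σ v`, hence to itself, contrary to
    -- negative definiteness on `S`.
    have h7 : v + σ v = (2 : ℝ) • v - (v - σ v) := by module
    nth_rewrite 2 [h7] at h6
    rw [map_sub, map_smul, h3, h4] at h6
    simp at h6
  · intro h z hz
    exact key h z hz

variable [FiniteDimensional ℝ L]

/-- Evaluate the trace of `(ad v)²` in the frame and move one `ad v` across by invariance. This is
the source of the Casimir identity. -/
theorem killingForm_self_eq_neg_sum {κ : Type*} [Fintype κ] (e : κ → L)
    (he : ∀ v, v = ∑ i, -killingForm ℝ L v (e i) • e i) (v : L) :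
    killingForm ℝ L v v = ∑ i, killingForm ℝ L ⁅v, e i⁆ ⁅v, e i⁆ := by
  rw [killingForm_apply_apply,
    trace_eq_sum_of_frame (-killingForm ℝ L) e (fun w ↦ by simpa using he w)]
  refine Finset.sum_congr rfl fun i _ ↦ ?_
  simp only [LinearMap.comp_apply, LieAlgebra.ad_apply, LinearMap.neg_apply]
  rw [← lie_skew v ⁅v, e i⁆, map_neg, LinearMap.neg_apply, killingForm_lie_left, neg_neg]

end SymmetricPair

/-! ### Adapted frames from the involution. -/

section IsSymmetricFrame

variable {E : Type*} [NormedAddCommGroup E] [NormedSpace ℝ E] [FiniteDimensional ℝ E]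

/-- Minus the Killing form of the Lie algebra of `H`, as a form on the model space. -/
def negKillingCLM (E : Type*) [NormedAddCommGroup E] [NormedSpace ℝ E] [FiniteDimensional ℝ E]
    (H : Type*) [TopologicalSpace H] [ChartedSpace E H] [Group H] [LieGroup 𝓘(ℝ, E) ∞ H] :
    E →L[ℝ] E →L[ℝ] ℝ :=
  LinearMap.toContinuousBilinearMap
    (-killingForm ℝ (GroupLieAlgebra 𝓘(ℝ, E) H) :
      GroupLieAlgebra 𝓘(ℝ, E) H →ₗ[ℝ] GroupLieAlgebra 𝓘(ℝ, E) H →ₗ[ℝ] ℝ)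

variable {H : Type*} [TopologicalSpace H] [ChartedSpace E H] [Group H] [LieGroup 𝓘(ℝ, E) ∞ H]
  {K : Subgroup H}

/-- The algebra `𝔨` is the `+1`-eigenspace and `𝔮` the `-1`-eigenspace of `dθ`, so they are
complementary and the bracket relations are sign rules. Definiteness provides orthonormal bases of
both. -/
theorem exists_isSymmetricFrame {θ : H →* H} (hθ : ContMDiff 𝓘(ℝ, E) 𝓘(ℝ, E) ∞ θ)
    (hinv : ∀ h, θ (θ h) = h) (hfix : ∀ k ∈ K, θ k = k)
    (hcomp : connectedComponentIn {h | θ h = h} 1 ⊆ (K : Set H))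
    (hk : ∀ v ∈ subgroupLieAlgebra E K, v ≠ 0 →
      killingForm ℝ (GroupLieAlgebra 𝓘(ℝ, E) H) v v < 0)
    (hq : ∀ v ∈ killingComplement E K, v ≠ 0 →
      killingForm ℝ (GroupLieAlgebra 𝓘(ℝ, E) H) v v < 0)
    {d n : ℕ} (hd : Module.finrank ℝ (subgroupLieAlgebra E K) = d)
    (hn : Module.finrank ℝ E = d + n) :
    ∃ (X : Fin n → E) (Z : Fin d → E),
      (∀ i, (X i : GroupLieAlgebra 𝓘(ℝ, E) H) ∈ killingComplement E K) ∧
      (∀ a, (Z a : GroupLieAlgebra 𝓘(ℝ, E) H) ∈ subgroupLieAlgebra E K) ∧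
      IsSymmetricFrame (lieBracketCLM E H) (negKillingCLM E H) X Z := by
  let L := GroupLieAlgebra 𝓘(ℝ, E) H
  have : FiniteDimensional ℝ L := inferInstanceAs (FiniteDimensional ℝ E)
  let σ : L →ₗ[ℝ] L := (homDeriv E θ : E →ₗ[ℝ] E)
  have hσ (u v : L) : σ ⁅u, v⁆ = ⁅σ u, σ v⁆ := homDeriv_lieBracket hθ u v
  have hσσ (v : L) : σ (σ v) = v := homDeriv_homDeriv hθ hinv v
  have hS (v : L) : v ∈ subgroupLieAlgebra E K ↔ σ v = v :=
    ⟨homDeriv_eq_self hθ hfix, mem_subgroupLieAlgebra_of_homDeriv_eq_self hθ hinv hcomp⟩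
  have hQ (v : L) : v ∈ killingComplement E K ↔ σ v = -v :=
    mem_orthogonal_killingForm_iff hσ hσσ hS hk
  have hcompl : IsCompl (subgroupLieAlgebra E K) (killingComplement E K) := by
    refine ⟨Submodule.disjoint_def.2 fun v hv hv' ↦ ?_, codisjoint_iff.2 ?_⟩
    · have h1 := (hS v).1 hv
      rw [(hQ v).1 hv'] at h1
      have h2 : (2 : ℝ) • v = 0 := by
        rw [two_smul]
        nth_rewrite 1 [← h1]
        exact neg_add_cancel v
      simpa using h2
    · refine Submodule.eq_top_iff'.2 fun v ↦ Submodule.mem_sup.2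
        ⟨(1 / 2 : ℝ) • (v + σ v), (hS _).2 ?_, (1 / 2 : ℝ) • (v - σ v), (hQ _).2 ?_, by module⟩
      · rw [map_smul, map_add, hσσ, add_comm]
      · rw [map_smul, map_sub, hσσ]; module
  have hn' : Module.finrank ℝ (killingComplement E K) = n := by
    have h1 := Submodule.finrank_add_eq_of_isCompl hcompl
    have h2 : Module.finrank ℝ (GroupLieAlgebra 𝓘(ℝ, E) H) = d + n := hn
    omega
  have hortho {z x : L} (hz : z ∈ subgroupLieAlgebra E K) (hx : x ∈ killingComplement E K) :
      killingForm ℝ L z x = 0 := (LinearMap.BilinForm.mem_orthogonal_iff.1 hx) z hz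
  obtain ⟨X, hXmem, hX, hXsum⟩ := exists_orthonormal_frame (-killingForm ℝ L)
    (killingComplement E K) hn' (fun v w ↦ by simp [killingForm_symm v w])
    (fun v hv h0 ↦ by simpa using hq v hv h0)
  obtain ⟨Z, hZmem, hZ, hZsum⟩ := exists_orthonormal_frame (-killingForm ℝ L)
    (subgroupLieAlgebra E K) hd (fun v w ↦ by simp [killingForm_symm v w])
    (fun v hv h0 ↦ by simpa using hk v hv h0)
  have hsum (v : L) : v = ∑ i, (-killingForm ℝ L) v (X i) • X i +
      ∑ a, (-killingForm ℝ L) v (Z a) • Z a := by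
    obtain ⟨z, hz, x, hx, rfl⟩ := Submodule.mem_sup.1
      (hcompl.sup_eq_top ▸ Submodule.mem_top : v ∈ _)
    have h1 (i : Fin n) : (-killingForm ℝ L) (z + x) (X i) = (-killingForm ℝ L) x (X i) := by
      simp [hortho hz (hXmem i)]
    have h2 (a : Fin d) : (-killingForm ℝ L) (z + x) (Z a) = (-killingForm ℝ L) z (Z a) := by
      have : killingForm ℝ L x (Z a) = 0 := by rw [killingForm_symm, hortho (hZmem a) hx]
      simp [this]
    simp only [h1, h2]
    rw [← hXsum x hx, ← hZsum z hz, add_comm]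
  have hcas (v : L) : killingForm ℝ L v v =
      ∑ i, killingForm ℝ L ⁅v, X i⁆ ⁅v, X i⁆ + ∑ a, killingForm ℝ L ⁅v, Z a⁆ ⁅v, Z a⁆ := by
    have := killingForm_self_eq_neg_sum (Sum.elim X Z)
      (fun w ↦ by
        simp only [Fintype.sum_sum_type, Sum.elim_inl, Sum.elim_inr]
        exact hsum w) v
    simpa [Fintype.sum_sum_type] using this
  refine ⟨X, Z, hXmem, hZmem, ?_⟩
  exact
    { br_skew a c := (lie_skew (L := L) a c).symm
      ip_symm a c := congrArg Neg.neg (killingForm_symm (L := L) a c)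
      ip_invariant a c e := congrArg Neg.neg (killingForm_lie_left (L := L) a c e)
      ip_X_X := hX
      ip_Z_Z := hZ
      ip_X_Z i a := by
        have : killingForm ℝ L (X i) (Z a) = 0 := by
          rw [killingForm_symm, hortho (hZmem a) (hXmem i)]
        exact neg_eq_zero.2 this
      eq_sum := hsum
      br_X_X i j k := by
        refine neg_eq_zero.2 (hortho (z := ⁅X i, X j⁆) ((hS _).2 ?_) (hXmem k))
        rw [hσ, (hQ _).1 (hXmem i), (hQ _).1 (hXmem j), neg_lie, lie_neg, neg_neg]
      br_Z_Z a b i := by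
        refine neg_eq_zero.2 (hortho (z := ⁅Z a, Z b⁆) ((hS _).2 ?_) (hXmem i))
        rw [hσ, (hS _).1 (hZmem a), (hS _).1 (hZmem b)]
      casimir v := by
        have h1 := congrArg Neg.neg (hcas v)
        rw [neg_add, ← Finset.sum_neg_distrib, ← Finset.sum_neg_distrib] at h1
        exact h1 }

end IsSymmetricFrame

/-! ### The metric at the base point, pulled back to `𝔥 ⊕ 𝔥`. -/

section InvariantMetric

variable {E : Type*} [NormedAddCommGroup E] [NormedSpace ℝ E] [FiniteDimensional ℝ E]
  {H : Type*} [TopologicalSpace H] [ChartedSpace E H] [Group H] [LieGroup 𝓘(ℝ, E) ∞ H]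
  {F : Type*} [NormedAddCommGroup F] [NormedSpace ℝ F] [FiniteDimensional ℝ F]
  {K : Subgroup H} [ChartedSpace F (DiagQuotient K)]
  [IsManifold 𝓘(ℝ, F) ∞ (DiagQuotient K)]

/-- The metric `g` at `p`, as a form on the model space. -/
def metricForm (g : RiemMetric F (DiagQuotient K)) (p : DiagQuotient K) : F →L[ℝ] F →L[ℝ] ℝ :=
  g.inner p

omit [FiniteDimensional ℝ E] [LieGroup 𝓘(ℝ, E) ∞ H] [FiniteDimensional ℝ F] in
theorem metricForm_symm (g : RiemMetric F (DiagQuotient K)) (p : DiagQuotient K) (v w : F) :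
    metricForm g p v w = metricForm g p w v := g.symm p v w

omit [FiniteDimensional ℝ E] [LieGroup 𝓘(ℝ, E) ∞ H] [FiniteDimensional ℝ F] in
theorem metricForm_pos (g : RiemMetric F (DiagQuotient K)) (p : DiagQuotient K) {v : F}
    (hv : v ≠ 0) : 0 < metricForm g p v v := g.pos p v hv

variable (F K) in
/-- The derivative of the translation by `a` at the base point. -/
def translationDeriv (a : H × H) : F →L[ℝ] F :=
  mfderiv 𝓘(ℝ, F) 𝓘(ℝ, F) (fun x : DiagQuotient K ↦ a • x) ((1 : H × H) : DiagQuotient K)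

omit [FiniteDimensional ℝ F] in
theorem metricForm_translationDeriv {g : RiemMetric F (DiagQuotient K)} (hg : IsInvariantMetric g)
    (a : H × H) (u v : F) :
    metricForm g (a • ((1 : H × H) : DiagQuotient K)) (translationDeriv F K a u)
      (translationDeriv F K a v) = metricForm g ((1 : H × H) : DiagQuotient K) u v :=
  hg a _ u v

/-- For `Z ≠ 0` the pair `(Z, -Z)` is not diagonal, so its image is a nonzero tangent vector, of
positive length. -/
theorem killingForm_neg_of_mem {g : RiemMetric F (DiagQuotient K)} {x₁ x₂ x₃ x₄ : ℝ}
    (hM : IsHomogeneousManifold E F K) (hg : IsMetricOfForm E g x₁ x₂ x₃ x₄) (hx₃ : 0 < x₃)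
    {Z : GroupLieAlgebra 𝓘(ℝ, E) H} (hZ : Z ∈ subgroupLieAlgebra E K) (h0 : Z ≠ 0) :
    killingForm ℝ (GroupLieAlgebra 𝓘(ℝ, E) H) Z Z < 0 := by
  have h1 : mkDeriv E F K (Z, -Z) ≠ 0 := by
    intro h
    have h2 := (eq_and_mem_of_mkDeriv_eq_zero hM h).1
    refine h0 ?_
    have h3 : (2 : ℝ) • Z = 0 := by
      rw [two_smul]; nth_rewrite 2 [h2]; exact add_neg_cancel Z
    simpa using h3
  have h2 := metricForm_pos g ((1 : H × H) : DiagQuotient K) h1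
  have h3 := hg.inner₃₃ Z hZ Z hZ
  simp only [map_neg, LinearMap.neg_apply, neg_neg] at h3
  have h4 : 0 < x₃ * -(killingForm ℝ (GroupLieAlgebra 𝓘(ℝ, E) H) Z Z +
      killingForm ℝ (GroupLieAlgebra 𝓘(ℝ, E) H) Z Z) := h3 ▸ h2
  have := (pos_iff_pos_of_mul_pos h4).1 hx₃
  linarith

theorem killingForm_neg_of_mem_complement {g : RiemMetric F (DiagQuotient K)} {x₁ x₂ x₃ x₄ : ℝ}
    (hM : IsHomogeneousManifold E F K) (hg : IsMetricOfForm E g x₁ x₂ x₃ x₄) (hx₁ : 0 < x₁)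
    {X : GroupLieAlgebra 𝓘(ℝ, E) H} (hX : X ∈ killingComplement E K) (h0 : X ≠ 0) :
    killingForm ℝ (GroupLieAlgebra 𝓘(ℝ, E) H) X X < 0 := by
  have h1 : mkDeriv E F K (X, 0) ≠ 0 := fun h ↦ h0 (eq_and_mem_of_mkDeriv_eq_zero hM h).1
  have h2 := metricForm_pos g ((1 : H × H) : DiagQuotient K) h1
  have h4 : 0 < x₁ * -(killingForm ℝ (GroupLieAlgebra 𝓘(ℝ, E) H) X X) :=
    hg.inner₁₁ X hX X hX ▸ h2
  have := (pos_iff_pos_of_mul_pos h4).1 hx₁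
  linarith

theorem apply_sum_smul {V κ : Type*} [NormedAddCommGroup V] [NormedSpace ℝ V] [Fintype κ]
    [DecidableEq κ] (ip : V →L[ℝ] V →L[ℝ] ℝ) {W : κ → V}
    (hW : ∀ i j, ip (W i) (W j) = if i = j then 1 else 0) (a c : κ → ℝ) :
    ip (∑ i, a i • W i) (∑ i, c i • W i) = ∑ i, a i * c i := by
  simp [sum_apply, hW, mul_comm]

omit [FiniteDimensional ℝ F] in
theorem metricForm_mkDeriv {g : RiemMetric F (DiagQuotient K)} {x₁ x₂ x₄ : ℝ}
    (hM : IsHomogeneousManifold E F K) (hg : IsMetricOfForm E g x₁ x₂ 1 x₄) {n d : ℕ}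
    {X : Fin n → E} {Z : Fin d → E}
    (hX : ∀ i, (X i : GroupLieAlgebra 𝓘(ℝ, E) H) ∈ killingComplement E K)
    (hZ : ∀ a, (Z a : GroupLieAlgebra 𝓘(ℝ, E) H) ∈ subgroupLieAlgebra E K)
    (h : IsSymmetricFrame (lieBracketCLM E H) (negKillingCLM E H) X Z) (v w : E × E) :
    metricForm g ((1 : H × H) : DiagQuotient K) (mkDeriv E F K v) (mkDeriv E F K w) =
      diagForm (partForm (negKillingCLM E H) X) (partForm (negKillingCLM E H) Z) x₁ x₂ x₄ v w := by
  set ip := negKillingCLM E H with hip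
  set B := metricForm g ((1 : H × H) : DiagQuotient K) with hB
  set P := mkDeriv E F K with hP
  let xp (v : E) : E := ∑ i, ip v (X i) • X i
  let zp (v : E) : E := ∑ a, ip v (Z a) • Z a
  have hxp (v : E) : (xp v : GroupLieAlgebra 𝓘(ℝ, E) H) ∈ killingComplement E K :=
    Submodule.sum_mem _ fun i _ ↦ Submodule.smul_mem _ _ (hX i)
  have hzp (v : E) : (zp v : GroupLieAlgebra 𝓘(ℝ, E) H) ∈ subgroupLieAlgebra E K :=
    Submodule.sum_mem _ fun i _ ↦ Submodule.smul_mem _ _ (hZ i)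
  have hsum (v : E) : v = xp v + zp v := h.eq_sum v
  have hzsub (v w : E) : zp (v - w) = zp v - zp w := by
    simp only [zp, map_sub, sub_apply, sub_smul, Finset.sum_sub_distrib]
  have hdec (v : E × E) : P v = P (xp v.1, 0) + P (0, xp v.2) +
      (1 / 2 : ℝ) • P (zp (v.1 - v.2), -zp (v.1 - v.2)) := by
    -- The last summand of this splitting is the diagonal `𝔨`-part, which the projection kills.
    have h1 : v = (xp v.1, 0) + (0, xp v.2) + (1 / 2 : ℝ) • (zp (v.1 - v.2), -zp (v.1 - v.2)) +
        (1 / 2 : ℝ) • (zp v.1 + zp v.2, zp v.1 + zp v.2) := by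
      ext
      · simp only [Prod.fst_add, Prod.smul_fst, hzsub]
        nth_rewrite 1 [hsum v.1]
        module
      · simp only [Prod.snd_add, Prod.smul_snd, hzsub]
        nth_rewrite 1 [hsum v.2]
        module
    have h2 : P (zp v.1 + zp v.2, zp v.1 + zp v.2) = 0 :=
      mkDeriv_diag hM (Submodule.add_mem _ (hzp v.1) (hzp v.2))
    nth_rewrite 1 [h1]
    simp only [map_add, map_smul, h2, smul_zero, add_zero]
  have hx (v w : E) : ip (xp v) (xp w) = partForm ip X v w := by
    rw [partForm_apply]; exact apply_sum_smul ip h.ip_X_X _ _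
  have hz (v w : E) : ip (zp v) (zp w) = partForm ip Z v w := by
    rw [partForm_apply]; exact apply_sum_smul ip h.ip_Z_Z _ _
  have e11 (v w : E) : B (P (xp v, 0)) (P (xp w, 0)) = x₁ * partForm ip X v w := by
    rw [← hx]; exact hg.inner₁₁ _ (hxp v) _ (hxp w)
  have e22 (v w : E) : B (P (0, xp v)) (P (0, xp w)) = x₂ * partForm ip X v w := by
    rw [← hx]; exact hg.inner₂₂ _ (hxp v) _ (hxp w)
  have e12 (v w : E) : B (P (xp v, 0)) (P (0, xp w)) = x₄ * partForm ip X v w := by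
    rw [← hx]; exact hg.inner₁₂ _ (hxp v) _ (hxp w)
  have e13 (v w : E) : B (P (xp v, 0)) (P (zp w, -zp w)) = 0 :=
    hg.inner₁₃ _ (hxp v) _ (hzp w)
  have e23 (v w : E) : B (P (0, xp v)) (P (zp w, -zp w)) = 0 :=
    hg.inner₂₃ _ (hxp v) _ (hzp w)
  have e33 (v w : E) : B (P (zp v, -zp v)) (P (zp w, -zp w)) = 2 * partForm ip Z v w := by
    have h1 : B (P (zp v, -zp v)) (P (zp w, -zp w)) =
        1 * -(killingForm ℝ (GroupLieAlgebra 𝓘(ℝ, E) H) (zp v) (zp w) +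
          killingForm ℝ (GroupLieAlgebra 𝓘(ℝ, E) H) (-zp v) (-zp w)) :=
      hg.inner₃₃ _ (hzp v) _ (hzp w)
    have h2 (u w : GroupLieAlgebra 𝓘(ℝ, E) H) :
        1 * -(killingForm ℝ (GroupLieAlgebra 𝓘(ℝ, E) H) u w +
          killingForm ℝ (GroupLieAlgebra 𝓘(ℝ, E) H) (-u) (-w)) =
        2 * -killingForm ℝ (GroupLieAlgebra 𝓘(ℝ, E) H) u w := by
      simp only [map_neg, LinearMap.neg_apply]
      ring
    exact h1.trans ((h2 _ _).trans (congrArg (2 * ·) (hz v w)))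
  have hs (v w : F) : B v w = B w v := metricForm_symm g _ v w
  rw [hdec v, hdec w, diagForm_apply]
  simp only [map_add, map_smul, add_apply, smul_apply, smul_eq_mul, e11, e22, e12, e13, e23, e33,
    hs (P (0, xp v.2)) (P (xp w.1, 0)), hs (P (zp (v.1 - v.2), _)) (P (xp w.1, 0)),
    hs (P (zp (v.1 - v.2), _)) (P (0, xp w.2))]
  rw [partForm_symm ip X w.1 v.2]
  ring

end InvariantMetric

/-! ### Moving frames from local sections. -/

section MovingFrame

variable {E : Type*} [NormedAddCommGroup E] [NormedSpace ℝ E] [FiniteDimensional ℝ E]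
  {H : Type*} [TopologicalSpace H] [ChartedSpace E H] [Group H] [LieGroup 𝓘(ℝ, E) ∞ H]
  {F : Type*} [NormedAddCommGroup F] [NormedSpace ℝ F] [FiniteDimensional ℝ F]
  {K : Subgroup H} [ChartedSpace F (DiagQuotient K)]

/-- The pullback of the Maurer-Cartan form of `H × H` under the map `s`. -/
def mcFormProd (s : F → H × H) (y : F) : F →L[ℝ] E × E :=
  (mcForm (fun z ↦ (s z).1) y).prod (mcForm (fun z ↦ (s z).2) y)

omit [FiniteDimensional ℝ E] [FiniteDimensional ℝ F] in
theorem mfderiv_inv_mul_eq_mcFormProd {s : F → H × H} {y : F}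
    (hs : MDifferentiableAt 𝓘(ℝ, F) (𝓘(ℝ, E).prod 𝓘(ℝ, E)) s y) :
    (mfderiv 𝓘(ℝ, F) (𝓘(ℝ, E).prod 𝓘(ℝ, E)) (fun z ↦ (s y)⁻¹ * s z) y : F →L[ℝ] E × E) =
      mcFormProd s y := by
  have h1 : MDifferentiableAt 𝓘(ℝ, F) 𝓘(ℝ, E) (fun z ↦ (s y).1⁻¹ * (s z).1) y :=
    ((contMDiff_mul_left (n := ∞)).mdifferentiableAt (by simp)).comp y
      (mdifferentiableAt_fst.comp y hs)
  have h2 : MDifferentiableAt 𝓘(ℝ, F) 𝓘(ℝ, E) (fun z ↦ (s y).2⁻¹ * (s z).2) y :=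
    ((contMDiff_mul_left (n := ∞)).mdifferentiableAt (by simp)).comp y
      (mdifferentiableAt_snd.comp y hs)
  exact mfderiv_prodMk h1 h2

omit [FiniteDimensional ℝ E] [FiniteDimensional ℝ F] in
theorem contDiffAt_mcFormProd {s : F → H × H} {y : F}
    (hs : ContMDiffAt 𝓘(ℝ, F) (𝓘(ℝ, E).prod 𝓘(ℝ, E)) ∞ s y) :
    ContDiffAt ℝ ∞ (mcFormProd (E := E) s) y := by
  have h1 := contDiffAt_mcForm (E := E) (contMDiffAt_fst.comp y hs)
  have h2 := contDiffAt_mcForm (E := E) (contMDiffAt_snd.comp y hs)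
  exact (ContinuousLinearMap.prodₗᵢ (𝕜 := ℝ) (E := F) (F := E) (G := E)
    ℝ).contDiff.contDiffAt.comp y (h1.prodMk h2)

omit [FiniteDimensional ℝ F] in
theorem maurerCartan_prod {s : F → H × H} {y : F}
    (hs : ContMDiffAt 𝓘(ℝ, F) (𝓘(ℝ, E).prod 𝓘(ℝ, E)) 2 s y)
    (hd : DifferentiableAt ℝ (mcForm (E := E) fun z ↦ (s z).1) y)
    (hd' : DifferentiableAt ℝ (mcForm (E := E) fun z ↦ (s z).2) y) (u v : F) :
    fderiv ℝ (mcFormProd (E := E) s) y u v - fderiv ℝ (mcFormProd (E := E) s) y v u =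
      -prodBracket (lieBracketCLM E H) (mcFormProd s y u) (mcFormProd s y v) := by
  have h1 := maurerCartan (E := E) (contMDiffAt_fst.comp y hs) u v
  have h2 := maurerCartan (E := E) (contMDiffAt_snd.comp y hs) u v
  have h3 : HasFDerivAt (mcFormProd (E := E) s) _ y :=
    (ContinuousLinearMap.prodₗᵢ (𝕜 := ℝ) (E := F) (F := E) (G := E)
      ℝ).toContinuousLinearEquiv.hasFDerivAt.comp y
    (hd.hasFDerivAt.prodMk hd'.hasFDerivAt)
  rw [h3.fderiv, prodBracket_apply]
  exact Prod.ext h1 h2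

omit [FiniteDimensional ℝ E] [FiniteDimensional ℝ F] [LieGroup 𝓘(ℝ, E) ∞ H] in
theorem translationDeriv_injective (hM : IsHomogeneousManifold E F K) (a : H × H) :
    Function.Injective (translationDeriv F K a) := by
  have hsm := hM.contMDiffSMul
  have h0 (a : H × H) (x : DiagQuotient K) :
      MDifferentiableAt 𝓘(ℝ, F) 𝓘(ℝ, F) (fun x : DiagQuotient K ↦ a • x) x :=
    (ContMDiffSMul.contMDiff_const_smul (I := 𝓘(ℝ, E).prod 𝓘(ℝ, E)) (n := ∞) a).mdifferentiableAt (by simp)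
  have h1 := mfderiv_comp_model (h0 a⁻¹ _) (h0 a ((1 : H × H) : DiagQuotient K)) rfl
  have h2 : (fun x : DiagQuotient K ↦ a⁻¹ • a • x) = id := by ext x; exact inv_smul_smul a x
  rw [h2, mfderiv_id] at h1
  intro u v huv
  have h3 (w : F) : w = (mfderiv 𝓘(ℝ, F) 𝓘(ℝ, F) (fun x : DiagQuotient K ↦ a⁻¹ • x)
      (a • ((1 : H × H) : DiagQuotient K)) : F →L[ℝ] F) (translationDeriv F K a w) :=
    congrArg (fun L : F →L[ℝ] F ↦ L w) h1
  rw [h3 u, h3 v, huv]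

variable [IsManifold 𝓘(ℝ, F) ∞ (DiagQuotient K)]

theorem exists_moving_frame (hM : IsHomogeneousManifold E F K) (a : H × H)
    {ι : Type*} [Fintype ι] (ε : ι → E × E) (b : Module.Basis ι ℝ F)
    (hb : ∀ i, b i = mkDeriv E F K (ε i)) (p : DiagQuotient K)
    (hp : a • ((1 : H × H) : DiagQuotient K) = p) :
    ∃ (α : F → F →L[ℝ] E × E) (f : Module.Basis ι ℝ F),
      (∀ i, f i = translationDeriv F K a (b i)) ∧
      ContDiffAt ℝ 2 α (extChartAt 𝓘(ℝ, F) p p) ∧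
      (∀ᶠ z in nhds (extChartAt 𝓘(ℝ, F) p p), ∀ u v, fderiv ℝ α z u v - fderiv ℝ α z v u =
        -prodBracket (lieBracketCLM E H) (α z u) (α z v)) ∧
      (∀ i, α (extChartAt 𝓘(ℝ, F) p p) (f i) = ε i) ∧
      ∀ g : RiemMetric F (DiagQuotient K), IsInvariantMetric g →
        coordMetric g p =ᶠ[nhds (extChartAt 𝓘(ℝ, F) p p)] fun z ↦
          ((metricForm g ((1 : H × H) : DiagQuotient K)).bilinearComp (mkDeriv E F K)
            (mkDeriv E F K)).bilinearComp (α z) (α z) := by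
  have hsm := hM.contMDiffSMul
  have hact (a : H × H) (x : DiagQuotient K) :
      MDifferentiableAt 𝓘(ℝ, F) 𝓘(ℝ, F) (fun x : DiagQuotient K ↦ a • x) x :=
    (ContMDiffSMul.contMDiff_const_smul (I := 𝓘(ℝ, E).prod 𝓘(ℝ, E)) (n := ∞) a).mdifferentiableAt (by simp)
  subst hp
  let q : H × H → DiagQuotient K := fun x ↦ a • (x : DiagQuotient K)
  have hmk : MDifferentiableAt (𝓘(ℝ, E).prod 𝓘(ℝ, E)) 𝓘(ℝ, F)
      (fun a : H × H ↦ (a : DiagQuotient K)) 1 := (hM.contMDiff_mk 1).mdifferentiableAt (by simp)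
  have hq : ContMDiffAt (𝓘(ℝ, E).prod 𝓘(ℝ, E)) 𝓘(ℝ, F) ∞ q 1 :=
    (ContMDiffSMul.contMDiff_const_smul (I := 𝓘(ℝ, E).prod 𝓘(ℝ, E)) (n := ∞) a).contMDiffAt.comp 1
      (hM.contMDiff_mk 1)
  set T := translationDeriv F K a with hT
  have hqd : (mfderiv (𝓘(ℝ, E).prod 𝓘(ℝ, E)) 𝓘(ℝ, F) q 1 : E × E →L[ℝ] F) =
      T.comp (mkDeriv E F K) := mfderiv_comp_model (hact a _) hmk rfl
  let T' : F ≃ₗ[ℝ] F := LinearEquiv.ofBijective (T : F →ₗ[ℝ] F)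
    ⟨translationDeriv_injective hM a, (LinearMap.injective_iff_surjective (f := (T : F →ₗ[ℝ] F))).1
      (translationDeriv_injective hM a)⟩
  let f : Module.Basis ι ℝ F := b.map T'
  have hf (i : ι) : f i = T (b i) := rfl
  -- Prescribing `L` as the derivative of the section makes `α` take the values `εᵢ` on the basis
  -- `f`, since the section passes through `1`.
  let L : F →L[ℝ] E × E := LinearMap.toContinuousLinearMap (f.constr ℝ ε)
  have hL (i : ι) : L (f i) = ε i := f.constr_basis ℝ ε i
  have hqL (u : F) : (mfderiv (𝓘(ℝ, E).prod 𝓘(ℝ, E)) 𝓘(ℝ, F) q 1 : E × E →L[ℝ] F) (L u) = u := by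
    rw [hqd]
    have : ((T.comp (mkDeriv E F K)).comp L : F →ₗ[ℝ] F) = LinearMap.id :=
      f.ext fun i ↦ by
        change T (mkDeriv E F K (L (f i))) = f i
        rw [hL, ← hb, hf]
    exact congrArg (fun S : F →ₗ[ℝ] F ↦ S u) this
  obtain ⟨s, hs0, hs, hsd, hqs⟩ := exists_section_of_mfderiv_comp hq hqL
  set y₀ := extChartAt 𝓘(ℝ, F) (q 1) (q 1) with hy₀
  have hman : IsManifold (𝓘(ℝ, E).prod 𝓘(ℝ, E)) 2 (H × H) :=
    IsManifold.of_le (n := ∞) ENat.LEInfty.out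
  have hs2 : ∀ᶠ z in nhds y₀, ContMDiffAt 𝓘(ℝ, F) (𝓘(ℝ, E).prod 𝓘(ℝ, E)) 2 s z :=
    (contMDiffAt_iff_contMDiffAt_nhds (by simp)).1 (hs.of_le ENat.LEInfty.out)
  have hα := contDiffAt_mcFormProd hs
  have hdiff {s₁ : F → H} (h : ContMDiffAt 𝓘(ℝ, F) 𝓘(ℝ, E) ∞ s₁ y₀) :
      ∀ᶠ z in nhds y₀, DifferentiableAt ℝ (mcForm (E := E) s₁) z := by
    filter_upwards [((contDiffAt_mcForm h).of_le (m := 1) (by simp)).eventually (by simp)] with z hz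
      using hz.differentiableAt (by simp)
  refine ⟨mcFormProd s, f, hf, hα.of_le ENat.LEInfty.out, ?_, fun i ↦ ?_, fun g hg ↦ ?_⟩
  · filter_upwards [hs2, hdiff (contMDiffAt_fst.comp y₀ hs), hdiff (contMDiffAt_snd.comp y₀ hs)]
      with z h1 h2 h3 u v using maurerCartan_prod h1 h2 h3 u v
  · have h1 := mfderiv_inv_mul_eq_mcFormProd (hs.mdifferentiableAt (by simp))
    have h2 : (fun z ↦ (s y₀)⁻¹ * s z) = s := by ext1 z; rw [hs0, inv_one, one_mul]
    rw [h2] at h1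
    change mcFormProd s y₀ (f i) = ε i
    rw [← h1, hsd, hL]
  · filter_upwards [hs2, hqs.eventually_nhds] with z hz hqz
    have hsz : MDifferentiableAt 𝓘(ℝ, F) (𝓘(ℝ, E).prod 𝓘(ℝ, E)) s z :=
      hz.mdifferentiableAt (by simp)
    have hsz' : MDifferentiableAt 𝓘(ℝ, F) (𝓘(ℝ, E).prod 𝓘(ℝ, E)) (fun x ↦ (s z)⁻¹ * s x) z :=
      ((contMDiff_mul_left (n := ∞)).mdifferentiableAt (by simp)).comp z hsz
    have h1 := mfderiv_comp_model hmk hsz' (inv_mul_cancel _)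
    have hmkz : MDifferentiableAt 𝓘(ℝ, F) 𝓘(ℝ, F)
        (fun x ↦ (((s z)⁻¹ * s x : H × H) : DiagQuotient K)) z :=
      MDifferentiableAt.comp_of_eq z hmk hsz' (inv_mul_cancel _)
    have h2 := mfderiv_comp_model (hact (a * s z) _) hmkz
      (y := ((1 : H × H) : DiagQuotient K)) (by rw [inv_mul_cancel])
    -- Near `z` the inverse chart is the translation by `a s(z)` of the projection of `s(z)⁻¹ s(x)`.
    -- Its derivative at `z` is therefore a translation applied to the projected Maurer–Cartan form,
    -- and invariance of `g` removes the translation.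
    have h3 : (extChartAt 𝓘(ℝ, F) (q 1)).symm =ᶠ[nhds z]
        fun x ↦ (a * s z) • (((s z)⁻¹ * s x : H × H) : DiagQuotient K) := by
      filter_upwards [hqz] with x hx
      rw [← hx, mul_smul]
      change a • (s x : DiagQuotient K) = a • (((s z * ((s z)⁻¹ * s x) : H × H)) : DiagQuotient K)
      rw [mul_inv_cancel_left]
    have h4 : (mfderiv 𝓘(ℝ, F) 𝓘(ℝ, F) (extChartAt 𝓘(ℝ, F) (q 1)).symm z : F →L[ℝ] F) =
        (translationDeriv F K (a * s z)).comp ((mkDeriv E F K).comp (mcFormProd s z)) := by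
      rw [← mfderiv_inv_mul_eq_mcFormProd hsz]
      exact h3.mfderiv_eq.trans (h2.trans (congrArg _ h1))
    have h5 : (extChartAt 𝓘(ℝ, F) (q 1)).symm z =
        (a * s z) • ((1 : H × H) : DiagQuotient K) := by
      refine h3.self_of_nhds.trans ?_
      change (a * s z) • (((s z)⁻¹ * s z : H × H) : DiagQuotient K) = _
      rw [inv_mul_cancel]
    have h6 (p : DiagQuotient K) (A : F →L[ℝ] F)
        (hp : p = (a * s z) • ((1 : H × H) : DiagQuotient K))
        (hA : A = (translationDeriv F K (a * s z)).comp ((mkDeriv E F K).comp (mcFormProd s z))) :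
        (metricForm g p).bilinearComp A A =
          ((metricForm g ((1 : H × H) : DiagQuotient K)).bilinearComp (mkDeriv E F K)
            (mkDeriv E F K)).bilinearComp (mcFormProd s z) (mcFormProd s z) := by
      subst hp hA
      ext u v
      exact metricForm_translationDeriv hg _ _ _
    exact h6 _ _ h5 h4

end MovingFrame

/-! ### The volume factor. -/

section RelativeDeterminant

variable {E : Type*} [NormedAddCommGroup E] [NormedSpace ℝ E] {n d : ℕ}
  {br : E →L[ℝ] E →L[ℝ] E} {ip : E →L[ℝ] E →L[ℝ] ℝ} {X : Fin n → E} {Z : Fin d → E}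

open scoped Kronecker in
-- For the standard metric the Gram matrix is block diagonal, with blocks `UUᵀ ⊗ 1ₙ` and `1_d`.
theorem IsSymmetricFrame.det_diagForm_standard (h : IsSymmetricFrame br ip X Z)
    (U : Fin 2 → Fin 2 → ℝ) :
    (Matrix.of fun i j ↦ diagForm (partForm ip X) (partForm ip Z) 1 1 0 (diagFrame X Z U i)
      (diagFrame X Z U j)).det = ((Matrix.of U).det ^ 2) ^ n := by
  have h2 : (√2)⁻¹ * (√2)⁻¹ = (1 / 2 : ℝ) := by
    rw [← mul_inv, Real.mul_self_sqrt (by norm_num)]; norm_num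
  have h1 : (Matrix.of fun i j ↦ diagForm (partForm ip X) (partForm ip Z) 1 1 0
      (diagFrame X Z U i) (diagFrame X Z U j)) =
      Matrix.fromBlocks ((Matrix.of U * (Matrix.of U).transpose) ⊗ₖ (1 : Matrix (Fin n) (Fin n) ℝ))
        0 0 (1 : Matrix (Fin d) (Fin d) ℝ) := by
    ext i j
    rcases i with ⟨s, i⟩ | a <;> rcases j with ⟨t, j⟩ | b
    · rw [Matrix.of_apply, h.diagForm_inl]
      simp [diagFrame, h.ip_X_X, Matrix.one_apply, Matrix.mul_apply]
      split_ifs <;> ring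
    · rw [Matrix.of_apply, h.diagForm_inr]
      simp [diagFrame, h.ip_X_Z]
    · rw [Matrix.of_apply, h.diagForm_inl]
      simp [diagFrame, h.ip_Z_X]
    · rw [Matrix.of_apply, h.diagForm_inr]
      simp only [diagFrame, Sum.elim_inr, map_smul, map_neg, smul_apply, neg_apply, h.ip_Z_Z,
        Matrix.fromBlocks_apply₂₂, Matrix.one_apply, smul_eq_mul]
      split_ifs
      · linear_combination 2 * h2
      · ring
  rw [h1, Matrix.det_fromBlocks_zero₂₁, Matrix.det_kronecker]
  simp [Matrix.det_mul, Matrix.det_transpose, sq]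

end RelativeDeterminant

/-! ### Assembling curvature and volume. -/

section ScalarCurvature

variable {E : Type*} [NormedAddCommGroup E] [NormedSpace ℝ E] [FiniteDimensional ℝ E]
  {H : Type*} [TopologicalSpace H] [ChartedSpace E H] [Group H] [LieGroup 𝓘(ℝ, E) ∞ H]
  {F : Type*} [NormedAddCommGroup F] [NormedSpace ℝ F] [FiniteDimensional ℝ F]
  {K : Subgroup H} [ChartedSpace F (DiagQuotient K)]
  [IsManifold 𝓘(ℝ, F) ∞ (DiagQuotient K)]

omit [FiniteDimensional ℝ E] [LieGroup 𝓘(ℝ, E) ∞ H] [FiniteDimensional ℝ F] in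
-- Orthonormality gives independence. For spanning, the remainder of a frame expansion has length
-- zero, so positivity of `g` forces its image to vanish.
theorem exists_basis_mkDeriv (hM : IsHomogeneousManifold E F K) {ι : Type*} [Fintype ι]
    [DecidableEq ι] (g : RiemMetric F (DiagQuotient K)) (ε : ι → E × E)
    {Q : E × E →L[ℝ] E × E →L[ℝ] ℝ}
    (hQ : ∀ v w, metricForm g ((1 : H × H) : DiagQuotient K) (mkDeriv E F K v)
      (mkDeriv E F K w) = Q v w)
    (hε : ∀ i j, Q (ε i) (ε j) = if i = j then 1 else 0)
    (hker : ∀ v z, Q (v - ∑ j, Q v (ε j) • ε j) z = 0) :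
    ∃ b : Module.Basis ι ℝ F, ∀ i, b i = mkDeriv E F K (ε i) := by
  have hli : LinearIndependent ℝ fun i ↦ mkDeriv E F K (ε i) := by
    rw [Fintype.linearIndependent_iff]
    intro c hc j
    have h1 := congrArg (fun v ↦ metricForm g ((1 : H × H) : DiagQuotient K) v
      (mkDeriv E F K (ε j))) hc
    simpa [sum_apply, hQ, hε] using h1
  have hspan : ⊤ ≤ Submodule.span ℝ (Set.range fun i ↦ mkDeriv E F K (ε i)) := by
    rintro u -
    obtain ⟨v, hv⟩ : ∃ v, mkDeriv E F K v = u := hM.surjective_mfderiv_mk 1 u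
    have h1 : mkDeriv E F K (v - ∑ j, Q v (ε j) • ε j) = 0 := by
      by_contra h0
      exact (metricForm_pos g ((1 : H × H) : DiagQuotient K) h0).ne' ((hQ _ _).trans (hker v _))
    rw [map_sub, map_sum, sub_eq_zero, hv] at h1
    rw [h1]
    refine Submodule.sum_mem _ fun j _ ↦ ?_
    rw [map_smul]
    exact Submodule.smul_mem _ _ (Submodule.subset_span ⟨j, rfl⟩)
  exact ⟨Module.Basis.mk hli hspan, fun i ↦ Module.Basis.mk_apply hli hspan i⟩

theorem normalizedScalarCurvature_eq (hM : IsHomogeneousManifold E F K) {d n : ℕ}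
    {X : Fin n → E} {Z : Fin d → E}
    (hX : ∀ i, (X i : GroupLieAlgebra 𝓘(ℝ, E) H) ∈ killingComplement E K)
    (hZ : ∀ a, (Z a : GroupLieAlgebra 𝓘(ℝ, E) H) ∈ subgroupLieAlgebra E K)
    (h : IsSymmetricFrame (lieBracketCLM E H) (negKillingCLM E H) X Z) {x₁ x₂ x₄ : ℝ}
    (hx₁ : 0 < x₁) (hD : 0 < x₁ * x₂ - x₄ ^ 2)
    {gK g : RiemMetric F (DiagQuotient K)} (hgK : IsMetricOfForm E gK 1 1 1 0)
    (hg : IsMetricOfForm E g x₁ x₂ 1 x₄) (p : DiagQuotient K) :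
    normalizedScalarCurvature gK g p =
      (8 * d * (x₄ ^ 2 - x₁ * x₂) ^ 2 -
        n * (x₂ ^ 2 + x₁ ^ 2 * (4 * x₂ ^ 2 - 8 * x₂ + 1) - 2 * x₄ ^ 2 + 8 * x₂ * x₄ ^ 2
          - 4 * x₄ ^ 4 - 8 * x₁ * (x₂ ^ 2 - x₄ ^ 2))) / (16 * (x₄ ^ 2 - x₁ * x₂) ^ 2) *
        (x₁ * x₂ - x₄ ^ 2) ^ ((n : ℝ) / (d + 2 * n)) := by
  obtain ⟨U, hU, hM₁₁, hM₁₂, hM₂₂⟩ := exists_orthonormal_pair hx₁ hD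
  have hQ := metricForm_mkDeriv hM hg hX hZ h
  have hε := h.diagForm_orthonormal hU
  have hker := h.diagForm_complete hM₁₁ hM₁₂ hM₂₂ hD.ne'
  obtain ⟨b, hb⟩ := exists_basis_mkDeriv hM g (diagFrame X Z U) hQ hε hker
  obtain ⟨a, ha⟩ : ∃ a : H × H, a • ((1 : H × H) : DiagQuotient K) = p := by
    obtain ⟨a, rfl⟩ := QuotientGroup.mk_surjective p
    exact ⟨a, congrArg QuotientGroup.mk (mul_one a)⟩
  obtain ⟨α, f, hf, hα, hMC, hαf, hG⟩ := exists_moving_frame hM a (diagFrame X Z U) b hb p ha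
  have hβ (v w : E × E) : prodBracket (lieBracketCLM E H) v w =
      -prodBracket (lieBracketCLM E H) w v := by
    rw [prodBracket_apply, prodBracket_apply, h.br_skew v.1, h.br_skew v.2, Prod.neg_mk]
  have hsymm (v w : E × E) :
      diagForm (partForm (negKillingCLM E H) X) (partForm (negKillingCLM E H) Z) x₁ x₂ x₄ v w =
        diagForm (partForm (negKillingCLM E H) X) (partForm (negKillingCLM E H) Z) x₁ x₂ x₄ w v := by
    rw [← hQ, ← hQ, metricForm_symm]
  have hG' : coordMetric g p =ᶠ[nhds (extChartAt 𝓘(ℝ, F) p p)] fun z ↦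
      (diagForm (partForm (negKillingCLM E H) X) (partForm (negKillingCLM E H) Z)
        x₁ x₂ x₄).bilinearComp (α z) (α z) := by
    filter_upwards [hG g hg.invariant] with z hz
    rw [hz]
    ext u v
    exact hQ _ _
  have hcurv := scalarCurvatureCoord_of_maurerCartan hβ hsymm hε hker
    (h.diagForm_invariant hD.ne') h.unimodular hα hMC hG' f hαf
  have hgram {x₁ x₂ x₄ : ℝ} {g : RiemMetric F (DiagQuotient K)}
      (hg : IsMetricOfForm E g x₁ x₂ 1 x₄) (i j) : metricForm g p (f i) (f j) =
        diagForm (partForm (negKillingCLM E H) X) (partForm (negKillingCLM E H) Z) x₁ x₂ x₄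
          (diagFrame X Z U i) (diagFrame X Z U j) := by
    rw [← metricForm_mkDeriv hM hg hX hZ h, hf, hf, ← hb, ← hb, ← ha]
    exact metricForm_translationDeriv hg.invariant _ _ _
  have hdetU : (Matrix.of U).det ^ 2 = (x₁ * x₂ - x₄ ^ 2)⁻¹ := by
    rw [Matrix.det_fin_two]
    simp only [Matrix.of_apply]
    have h1 : (U 0 0 * U 1 1 - U 0 1 * U 1 0) ^ 2 =
        (U 0 0 ^ 2 + U 1 0 ^ 2) * (U 0 1 ^ 2 + U 1 1 ^ 2) -
          (U 0 0 * U 0 1 + U 1 0 * U 1 1) ^ 2 := by ring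
    rw [h1, hM₁₁, hM₁₂, hM₂₂]
    have := hD.ne'
    field_simp
  -- The frame is orthonormal for `g`, so the relative determinant is the reciprocal of the Gram
  -- determinant of `gK`, which is `((x₁x₂ - x₄²)⁻¹)ⁿ`.
  have hdet : relDet (metricForm gK p) (metricForm g p) = (x₁ * x₂ - x₄ ^ 2) ^ n := by
    rw [relDet_eq_basis f]
    simp only [hgram hg, hgram hgK]
    rw [h.det_diagForm_standard, hdetU]
    have h1 : (Matrix.of fun i j ↦ diagForm (partForm (negKillingCLM E H) X)
        (partForm (negKillingCLM E H) Z) x₁ x₂ x₄ (diagFrame X Z U i) (diagFrame X Z U j)) = 1 := by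
      ext i j
      rw [Matrix.of_apply, hε, Matrix.one_apply]
    rw [h1, Matrix.det_one, inv_pow, one_div, inv_inv]
  have hdim : (Module.finrank ℝ F : ℝ) = d + 2 * n := by
    rw [Module.finrank_eq_card_basis b]
    simp [add_comm]
  rw [h.scalar_sum hD.ne' hU hM₁₁ hM₁₂ hM₂₂] at hcurv
  change scalarCurvatureCoord (coordMetric g p) (extChartAt 𝓘(ℝ, F) p p) *
    relDet (metricForm gK p) (metricForm g p) ^ _ = _
  rw [hcurv, hdet, hdim, ← Real.rpow_natCast _ n, ← Real.rpow_mul hD.le, mul_one_div]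

end ScalarCurvature

end

theorem corollary3p4
    {E : Type*} [NormedAddCommGroup E] [NormedSpace ℝ E] [FiniteDimensional ℝ E]
    {H : Type*} [TopologicalSpace H] [ChartedSpace E H] [Group H] [LieGroup 𝓘(ℝ, E) ∞ H]
    [T2Space H] [CompactSpace H] [LieAlgebra.IsSimple ℝ (GroupLieAlgebra 𝓘(ℝ, E) H)]
    (K : Subgroup H) (hK : IsIrreducibleSymmetric E K)
    {F : Type*} [NormedAddCommGroup F] [NormedSpace ℝ F] [FiniteDimensional ℝ F]
    [ChartedSpace F (DiagQuotient K)] [IsManifold 𝓘(ℝ, F) ∞ (DiagQuotient K)]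
    (hM : IsHomogeneousManifold E F K)
    (d n : ℕ) (hd : Module.finrank ℝ (subgroupLieAlgebra E K) = d)
    (hn : Module.finrank ℝ E = d + n)
    (x₁ x₂ x₄ : ℝ) (hx₁ : 0 < x₁) (hx₂ : 0 < x₂) (hx₄ : x₄ ^ 2 < x₁ * x₂)
    (gK : RiemMetric F (DiagQuotient K)) (hgK : IsMetricOfForm E gK 1 1 1 0)
    (g : RiemMetric F (DiagQuotient K)) (hg : IsMetricOfForm E g x₁ x₂ 1 x₄)
    (p : DiagQuotient K) :
    normalizedScalarCurvature gK g p =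
      (x₁ * x₂ - x₄ ^ 2) ^ ((n : ℝ) / (d + 2 * n)) *
        (8 * d * (x₄ ^ 2 - x₁ * x₂) ^ 2 -
          n * (x₂ ^ 2 + x₁ ^ 2 * (4 * x₂ ^ 2 - 8 * x₂ + 1) - 2 * x₄ ^ 2 + 8 * x₂ * x₄ ^ 2
            - 4 * x₄ ^ 4 - 8 * x₁ * (x₂ ^ 2 - x₄ ^ 2))) /
        (16 * (x₄ ^ 2 - x₁ * x₂) ^ 2) := by
  obtain ⟨θ, hθ, hinv, -, hfix, hcomp⟩ := hK.exists_involution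
  -- The standard metric is a positive multiple of minus the Killing form on `𝔨` and on `𝔮`, so its
  -- positivity supplies the required definiteness.
  obtain ⟨X, Z, hX, hZ, h⟩ := exists_isSymmetricFrame hθ hinv hfix hcomp
    (fun v hv h0 ↦ killingForm_neg_of_mem hM hgK one_pos hv h0)
    (fun v hv h0 ↦ killingForm_neg_of_mem_complement hM hgK one_pos hv h0) hd hn
  rw [normalizedScalarCurvature_eq hM hX hZ h hx₁ (sub_pos.2 hx₄) hgK hg p]
  ring
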